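/- **Setting.** Let $\mathcal R>0$, let $q\ge 1$ be an integer, and consider $$\frac{dr}{dt}=f(r,\varphi,S(t),t),\qquad \frac{d\varphi}{dt}=\omega(r)+g(r,\varphi,S(t),t),\tag{1}$$ where $\omega(r)>0$, $f$, $g$ are infinitely differentiable for $|r|\le\mathcal R$, $(\varphi,S)\in\mathbb R^2$, $t>0$, and $f,g$ are $2\pi$-periodic in $\varphi$ and in $S$. Assume that $f\sim\sum_{j\ge1}t^{-j/q}f_j(r,\varphi,S)$ and $g\sim\sum_{j\ge1}t^{-j/q}g_j(r,\varphi,S)$ as $t\to\infty$, with $f_j,g_j$ infinitely differentiable and $2\pi$-periodic in $\varphi$ and $S$, in the sense that for every $N\ge1$ one has $f-\sum_{j=1}^{N-1}t^{-j/q}f_j=O(t^{-N/q})$, and likewise for $g$, uniformly in $|r|\le\mathcal R$, $(\varphi,S)\in\mathbb R^2$. Let $S(t)=s_0t+\sum_{j=1}^{q-1}s_jt^{1-j/q}+s_q\log t$ with constants $s_j$, $s_0>0$. Assume that there are $a$ with $0<|a|<\mathcal R$ and coprime positive integers $\kappa,\varkappa$ such that $\kappa s_0=\varkappa\,\omega(a)$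 and $\eta:=\omega'(a)\ne0$. **Averaged coefficients.** With $r=a+t^{-1/(2q)}R$, $\varphi=\frac{\kappa}{\varkappa}S(t)+\Psi$, system (1) becomes $\dot R\sim\sum_{k\ge1}t^{-k/(2q)}F_k(R,\Psi,S)$, $\dot\Psi\sim\sum_{k\ge1}t^{-k/(2q)}G_k(R,\Psi,S)$, where, with $\sigma_k$ the coefficient of $t^{-k/(2q)}$ in $S'(t)$ and $\delta$ the Kronecker delta, $$F_k=\sum_{i+2j=k+1,\ i\ge0,\ j\ge1}\partial_r^if_j\!\left(a,\tfrac{\kappa}{\varkappa}S+\Psi,S\right)\frac{R^i}{i!}+\delta_{k,2q}\frac{R}{2q},$$ $$G_k=\omega^{(k)}(a)\frac{R^k}{k!}-\frac{\kappa}{\varkappa}\sigma_k+\sum_{i+2j=k,\ i\ge0,\ j\ge1}\partial_r^ig_j\!\left(a,\tfrac{\kappa}{\varkappa}S+\Psi,S\right)\frac{R^i}{i!}.$$ Let $\langle\cdot\rangle$ be the mean over $S\in[0,2\pi\varkappa]$. Define successively for $k=1,2,\dots$ $$\begin{pmatrix}\Lambda_k\\ \Omega_k\end{pmatrix}=\left\langle\begin{pmatrix}F_k-\tilde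 F_k\\ G_k-\tilde G_k\end{pmatrix}\right\rangle,\qquad s_0\,\partial_S\begin{pmatrix}u_k\\ v_k\end{pmatrix}=\begin{pmatrix}\Lambda_k-F_k+\tilde F_k\\ \Omega_k-G_k+\tilde G_k\end{pmatrix},\qquad \langle u_k\rangle=\langle v_k\rangle=0,$$ where $$\begin{pmatrix}\tilde F_k\\ \tilde G_k\end{pmatrix}=\sum_{j=1}^{k-1}[\tau^{k-j}]\begin{pmatrix}\Lambda_j\\ \Omega_j\end{pmatrix}\!\Big(R+\sum_{i=1}^{k-j}\tau^iu_i,\ \Psi+\sum_{i=1}^{k-j}\tau^iv_i\Big)-\sum_{j=1}^{k-1}\Big(F_j\partial_R+G_j\partial_\Psi+\sigma_j\partial_S+\delta_{j,2q}\tfrac{2q-k}{2q}\Big)\begin{pmatrix}u_{k-j}\\ v_{k-j}\end{pmatrix}$$ and $[\tau^p]$ denotes the Taylor coefficient of $\tau^p$ at $\tau=0$. In particular $\Lambda_1(\rho,\psi)=\langle f_1(a,\kappa S/\varkappa+\psi,S)\rangle$ and $\Omega_1(\rho,\psi)=\eta\rho$. **Assumptions.** Let $n\in[1,2q]$, $m\in[2,2q]$,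 $h\in(\min\{m,n\},2q]$ be integers and $\psi_0\in\mathbb R$ such that * $\Lambda_i\equiv0$ for $1\le i<n$, $\Lambda_n\not\equiv0$; $\Omega_j\equiv0$ for $1<j<m$, $\Omega_m\not\equiv0$; * $\Lambda_n(0,\psi_0)=0$ and $\nu_n:=\partial_\psi\Lambda_n(0,\psi_0)\neq0$; * $\partial_\rho\Lambda_k+\partial_\psi\Omega_k\equiv0$ for $1\le k\le h-1$, and $d_h:=\partial_\rho\Lambda_h(0,\psi_0)+\partial_\psi\Omega_h(0,\psi_0)\ne0$; * $\nu_n\eta<0$, $d_h>0$ and $h+n-1<2q$. **Phase-locking regime.** For $N\ge1$ consider the truncated system $$\frac{d\varrho}{dt}=\sum_{k=1}^Nt^{-k/(2q)}\Lambda_k(\varrho,\phi),\qquad\frac{d\phi}{dt}=\sum_{k=1}^Nt^{-k/(2q)}\Omega_k(\varrho,\phi),\tag{2}$$ and its formal solution $\varrho\sim\sum_{k\ge1}t^{-(k+m-2)/(2q)}\varrho_k$, $\phi\sim\psi_0+\sum_{k\ge1}t^{-k/(2q)}\phi_k$, whose constant coefficients are determined successively by equating the coefficients of $t^{-(m+k-1)/(2q)}$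 in the second and of $t^{-(n+k)/(2q)}$ in the first equation, $k=1,2,\dots$. Call $(\varrho_*,\phi_*)$ a *regime at level $N$* if it is either the pair of $M$th partial sums of these two series for some integer $M\geq 0$, or a solution of (2), for all large $t$, that has these series as asymptotic expansions as $t\to\infty$. Put $$D(t,r,\varphi)=\left|r-a-t^{-\frac1{2q}}\varrho_*(t)\right|+\left|\varphi-\tfrac{\kappa}{\varkappa}S(t)-\phi_*(t)\right|.$$ **Theorem.** Under these assumptions there are a positive integer $N_0$ and $\varepsilon>0$ such that for all $\delta\in(0,\varepsilon)$, all $N\ge N_0$, every regime $(\varrho_*,\phi_*)$ at level $N$ and every $\delta_0\in(0,\delta]$ there is $T>0$ with the following property. For all $t_*\ge T$ and all $(r_*,\varphi_*)$ with $\delta_0\le D(t_*,r_*,\varphi_*)\le\delta$ there is $t_e>t_*$ such that system (1) has a solution on $[t_*,t_e]$ with $r(t_*)=r_*$, $\varphi(t_*)=\varphi_*$, and every such solution satisfies $$D(t_e,r(t_e),\varphi(t_e))\ge\varepsilon .$$ -/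

import Mathlib

open Filter Asymptotics

/-- The data of the perturbed oscillator
`dr/dt = f(r, φ, S(t), t)`, `dφ/dt = ω(r) + g(r, φ, S(t), t)`:
the bound `Rmax` for the amplitude, the frequency `ω`, the perturbations `f`, `g`, the coefficients
`fc j`, `gc j` (`j ≥ 1`) of their expansions in powers of `t ^ (-1/q)`, the coefficients `s j`
(`0 ≤ j ≤ q`) of the phase `S(t)`, the resonant amplitude `a` and the integers `κ`, `ϰ` of the
resonance condition. The conditions on these data are in `OscSystem.Standing`. -/
structure OscSystem where
  Rmax : ℝ
  ω : ℝ → ℝ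
  f : ℝ → ℝ → ℝ → ℝ → ℝ
  g : ℝ → ℝ → ℝ → ℝ → ℝ
  q : ℕ
  fc : ℕ → ℝ → ℝ → ℝ → ℝ
  gc : ℕ → ℝ → ℝ → ℝ → ℝ
  s : ℕ → ℝ
  a : ℝ
  κ : ℕ
  ϰ : ℕ

/-- One order `k` of the averaging procedure: the coefficients `Λ_k(ρ, ψ)`, `Ω_k(ρ, ψ)` of the
averaged system and `u_k(R, Ψ, S)`, `v_k(R, Ψ, S)` of the near-identity transformation. -/
structure AvgLevel where
  Lam : ℝ → ℝ → ℝ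
  Om : ℝ → ℝ → ℝ
  u : ℝ → ℝ → ℝ → ℝ
  v : ℝ → ℝ → ℝ → ℝ

namespace OscSystem

noncomputable section

/-! ### The system and the standing assumptions -/

/-- The phase `S(t) = s₀ t + ∑_{j=1}^{q-1} s_j t^{1-j/q} + s_q log t`. -/
def phase (P : OscSystem) (t : ℝ) : ℝ :=
  P.s 0 * t + ∑ j ∈ Finset.Ico 1 P.q, P.s j * t ^ (1 - (j : ℝ) / (P.q : ℝ))
    + P.s P.q * Real.log t

/-- `η = ω'(a)`. -/
def eta (P : OscSystem) : ℝ := deriv P.ω P.a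

/-- A function `F(r, φ, S)` that is infinitely differentiable for `|r| ≤ Rmax`, `(φ, S) ∈ ℝ²`, and
`2π`-periodic in `φ` and in `S`. -/
structure IsCoeff (P : OscSystem) (F : ℝ → ℝ → ℝ → ℝ) : Prop where
  smooth : ContDiffOn ℝ ((⊤ : ℕ∞) : WithTop ℕ∞)
    (fun p : ℝ × ℝ × ℝ => F p.1 p.2.1 p.2.2) {p | |p.1| ≤ P.Rmax}
  periodic_φ : ∀ r φ S, |r| ≤ P.Rmax → F r (φ + 2 * Real.pi) S = F r φ S
  periodic_S : ∀ r φ S, |r| ≤ P.Rmax → F r φ (S + 2 * Real.pi) = F r φ S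

/-- A perturbation `F(r, φ, S, t)`: infinitely differentiable for `|r| ≤ Rmax`, `(φ, S) ∈ ℝ²`,
`t > 0`, `2π`-periodic in `φ` and in `S`, with the asymptotic expansion
`F ∼ ∑_{j ≥ 1} t^{-j/q} F_j(r, φ, S)` as `t → ∞`, uniformly for `|r| ≤ Rmax`, `(φ, S) ∈ ℝ²`. -/
structure IsPerturbation (P : OscSystem) (F : ℝ → ℝ → ℝ → ℝ → ℝ)
    (Fc : ℕ → ℝ → ℝ → ℝ → ℝ) : Prop where
  smooth : ContDiffOn ℝ ((⊤ : ℕ∞) : WithTop ℕ∞)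
    (fun p : ℝ × ℝ × ℝ × ℝ => F p.1 p.2.1 p.2.2.1 p.2.2.2)
    {p | |p.1| ≤ P.Rmax ∧ 0 < p.2.2.2}
  periodic_φ : ∀ r φ S t, |r| ≤ P.Rmax → 0 < t → F r (φ + 2 * Real.pi) S t = F r φ S t
  periodic_S : ∀ r φ S t, |r| ≤ P.Rmax → 0 < t → F r φ (S + 2 * Real.pi) t = F r φ S t
  coeff : ∀ j, 1 ≤ j → P.IsCoeff (Fc j)
  expansion : ∀ N : ℕ, 1 ≤ N → ∃ C T : ℝ, 0 < T ∧ ∀ t, T ≤ t → ∀ r φ S, |r| ≤ P.Rmax →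
    |F r φ S t - ∑ j ∈ Finset.Ico 1 N, t ^ (-((j : ℝ) / (P.q : ℝ))) * Fc j r φ S|
      ≤ C * t ^ (-((N : ℝ) / (P.q : ℝ)))

/-- The standing assumptions on the system, its perturbations and the resonance. -/
structure Standing (P : OscSystem) : Prop where
  q_pos : 0 < P.q
  ω_smooth : ContDiffOn ℝ ((⊤ : ℕ∞) : WithTop ℕ∞) P.ω {r | |r| ≤ P.Rmax}
  ω_pos : ∀ r, |r| ≤ P.Rmax → 0 < P.ω r
  pert_f : P.IsPerturbation P.f P.fc
  pert_g : P.IsPerturbation P.g P.gc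
  s_pos : 0 < P.s 0
  a_pos : 0 < |P.a|
  a_lt : |P.a| < P.Rmax
  κ_pos : 0 < P.κ
  ϰ_pos : 0 < P.ϰ
  coprime : Nat.Coprime P.κ P.ϰ
  resonance : (P.κ : ℝ) * P.s 0 = (P.ϰ : ℝ) * P.ω P.a
  eta_ne : P.eta ≠ 0

/-- `(r, φ)` is a solution of the perturbed system on `[t₁, t₂]` (one-sided derivatives at the end
points), staying in the strip `|r| ≤ Rmax` where the system is defined. -/
def IsSolution (P : OscSystem) (r φ : ℝ → ℝ) (t₁ t₂ : ℝ) : Prop :=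
  ∀ t ∈ Set.Icc t₁ t₂, |r t| ≤ P.Rmax ∧
    HasDerivWithinAt r (P.f (r t) (φ t) (P.phase t) t) (Set.Icc t₁ t₂) t ∧
    HasDerivWithinAt φ (P.ω (r t) + P.g (r t) (φ t) (P.phase t) t) (Set.Icc t₁ t₂) t

/-! ### Averaging

With `r = a + t^{-1/(2q)} R`, `φ = (κ/ϰ) S(t) + Ψ` the system becomes
`dR/dt ∼ ∑ t^{-k/(2q)} F_k(R, Ψ, S)`, `dΨ/dt ∼ ∑ t^{-k/(2q)} G_k(R, Ψ, S)`.
The substitution `ρ = R + ∑ t^{-k/(2q)} u_k`, `ψ = Ψ + ∑ t^{-k/(2q)} v_k` with `u_k`, `v_k` periodic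
in `S` with zero mean removes `S` from the coefficients; what remains is
`dρ/dt ∼ ∑ t^{-k/(2q)} Λ_k(ρ, ψ)`, `dψ/dt ∼ ∑ t^{-k/(2q)} Ω_k(ρ, ψ)`. -/

/-- The coefficient of `t^{-k/(2q)}` in `S'(t)`. -/
def sDot (P : OscSystem) (k : ℕ) : ℝ :=
  if Even k ∧ k ≤ 2 * P.q then
    P.s (k / 2) * (1 - (k : ℝ) / (2 * P.q) + if k = 2 * P.q then 1 else 0)
  else 0

/-- `F_k(R, Ψ, S)`; the summation index is `j`, and `i = k + 1 - 2 j`. -/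
def Fk (P : OscSystem) (k : ℕ) (R Ψ S : ℝ) : ℝ :=
  ∑ j ∈ Finset.Icc 1 ((k + 1) / 2),
      iteratedDeriv (k + 1 - 2 * j)
        (fun r => P.fc j r ((P.κ : ℝ) / (P.ϰ : ℝ) * S + Ψ) S) P.a
          * R ^ (k + 1 - 2 * j) / (Nat.factorial (k + 1 - 2 * j) : ℝ)
    + if k = 2 * P.q then R / (2 * P.q) else 0

/-- `G_k(R, Ψ, S)`; the summation index is `j`, and `i = k - 2 j`. -/
def Gk (P : OscSystem) (k : ℕ) (R Ψ S : ℝ) : ℝ :=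
  iteratedDeriv k P.ω P.a * R ^ k / (Nat.factorial k : ℝ)
    - (P.κ : ℝ) / (P.ϰ : ℝ) * P.sDot k
    + ∑ j ∈ Finset.Icc 1 (k / 2),
        iteratedDeriv (k - 2 * j)
          (fun r => P.gc j r ((P.κ : ℝ) / (P.ϰ : ℝ) * S + Ψ) S) P.a
            * R ^ (k - 2 * j) / (Nat.factorial (k - 2 * j) : ℝ)

/-- The mean value of `F(S)` over the period `2πϰ`. -/
def mean (P : OscSystem) (F : ℝ → ℝ) : ℝ :=
  1 / (2 * Real.pi * P.ϰ) * ∫ S in (0 : ℝ)..(2 * Real.pi * P.ϰ), F S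

/-- The antiderivative of `F` that has zero mean over the period `2πϰ`. -/
def zeroMeanPrimitive (P : OscSystem) (F : ℝ → ℝ) (S : ℝ) : ℝ :=
  (∫ x in (0 : ℝ)..S, F x) - P.mean (fun y => ∫ x in (0 : ℝ)..y, F x)

/-- The Taylor coefficient of order `p` at `0`. -/
def taylorCoeff (p : ℕ) (F : ℝ → ℝ) : ℝ := iteratedDeriv p F 0 / (Nat.factorial p : ℝ)

/-- The coefficient of `τ^p` in `A(R + ∑ τ^i u_i, Ψ + ∑ τ^i v_i)`. -/
def substCoeff (L : ℕ → AvgLevel) (A : ℝ → ℝ → ℝ) (p : ℕ) (R Ψ S : ℝ) : ℝ :=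
  taylorCoeff p (fun τ =>
    A (R + ∑ i ∈ Finset.Icc 1 p, τ ^ i * (L i).u R Ψ S)
      (Ψ + ∑ i ∈ Finset.Icc 1 p, τ ^ i * (L i).v R Ψ S))

/-- The contribution of order `j` of the operator `d/dt` along the system to the coefficient of
`t^{-k/(2q)}`, applied to the coefficient `w = w(R, Ψ, S)` of `t^{-(k-j)/(2q)}`:
`(F_j ∂_R + G_j ∂_Ψ + s_{j/2} (1 - j/(2q) + δ_{j,2q}) ∂_S + δ_{j,2q} (2q-k)/(2q)) w`. -/
def transport (P : OscSystem) (k j : ℕ) (w : ℝ → ℝ → ℝ → ℝ) (R Ψ S : ℝ) : ℝ :=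
  P.Fk j R Ψ S * deriv (fun x => w x Ψ S) R
    + P.Gk j R Ψ S * deriv (fun x => w R x S) Ψ
    + P.sDot j * deriv (fun x => w R Ψ x) S
    + if j = 2 * P.q then (2 * (P.q : ℝ) - k) / (2 * P.q) * w R Ψ S else 0

/-- The terms `F̃_k` expressed through the orders below `k`. -/
def Ftilde (P : OscSystem) (L : ℕ → AvgLevel) (k : ℕ) (R Ψ S : ℝ) : ℝ :=
  ∑ j ∈ Finset.Ico 1 k, substCoeff L (L j).Lam (k - j) R Ψ S
    - ∑ j ∈ Finset.Ico 1 k, P.transport k j (L (k - j)).u R Ψ S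

/-- The terms `G̃_k` expressed through the orders below `k`. -/
def Gtilde (P : OscSystem) (L : ℕ → AvgLevel) (k : ℕ) (R Ψ S : ℝ) : ℝ :=
  ∑ j ∈ Finset.Ico 1 k, substCoeff L (L j).Om (k - j) R Ψ S
    - ∑ j ∈ Finset.Ico 1 k, P.transport k j (L (k - j)).v R Ψ S

/-- The order `k` obtained from the orders below `k`: `Λ_k = ⟨F_k - F̃_k⟩`, `Ω_k = ⟨G_k - G̃_k⟩`, and
`u_k`, `v_k` are the solutions with zero mean of `s₀ ∂_S u_k = Λ_k - F_k + F̃_k`,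
`s₀ ∂_S v_k = Ω_k - G_k + G̃_k`. -/
def nextLevel (P : OscSystem) (L : ℕ → AvgLevel) (k : ℕ) : AvgLevel where
  Lam R Ψ := P.mean (fun S => P.Fk k R Ψ S - P.Ftilde L k R Ψ S)
  Om R Ψ := P.mean (fun S => P.Gk k R Ψ S - P.Gtilde L k R Ψ S)
  u R Ψ S := P.zeroMeanPrimitive (fun x =>
    P.mean (fun y => P.Fk k R Ψ y - P.Ftilde L k R Ψ y)
      - P.Fk k R Ψ x + P.Ftilde L k R Ψ x) S / P.s 0
  v R Ψ S := P.zeroMeanPrimitive (fun x =>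
    P.mean (fun y => P.Gk k R Ψ y - P.Gtilde L k R Ψ y)
      - P.Gk k R Ψ x + P.Gtilde L k R Ψ x) S / P.s 0

/-- `levels P k` holds the orders `1, …, k` of the averaging procedure (and zero elsewhere). -/
def levels (P : OscSystem) : ℕ → ℕ → AvgLevel
  | 0 => fun _ => ⟨0, 0, 0, 0⟩
  | k + 1 => Function.update (levels P k) (k + 1) (P.nextLevel (levels P k) (k + 1))

/-- The averaged coefficient `Λ_k(ρ, ψ)`. -/
def Lam (P : OscSystem) (k : ℕ) : ℝ → ℝ → ℝ := (P.levels k k).Lam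

/-- The averaged coefficient `Ω_k(ρ, ψ)`. -/
def Om (P : OscSystem) (k : ℕ) : ℝ → ℝ → ℝ := (P.levels k k).Om

/-! ### The assumptions on the averaged coefficients -/

/-- `n ∈ [1, 2q]`, `m ∈ [2, 2q]` are the orders of the first coefficients that do not vanish
identically: `Λ_n` among all `Λ_i`, and `Ω_m` among the `Ω_j` with `j > 1`. -/
structure LeadingOrders (P : OscSystem) (n m : ℕ) : Prop where
  n_mem : 1 ≤ n ∧ n ≤ 2 * P.q
  m_mem : 2 ≤ m ∧ m ≤ 2 * P.q
  Lam_zero : ∀ i, 1 ≤ i → i < n → ∀ ρ ψ, P.Lam i ρ ψ = 0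
  Lam_ne : ∃ ρ ψ, P.Lam n ρ ψ ≠ 0
  Om_zero : ∀ j, 1 < j → j < m → ∀ ρ ψ, P.Om j ρ ψ = 0
  Om_ne : ∃ ρ ψ, P.Om m ρ ψ ≠ 0

/-- `ν_n = ∂_ψ Λ_n(0, ψ₀)`. -/
def nu (P : OscSystem) (n : ℕ) (ψ₀ : ℝ) : ℝ := deriv (fun ψ => P.Lam n 0 ψ) ψ₀

/-- `(0, ψ₀)` is an equilibrium of the limiting system with `ν_n ≠ 0`. -/
def IsEquilibrium (P : OscSystem) (n : ℕ) (ψ₀ : ℝ) : Prop :=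
  P.Lam n 0 ψ₀ = 0 ∧ P.nu n ψ₀ ≠ 0

/-- `∂_ρ Λ_k(ρ, ψ) + ∂_ψ Ω_k(ρ, ψ)`. -/
def divergence (P : OscSystem) (k : ℕ) (ρ ψ : ℝ) : ℝ :=
  deriv (fun x => P.Lam k x ψ) ρ + deriv (fun y => P.Om k ρ y) ψ

/-- `h ∈ (min{m, n}, 2q]`, the divergence vanishes identically at the orders below `h`, and
`d_h = ∂_ρ Λ_h(0, ψ₀) + ∂_ψ Ω_h(0, ψ₀) ≠ 0`. -/
structure DivergenceOrder (P : OscSystem) (n m h : ℕ) (ψ₀ : ℝ) : Prop where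
  h_mem : min m n < h ∧ h ≤ 2 * P.q
  div_zero : ∀ k, 1 ≤ k → k ≤ h - 1 → ∀ ρ ψ, P.divergence k ρ ψ = 0
  div_ne : P.divergence h 0 ψ₀ ≠ 0

/-! ### The phase-locking regime of the truncated system

The truncated system is `dϱ/dt = ∑_{k=1}^N t^{-k/(2q)} Λ_k(ϱ, ϕ)`,
`dϕ/dt = ∑_{k=1}^N t^{-k/(2q)} Ω_k(ϱ, ϕ)`. Below `τ = t^{-1/(2q)}`, so that
`d(τ^p)/dt = -(p/(2q)) τ^{p+2q}`. -/

/-- `∑_{k=1}^N τ^k Λ_k(ρ, ψ)`. -/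
def LamHat (P : OscSystem) (N : ℕ) (ρ ψ τ : ℝ) : ℝ :=
  ∑ k ∈ Finset.Icc 1 N, τ ^ k * P.Lam k ρ ψ

/-- `∑_{k=1}^N τ^k Ω_k(ρ, ψ)`. -/
def OmHat (P : OscSystem) (N : ℕ) (ρ ψ τ : ℝ) : ℝ :=
  ∑ k ∈ Finset.Icc 1 N, τ ^ k * P.Om k ρ ψ

/-- `∑_{k=1}^K τ^{k+m-2} c_k`. -/
def rhoSum (m : ℕ) (c : ℕ → ℝ) (K : ℕ) (τ : ℝ) : ℝ :=
  ∑ k ∈ Finset.Icc 1 K, τ ^ (k + m - 2) * c k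

/-- `ψ₀ + ∑_{k=1}^K τ^k d_k`. -/
def phiSum (ψ₀ : ℝ) (d : ℕ → ℝ) (K : ℕ) (τ : ℝ) : ℝ :=
  ψ₀ + ∑ k ∈ Finset.Icc 1 K, τ ^ k * d k

/-- The derivative of `rhoSum m c K` with respect to `t`, as a function of `τ`. -/
def rhoSumDot (P : OscSystem) (m : ℕ) (c : ℕ → ℝ) (K : ℕ) (τ : ℝ) : ℝ :=
  ∑ k ∈ Finset.Icc 1 K,
    -(((k + m - 2 : ℕ) : ℝ) / (2 * P.q)) * τ ^ (k + m - 2 + 2 * P.q) * c k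

/-- The derivative of `phiSum ψ₀ d K` with respect to `t`, as a function of `τ`. -/
def phiSumDot (P : OscSystem) (d : ℕ → ℝ) (K : ℕ) (τ : ℝ) : ℝ :=
  ∑ k ∈ Finset.Icc 1 K, -((k : ℝ) / (2 * P.q)) * τ ^ (k + 2 * P.q) * d k

/-- The coefficients `ϱ_k` (first component) and `ϕ_k` (second component), `1 ≤ k ≤ K`, of the
formal solution `ϱ = ∑ τ^{k+m-2} ϱ_k`, `ϕ = ψ₀ + ∑ τ^k ϕ_k` of the truncated system, obtained
by equating the coefficients of `τ^{m+k-1}` in the second equation (where `ϱ_k` enters as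
`η ϱ_k`, and all the other terms have lower indices), and then those of `τ^{n+k}` in the first
equation (where `ϕ_k` enters as `ν_n ϕ_k`, and the other terms are known). -/
def seriesUpTo (P : OscSystem) (N n m : ℕ) (ψ₀ : ℝ) : ℕ → (ℕ → ℝ) × (ℕ → ℝ)
  | 0 => (0, 0)
  | k + 1 =>
    let c := (seriesUpTo P N n m ψ₀ k).1
    let d := (seriesUpTo P N n m ψ₀ k).2
    let c₁ := Function.update c (k + 1)
      (-(taylorCoeff (m + k) (fun τ =>
        P.OmHat N (rhoSum m c k τ) (phiSum ψ₀ d k τ) τ - P.phiSumDot d k τ)) / P.eta)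
    (c₁, Function.update d (k + 1)
      (-(taylorCoeff (n + (k + 1)) (fun τ =>
        P.LamHat N (rhoSum m c₁ (k + 1) τ) (phiSum ψ₀ d k τ) τ
          - P.rhoSumDot m c₁ (k + 1) τ)) / P.nu n ψ₀))

/-- The coefficient `ϱ_k` of the formal solution. -/
def rhoCoeff (P : OscSystem) (N n m : ℕ) (ψ₀ : ℝ) (k : ℕ) : ℝ :=
  (P.seriesUpTo N n m ψ₀ k).1 k

/-- The coefficient `ϕ_k` of the formal solution. -/
def phiCoeff (P : OscSystem) (N n m : ℕ) (ψ₀ : ℝ) (k : ℕ) : ℝ :=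
  (P.seriesUpTo N n m ψ₀ k).2 k

/-- `τ = t^{-1/(2q)}`. -/
def tau (P : OscSystem) (t : ℝ) : ℝ := t ^ (-(1 / (2 * (P.q : ℝ))))

/-- The `M`th partial sum `ϱ_{∗,M}(t) = ∑_{k=1}^M t^{-(k+m-2)/(2q)} ϱ_k`. -/
def rhoStar (P : OscSystem) (N n m : ℕ) (ψ₀ : ℝ) (M : ℕ) (t : ℝ) : ℝ :=
  rhoSum m (P.rhoCoeff N n m ψ₀) M (P.tau t)

/-- The `M`th partial sum `ϕ_{∗,M}(t) = ψ₀ + ∑_{k=1}^M t^{-k/(2q)} ϕ_k`. -/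
def phiStar (P : OscSystem) (N n m : ℕ) (ψ₀ : ℝ) (M : ℕ) (t : ℝ) : ℝ :=
  phiSum ψ₀ (P.phiCoeff N n m ψ₀) M (P.tau t)

/-- `(ϱ, ϕ)` solves the truncated system for all sufficiently large `t`. -/
def IsTruncatedSolution (P : OscSystem) (N : ℕ) (ϱ ϕ : ℝ → ℝ) : Prop :=
  ∃ t₁ : ℝ, 0 < t₁ ∧ ∀ t, t₁ ≤ t →
    HasDerivAt ϱ (P.LamHat N (ϱ t) (ϕ t) (P.tau t)) t ∧
    HasDerivAt ϕ (P.OmHat N (ϱ t) (ϕ t) (P.tau t)) t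

/-- `ϱ(t) ∼ ∑_{k ≥ 1} t^{-(k+m-2)/(2q)} ϱ_k` and `ϕ(t) ∼ ψ₀ + ∑_{k ≥ 1} t^{-k/(2q)} ϕ_k` as
`t → ∞`. -/
def HasExpansion (P : OscSystem) (N n m : ℕ) (ψ₀ : ℝ) (ϱ ϕ : ℝ → ℝ) : Prop :=
  ∀ M : ℕ,
    (fun t => ϱ t - P.rhoStar N n m ψ₀ M t) =O[atTop] (fun t => P.tau t ^ (M + m - 1)) ∧
    (fun t => ϕ t - P.phiStar N n m ψ₀ M t) =O[atTop] (fun t => P.tau t ^ (M + 1))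

/-- The functions `ϱ_∗`, `ϕ_∗` describing the phase-locking regime: a partial sum of the formal
solution of the truncated system, or an exact solution of the truncated system that has the formal
solution as its asymptotic expansion. -/
def IsRegime (P : OscSystem) (N n m : ℕ) (ψ₀ : ℝ) (ϱ ϕ : ℝ → ℝ) : Prop :=
  (∃ M : ℕ, ϱ = P.rhoStar N n m ψ₀ M ∧ ϕ = P.phiStar N n m ψ₀ M) ∨
    (P.IsTruncatedSolution N ϱ ϕ ∧ P.HasExpansion N n m ψ₀ ϱ ϕ)

/-- `|r - a - t^{-1/(2q)} ϱ_∗(t)| + |φ - (κ/ϰ) S(t) - ϕ_∗(t)|`. -/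
def regimeDist (P : OscSystem) (ϱ ϕ : ℝ → ℝ) (t r φ : ℝ) : ℝ :=
  |r - P.a - P.tau t * ϱ t| + |φ - (P.κ : ℝ) / (P.ϰ : ℝ) * P.phase t - ϕ t|

end

end OscSystem

open scoped ContDiff

/-! ### Calculus with parameters -/

section Calculus

open Set MeasureTheory

theorem hasFDerivAt_parametric_integral {E G : Type} [NormedAddCommGroup E] [NormedSpace ℝ E]
    [FiniteDimensional ℝ E] [NormedAddCommGroup G] [NormedSpace ℝ G] [CompleteSpace G]
    {f : E → ℝ → G} (hf : ContDiff ℝ 1 (fun p : E × ℝ => f p.1 p.2)) (a b : ℝ) (x : E) :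
    HasFDerivAt (fun x => ∫ t in a..b, f x t)
      (∫ t in a..b, (fderiv ℝ (fun p : E × ℝ => f p.1 p.2) (x, t)).comp
        (ContinuousLinearMap.inl ℝ E ℝ)) x := by
  have := FiniteDimensional.proper_real E
  set f' : E → ℝ → (E →L[ℝ] G) := fun x t =>
    (fderiv ℝ (fun p : E × ℝ => f p.1 p.2) (x, t)).comp (ContinuousLinearMap.inl ℝ E ℝ)
    with hf'
  have hc : Continuous (fun p : E × ℝ => f' p.1 p.2) := by
    have := hf.continuous_fderiv (by norm_num)
    simp only [hf']
    exact this.clm_comp continuous_const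
  have hcf : Continuous (fun p : E × ℝ => f p.1 p.2) := hf.continuous
  obtain ⟨C, hC⟩ := ((isCompact_closedBall x 1).prod (isCompact_uIcc (a := a) (b := b))).exists_bound_of_continuousOn
    hc.continuousOn
  refine intervalIntegral.hasFDerivAt_integral_of_dominated_of_fderiv_le (F' := f')
    (bound := fun _ => C) (Metric.closedBall_mem_nhds x one_pos) ?_ ?_ ?_ ?_ ?_ ?_
  · exact Filter.Eventually.of_forall fun y =>
      (hcf.comp (Continuous.prodMk_right y)).aestronglyMeasurable
  · exact (hcf.comp (Continuous.prodMk_right x)).intervalIntegrable _ _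
  · exact (hc.comp (Continuous.prodMk_right x)).aestronglyMeasurable
  · refine Filter.Eventually.of_forall fun t ht y hy => hC (y, t) ⟨hy, ?_⟩
    exact uIoc_subset_uIcc ht
  · exact intervalIntegrable_const
  · refine Filter.Eventually.of_forall fun t _ y _ => ?_
    have h1 : HasFDerivAt (fun p : E × ℝ => f p.1 p.2) _ (y, t) :=
      (hf.differentiable (by norm_num) (y, t)).hasFDerivAt
    exact HasFDerivAt.comp (f := fun e : E => (e, t)) y h1 (hasFDerivAt_prodMk_left y t)

theorem contDiff_nat_parametric_integral (n : ℕ) : ∀ {E G : Type} [NormedAddCommGroup E]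
    [NormedSpace ℝ E] [FiniteDimensional ℝ E] [NormedAddCommGroup G] [NormedSpace ℝ G]
    [CompleteSpace G] {f : E → ℝ → G} (_ : ContDiff ℝ n (fun p : E × ℝ => f p.1 p.2)) (a b : ℝ),
    ContDiff ℝ n (fun x => ∫ t in a..b, f x t) := by
  induction n with
  | zero =>
    intro E G _ _ _ _ _ _ f hf a b
    have := FiniteDimensional.proper_real E
    simp only [Nat.cast_zero, contDiff_zero] at hf ⊢
    exact intervalIntegral.continuous_parametric_intervalIntegral_of_continuous' hf a b
  | succ n ih =>
    intro E G _ _ _ _ _ _ f hf a b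
    have h1 : ContDiff ℝ 1 (fun p : E × ℝ => f p.1 p.2) := hf.of_le (by
      norm_cast; omega)
    have hd := hasFDerivAt_parametric_integral h1 a b
    push_cast
    rw [contDiff_succ_iff_hasFDerivAt]
    refine ⟨_, ?_, fun x => hd x⟩
    refine ih (f := fun x t => (fderiv ℝ (fun p : E × ℝ => f p.1 p.2) (x, t)).comp
        (ContinuousLinearMap.inl ℝ E ℝ)) ?_ a b
    have : ContDiff ℝ n (fderiv ℝ (fun p : E × ℝ => f p.1 p.2)) :=
      hf.fderiv_right (by push_cast; exact le_rfl)
    exact this.clm_comp contDiff_const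

theorem contDiff_parametric_integral {E G : Type} [NormedAddCommGroup E]
    [NormedSpace ℝ E] [FiniteDimensional ℝ E] [NormedAddCommGroup G] [NormedSpace ℝ G]
    [CompleteSpace G] {f : E → ℝ → G} (hf : ContDiff ℝ ∞ (fun p : E × ℝ => f p.1 p.2)) (a b : ℝ) :
    ContDiff ℝ ∞ (fun x => ∫ t in a..b, f x t) :=
  contDiff_infty.2 fun n => contDiff_nat_parametric_integral n (contDiff_infty.1 hf n) a b

/-- Antiderivatives of smooth functions with parameters are smooth. -/
theorem contDiff_parametric_primitive {E : Type} [NormedAddCommGroup E]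
    [NormedSpace ℝ E] [FiniteDimensional ℝ E] {f : E → ℝ → ℝ}
    (hf : ContDiff ℝ ∞ (fun p : E × ℝ => f p.1 p.2)) :
    ContDiff ℝ ∞ (fun p : E × ℝ => ∫ t in (0 : ℝ)..p.2, f p.1 t) := by
  have h : (fun p : E × ℝ => ∫ t in (0 : ℝ)..p.2, f p.1 t)
      = fun p : E × ℝ => p.2 * ∫ t in (0 : ℝ)..1, f p.1 (p.2 * t) := by
    ext p
    have := intervalIntegral.mul_integral_comp_mul_left (f := f p.1) (a := 0) (b := 1) p.2
    simpa only [mul_zero, mul_one] using this.symm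
  rw [h]
  refine contDiff_snd.mul (contDiff_parametric_integral (f := fun (p : E × ℝ) t => f p.1 (p.2 * t))
    ?_ 0 1)
  exact hf.comp ((contDiff_fst.comp contDiff_fst).prodMk
    ((contDiff_snd.comp contDiff_fst).mul contDiff_snd))

/-- Hadamard's lemma with parameters. -/
theorem exists_hadamard {E : Type} [NormedAddCommGroup E]
    [NormedSpace ℝ E] [FiniteDimensional ℝ E] {g : ℝ → E → ℝ}
    (hg : ContDiff ℝ ∞ (fun p : ℝ × E => g p.1 p.2)) :
    ∃ g₁ : ℝ → E → ℝ, ContDiff ℝ ∞ (fun p : ℝ × E => g₁ p.1 p.2) ∧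
      (∀ x p, g x p = g 0 p + x * g₁ x p) ∧ ∀ p, g₁ 0 p = deriv (fun x => g x p) 0 := by
  have hd : ContDiff ℝ ∞ (fun q : ℝ × E => deriv (fun x => g x q.2) q.1) := by
    have h1 : (fun q : ℝ × E => deriv (fun x => g x q.2) q.1)
        = fun q => fderiv ℝ (fun p : ℝ × E => g p.1 p.2) q (1, 0) := by
      ext q
      have h2 : HasFDerivAt (fun p : ℝ × E => g p.1 p.2) _ (q.1, q.2) :=
        (hg.differentiable (by simp) (q.1, q.2)).hasFDerivAt
      have h3 : HasDerivAt (fun x : ℝ => (x, q.2)) ((1 : ℝ), (0 : E)) q.1 :=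
        (hasDerivAt_id q.1).prodMk (hasDerivAt_const q.1 q.2)
      exact (h2.comp_hasDerivAt q.1 h3).deriv
    rw [h1]
    exact (hg.fderiv_right (m := ∞) (by simp)).clm_apply contDiff_const
  refine ⟨fun x p => ∫ t in (0 : ℝ)..1, deriv (fun y => g y p) (x * t), ?_, ?_, ?_⟩
  · refine contDiff_parametric_integral (E := ℝ × E)
      (f := fun q t => deriv (fun y => g y q.2) (q.1 * t)) ?_ 0 1
    exact hd.comp (((contDiff_fst.comp contDiff_fst).mul contDiff_snd).prodMk
      (contDiff_snd.comp contDiff_fst))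
  · intro x p
    have h := intervalIntegral.mul_integral_comp_mul_left (f := deriv (fun y => g y p))
      (a := 0) (b := 1) x
    have hgp : ContDiff ℝ ∞ (fun y => g y p) := hg.comp (contDiff_id.prodMk contDiff_const)
    have h2 : ∫ t in (0 : ℝ)..x, deriv (fun y => g y p) t = g x p - g 0 p := by
      refine intervalIntegral.integral_deriv_eq_sub
        (fun y _ => hgp.differentiable (by simp) y) ?_
      exact (hgp.continuous_deriv (by simp)).intervalIntegrable _ _
    rw [mul_zero, mul_one, h2] at h
    rw [h]; ring
  · intro p; simp

/-- If `x ↦ x * g x p` vanishes then so does the continuous function `g`. -/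
theorem eq_zero_of_mul_eq_zero {g : ℝ → ℝ} (hg : Continuous g) (h : ∀ x, x * g x = 0) (x : ℝ) :
    g x = 0 := by
  have h1 : EqOn g 0 {0}ᶜ := fun y hy => by
    rcases mul_eq_zero.1 (h y) with h2 | h2
    · exact absurd h2 hy
    · exact h2
  have := Continuous.ext_on (dense_compl_singleton (0 : ℝ)) hg continuous_const h1
  exact congrFun this x

/-- The partial derivative of a function that is smooth near `s × E` is smooth there. -/
theorem contDiffOn_deriv_fst {E : Type} [NormedAddCommGroup E] [NormedSpace ℝ E]
    {s : Set ℝ} (hs : IsOpen s) {g : ℝ → E → ℝ}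
    (hg : ContDiffOn ℝ ∞ (fun p : ℝ × E => g p.1 p.2) (s ×ˢ univ)) :
    ContDiffOn ℝ ∞ (fun q : ℝ × E => deriv (fun x => g x q.2) q.1) (s ×ˢ univ) := by
  have ho : IsOpen (s ×ˢ (univ : Set E)) := hs.prod isOpen_univ
  have h1 : EqOn (fun q : ℝ × E => deriv (fun x => g x q.2) q.1)
      (fun q => fderiv ℝ (fun p : ℝ × E => g p.1 p.2) q (1, 0)) (s ×ˢ univ) := by
    intro q hq
    have h2 : HasFDerivAt (fun p : ℝ × E => g p.1 p.2) _ (q.1, q.2) :=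
      ((hg.differentiableOn (by simp)).differentiableAt (ho.mem_nhds hq)).hasFDerivAt
    have h3 : HasDerivAt (fun x : ℝ => (x, q.2)) ((1 : ℝ), (0 : E)) q.1 :=
      (hasDerivAt_id q.1).prodMk (hasDerivAt_const q.1 q.2)
    exact (h2.comp_hasDerivAt q.1 h3).deriv
  refine ContDiffOn.congr ?_ h1
  exact (hg.fderiv_of_isOpen (m := ∞) ho (by simp)).clm_apply contDiffOn_const

theorem contDiffOn_iteratedDeriv_fst {E : Type} [NormedAddCommGroup E] [NormedSpace ℝ E]
    {s : Set ℝ} (hs : IsOpen s) {g : ℝ → E → ℝ}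
    (hg : ContDiffOn ℝ ∞ (fun p : ℝ × E => g p.1 p.2) (s ×ˢ univ)) (n : ℕ) :
    ContDiffOn ℝ ∞ (fun q : ℝ × E => iteratedDeriv n (fun x => g x q.2) q.1) (s ×ˢ univ) := by
  induction n with
  | zero => simpa using hg
  | succ n ih =>
    simp only [iteratedDeriv_succ]
    exact contDiffOn_deriv_fst (g := fun x p => iteratedDeriv n (fun x => g x p) x) hs ih

theorem contDiff_deriv_fst {E : Type} [NormedAddCommGroup E] [NormedSpace ℝ E]
    {g : ℝ → E → ℝ} (hg : ContDiff ℝ ∞ (fun p : ℝ × E => g p.1 p.2)) :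
    ContDiff ℝ ∞ (fun q : ℝ × E => deriv (fun x => g x q.2) q.1) := by
  rw [← contDiffOn_univ, ← univ_prod_univ] at hg ⊢
  exact contDiffOn_deriv_fst isOpen_univ hg

theorem contDiff_iteratedDeriv_fst {E : Type} [NormedAddCommGroup E] [NormedSpace ℝ E]
    {g : ℝ → E → ℝ} (hg : ContDiff ℝ ∞ (fun p : ℝ × E => g p.1 p.2)) (n : ℕ) :
    ContDiff ℝ ∞ (fun q : ℝ × E => iteratedDeriv n (fun x => g x q.2) q.1) := by
  rw [← contDiffOn_univ, ← univ_prod_univ] at hg ⊢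
  exact contDiffOn_iteratedDeriv_fst isOpen_univ hg n

/-- Taylor's formula with a remainder that is uniform for parameters in a compact set. -/
theorem exists_taylor_bound {E : Type} [NormedAddCommGroup E] [NormedSpace ℝ E]
    {a r : ℝ} {K : Set E} (hK : IsCompact K) {s : Set ℝ} (hs : IsOpen s)
    (hrs : Icc (a - r) (a + r) ⊆ s) (n : ℕ) : ∀ {g : ℝ → E → ℝ},
    ContDiffOn ℝ ∞ (fun p : ℝ × E => g p.1 p.2) (s ×ˢ univ) →
    ∃ C, 0 ≤ C ∧ ∀ z, |z| ≤ r → ∀ p ∈ K,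
      |g (a + z) p - ∑ l ∈ Finset.range n,
        z ^ l * (iteratedDeriv l (fun x => g x p) a / (Nat.factorial l : ℝ))| ≤ C * |z| ^ n := by
  induction n with
  | zero =>
    intro g hg
    obtain ⟨C, hC⟩ := ((isCompact_Icc (a := a - r) (b := a + r)).prod hK).exists_bound_of_continuousOn
      (hg.continuousOn.mono (prod_mono hrs (subset_univ _)))
    refine ⟨max C 0, le_max_right _ _, fun z hz p hp => ?_⟩
    have h := abs_le.1 hz
    have := hC (a + z, p) ⟨⟨by linarith, by linarith⟩, hp⟩
    simpa using Or.inl this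
  | succ n ih =>
    intro g hg
    obtain ⟨C, hC0, hC⟩ := ih (g := fun y p => deriv (fun x => g x p) y)
      (contDiffOn_deriv_fst hs hg)
    refine ⟨C, hC0, fun z hz p hp => ?_⟩
    set T : ℝ → ℝ := fun z => ∑ l ∈ Finset.range (n + 1),
        z ^ l * (iteratedDeriv l (fun x => g x p) a / (Nat.factorial l : ℝ)) with hT
    set T' : ℝ → ℝ := fun z => ∑ l ∈ Finset.range n,
        z ^ l * (iteratedDeriv l (fun x => deriv (fun x => g x p) x) a / (Nat.factorial l : ℝ))
      with hT'
    have hTd : ∀ z, HasDerivAt T (T' z) z := by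
      intro z
      have hT2 : T = fun z => ∑ l ∈ Finset.range n,
          z ^ (l + 1) * (iteratedDeriv (l + 1) (fun x => g x p) a / (Nat.factorial (l + 1) : ℝ))
          + g a p := by
        ext z; simp [hT, Finset.sum_range_succ']
      rw [hT2]
      refine HasDerivAt.add_const _ (HasDerivAt.fun_sum fun l _ => ?_)
      have := (hasDerivAt_pow (l + 1) z).mul_const
        (iteratedDeriv (l + 1) (fun x => g x p) a / (Nat.factorial (l + 1) : ℝ))
      refine this.congr_deriv ?_
      rw [iteratedDeriv_succ', Nat.factorial_succ]
      push_cast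
      have : (Nat.factorial l : ℝ) ≠ 0 := by positivity
      field_simp
    have hgd : ∀ y, |y| ≤ r → HasDerivAt (fun z => g (a + z) p)
        (deriv (fun x => g x p) (a + y)) y := by
      intro y hy
      have h := abs_le.1 hy
      have hmem : a + y ∈ s := hrs ⟨by linarith, by linarith⟩
      have h0 : DifferentiableAt ℝ (fun x => g x p) (a + y) := by
        have h2 : DifferentiableAt ℝ (fun p : ℝ × E => g p.1 p.2) (a + y, p) :=
          (hg.differentiableOn (by simp)).differentiableAt
            ((hs.prod isOpen_univ).mem_nhds ⟨hmem, mem_univ _⟩)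
        exact h2.comp (a + y) (by fun_prop : DifferentiableAt ℝ (fun x : ℝ => (x, p)) (a + y))
      have := h0.hasDerivAt.comp_const_add a y
      exact this
    have key := (convex_uIcc (0 : ℝ) z).norm_image_sub_le_of_norm_hasDerivWithin_le
      (f := fun z => g (a + z) p - T z) (f' := fun y => deriv (fun x => g x p) (a + y) - T' y)
      (C := C * |z| ^ n) (x := 0) (y := z) ?_ ?_ left_mem_uIcc right_mem_uIcc
    · have hT0 : T 0 = g a p := by simp [hT, Finset.sum_range_succ']
      simp only [hT0, add_zero, sub_self, sub_zero, Real.norm_eq_abs] at key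
      rw [pow_succ, ← mul_assoc]
      exact key
    · intro y hy
      have hyz : |y| ≤ |z| := by
        rcases le_total 0 z with h0 | h0
        · rw [uIcc_of_le h0] at hy
          rw [abs_of_nonneg hy.1, abs_of_nonneg h0]; exact hy.2
        · rw [uIcc_of_ge h0] at hy
          rw [abs_of_nonpos hy.2, abs_of_nonpos h0]; linarith [hy.1]
      exact ((hgd y (hyz.trans hz)).sub (hTd y)).hasDerivWithinAt
    · intro y hy
      have hyz : |y| ≤ |z| := by
        rcases le_total 0 z with h0 | h0
        · rw [uIcc_of_le h0] at hy
          rw [abs_of_nonneg hy.1, abs_of_nonneg h0]; exact hy.2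
        · rw [uIcc_of_ge h0] at hy
          rw [abs_of_nonpos hy.2, abs_of_nonpos h0]; linarith [hy.1]
      refine (hC y (hyz.trans hz) p hp).trans ?_
      gcongr

end Calculus

namespace OscSystem

/-! ### Smoothness and periodicity of the averaged coefficients -/

/-- Joint smoothness of a function of `(R, Ψ, S)`. -/
def Smooth3 (w : ℝ → ℝ → ℝ → ℝ) : Prop :=
  ContDiff ℝ ∞ (fun p : ℝ × ℝ × ℝ => w p.1 p.2.1 p.2.2)

/-- Periodicity in `S` with period `2πϰ`. -/
def Per (P : OscSystem) (w : ℝ → ℝ → ℝ → ℝ) : Prop :=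
  ∀ R Ψ S, w R Ψ (S + 2 * Real.pi * P.ϰ) = w R Ψ S

theorem Smooth3.comp {w : ℝ → ℝ → ℝ → ℝ} (hw : Smooth3 w) {E : Type} [NormedAddCommGroup E]
    [NormedSpace ℝ E] {a b c : E → ℝ} (ha : ContDiff ℝ ∞ a) (hb : ContDiff ℝ ∞ b)
    (hc : ContDiff ℝ ∞ c) : ContDiff ℝ ∞ (fun e => w (a e) (b e) (c e)) :=
  ContDiff.comp (g := fun p : ℝ × ℝ × ℝ => w p.1 p.2.1 p.2.2) hw (ha.prodMk (hb.prodMk hc))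

theorem Smooth3.deriv1 {w : ℝ → ℝ → ℝ → ℝ} (hw : Smooth3 w) :
    Smooth3 (fun R Ψ S => deriv (fun x => w x Ψ S) R) :=
  contDiff_deriv_fst (E := ℝ × ℝ) (g := fun x p => w x p.1 p.2) hw

theorem Smooth3.deriv2 {w : ℝ → ℝ → ℝ → ℝ} (hw : Smooth3 w) :
    Smooth3 (fun R Ψ S => deriv (fun x => w R x S) Ψ) := by
  have h : Smooth3 (fun x R S => w R x S) := hw.comp (by fun_prop) (by fun_prop) (by fun_prop)
  exact h.deriv1.comp (E := ℝ × ℝ × ℝ) (a := fun p => p.2.1) (b := fun p => p.1)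
    (c := fun p => p.2.2) (by fun_prop) (by fun_prop) (by fun_prop)

theorem Smooth3.deriv3 {w : ℝ → ℝ → ℝ → ℝ} (hw : Smooth3 w) :
    Smooth3 (fun R Ψ S => deriv (fun x => w R Ψ x) S) := by
  have h : Smooth3 (fun x R Ψ => w R Ψ x) := hw.comp (by fun_prop) (by fun_prop) (by fun_prop)
  exact h.deriv1.comp (E := ℝ × ℝ × ℝ) (a := fun p => p.2.2) (b := fun p => p.1)
    (c := fun p => p.2.1) (by fun_prop) (by fun_prop) (by fun_prop)

theorem Smooth3.sub {w z : ℝ → ℝ → ℝ → ℝ} (hw : Smooth3 w) (hz : Smooth3 z) :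
    Smooth3 (fun R Ψ S => w R Ψ S - z R Ψ S) := ContDiff.sub hw hz

theorem Smooth3.mul {w z : ℝ → ℝ → ℝ → ℝ} (hw : Smooth3 w) (hz : Smooth3 z) :
    Smooth3 (fun R Ψ S => w R Ψ S * z R Ψ S) := ContDiff.mul hw hz

/-- The data of one order are smooth, and those of the transformation are periodic. -/
structure IsSmoothLevel (P : OscSystem) (A : AvgLevel) : Prop where
  Lam : ContDiff ℝ ∞ (fun p : ℝ × ℝ => A.Lam p.1 p.2)
  Om : ContDiff ℝ ∞ (fun p : ℝ × ℝ => A.Om p.1 p.2)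
  u : Smooth3 A.u
  v : Smooth3 A.v
  u_per : P.Per A.u
  v_per : P.Per A.v

variable {P : OscSystem}

theorem Standing.strip (hP : P.Standing) : P.a ∈ Set.Ioo (-P.Rmax) P.Rmax := abs_lt.1 hP.a_lt

theorem IsCoeff.contDiffOn_Ioo {F : ℝ → ℝ → ℝ → ℝ} (hF : P.IsCoeff F) :
    ContDiffOn ℝ ∞ (fun p : ℝ × ℝ × ℝ => F p.1 p.2.1 p.2.2)
      (Set.Ioo (-P.Rmax) P.Rmax ×ˢ Set.univ) :=
  hF.smooth.mono fun _ hp => (abs_lt.2 hp.1).le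

theorem IsCoeff.smooth_iteratedDeriv (hP : P.Standing) {F : ℝ → ℝ → ℝ → ℝ} (hF : P.IsCoeff F)
    (i : ℕ) : Smooth3 (fun _ Ψ S =>
      iteratedDeriv i (fun r => F r ((P.κ : ℝ) / (P.ϰ : ℝ) * S + Ψ) S) P.a) := by
  have h := contDiffOn_iteratedDeriv_fst (E := ℝ × ℝ) (g := fun r y => F r y.1 y.2) isOpen_Ioo
    hF.contDiffOn_Ioo i
  refine contDiffOn_univ.1 (h.comp (f := fun p : ℝ × ℝ × ℝ =>
    (P.a, (P.κ : ℝ) / (P.ϰ : ℝ) * p.2.2 + p.2.1, p.2.2)) (ContDiff.contDiffOn ?_) ?_)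
  · fun_prop
  · exact fun p _ => ⟨hP.strip, Set.mem_univ _⟩

theorem IsCoeff.periodic_nat {F : ℝ → ℝ → ℝ → ℝ} (hF : P.IsCoeff F) {r : ℝ} (hr : |r| ≤ P.Rmax)
    (φ S : ℝ) (i j : ℕ) :
    F r (φ + i * (2 * Real.pi)) (S + j * (2 * Real.pi)) = F r φ S := by
  have h1 : Function.Periodic (fun φ => F r φ (S + j * (2 * Real.pi))) (2 * Real.pi) :=
    fun φ => hF.periodic_φ r φ _ hr
  have h2 : Function.Periodic (fun S => F r φ S) (2 * Real.pi) := fun S => hF.periodic_S r φ S hr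
  exact (h1.nat_mul i φ).trans (h2.nat_mul j S)

theorem IsCoeff.per_comp (hP : P.Standing) {F : ℝ → ℝ → ℝ → ℝ} (hF : P.IsCoeff F) {r : ℝ}
    (hr : |r| ≤ P.Rmax) (Ψ S : ℝ) :
    F r ((P.κ : ℝ) / (P.ϰ : ℝ) * (S + 2 * Real.pi * P.ϰ) + Ψ) (S + 2 * Real.pi * P.ϰ)
      = F r ((P.κ : ℝ) / (P.ϰ : ℝ) * S + Ψ) S := by
  have h0 : (P.ϰ : ℝ) ≠ 0 := by exact_mod_cast hP.ϰ_pos.ne'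
  rw [← hF.periodic_nat hr ((P.κ : ℝ) / (P.ϰ : ℝ) * S + Ψ) S P.κ P.ϰ]
  congr 1
  · field_simp
    ring
  · ring

theorem Standing.eventually_strip (hP : P.Standing) : ∀ᶠ r in nhds P.a, |r| ≤ P.Rmax :=
  (continuous_abs.tendsto P.a).eventually (eventually_le_nhds hP.a_lt)

theorem IsCoeff.per_iteratedDeriv (hP : P.Standing) {F : ℝ → ℝ → ℝ → ℝ} (hF : P.IsCoeff F)
    (i : ℕ) : P.Per (fun _ Ψ S =>
      iteratedDeriv i (fun r => F r ((P.κ : ℝ) / (P.ϰ : ℝ) * S + Ψ) S) P.a) := by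
  intro _ Ψ S
  refine Filter.EventuallyEq.iteratedDeriv_eq i ?_
  filter_upwards [hP.eventually_strip] with r hr
  exact hF.per_comp hP hr Ψ S

theorem smooth_Fk (hP : P.Standing) (k : ℕ) : Smooth3 (P.Fk k) := by
  refine ContDiff.add (ContDiff.sum fun j hj => ?_) ?_
  · have h := (hP.pert_f.coeff j (Finset.mem_Icc.1 hj).1).smooth_iteratedDeriv hP (k + 1 - 2 * j)
    exact ((ContDiff.mul h (contDiff_fst.pow _))).div_const _
  · split_ifs
    · exact contDiff_fst.div_const _
    · exact contDiff_const

theorem smooth_Gk (hP : P.Standing) (k : ℕ) : Smooth3 (P.Gk k) := by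
  refine ContDiff.add (ContDiff.sub ?_ contDiff_const) (ContDiff.sum fun j hj => ?_)
  · exact (contDiff_const.mul (contDiff_fst.pow _)).div_const _
  · have h := (hP.pert_g.coeff j (Finset.mem_Icc.1 hj).1).smooth_iteratedDeriv hP (k - 2 * j)
    exact ((ContDiff.mul h (contDiff_fst.pow _))).div_const _

theorem per_Fk (hP : P.Standing) (k : ℕ) : P.Per (P.Fk k) := by
  intro R Ψ S
  unfold Fk
  congr 1
  refine Finset.sum_congr rfl fun j hj => ?_
  have h := (hP.pert_f.coeff j (Finset.mem_Icc.1 hj).1).per_iteratedDeriv hP (k + 1 - 2 * j) R Ψ S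
  beta_reduce at h
  rw [h]

theorem per_Gk (hP : P.Standing) (k : ℕ) : P.Per (P.Gk k) := by
  intro R Ψ S
  unfold Gk
  congr 1
  refine Finset.sum_congr rfl fun j hj => ?_
  have h := (hP.pert_g.coeff j (Finset.mem_Icc.1 hj).1).per_iteratedDeriv hP (k - 2 * j) R Ψ S
  beta_reduce at h
  rw [h]

/-- The near-identity curve `τ ↦ R + ∑_{i ≤ p} τ^i u_i`. -/
def nearR (L : ℕ → AvgLevel) (p : ℕ) (τ R Ψ S : ℝ) : ℝ :=
  R + ∑ i ∈ Finset.Icc 1 p, τ ^ i * (L i).u R Ψ S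

/-- The near-identity curve `τ ↦ Ψ + ∑_{i ≤ p} τ^i v_i`. -/
def nearΨ (L : ℕ → AvgLevel) (p : ℕ) (τ R Ψ S : ℝ) : ℝ :=
  Ψ + ∑ i ∈ Finset.Icc 1 p, τ ^ i * (L i).v R Ψ S

theorem smooth_nearR {L : ℕ → AvgLevel} {p : ℕ} (hL : ∀ i, 1 ≤ i → i ≤ p → P.IsSmoothLevel (L i)) :
    ContDiff ℝ ∞ (fun y : ℝ × ℝ × ℝ × ℝ => nearR L p y.1 y.2.1 y.2.2.1 y.2.2.2) := by
  refine ContDiff.add (by fun_prop) (ContDiff.sum fun i hi => ?_)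
  have hi' := Finset.mem_Icc.1 hi
  exact (contDiff_fst.pow i).mul (ContDiff.comp (hL i hi'.1 hi'.2).u contDiff_snd)

theorem smooth_nearΨ {L : ℕ → AvgLevel} {p : ℕ} (hL : ∀ i, 1 ≤ i → i ≤ p → P.IsSmoothLevel (L i)) :
    ContDiff ℝ ∞ (fun y : ℝ × ℝ × ℝ × ℝ => nearΨ L p y.1 y.2.1 y.2.2.1 y.2.2.2) := by
  refine ContDiff.add (by fun_prop) (ContDiff.sum fun i hi => ?_)
  have hi' := Finset.mem_Icc.1 hi
  exact (contDiff_fst.pow i).mul (ContDiff.comp (hL i hi'.1 hi'.2).v contDiff_snd)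

theorem per_nearR {L : ℕ → AvgLevel} {p : ℕ} (hL : ∀ i, 1 ≤ i → i ≤ p → P.IsSmoothLevel (L i))
    (τ : ℝ) : P.Per (nearR L p τ) := by
  intro R Ψ S
  unfold nearR
  congr 1
  refine Finset.sum_congr rfl fun i hi => ?_
  have hi' := Finset.mem_Icc.1 hi
  rw [(hL i hi'.1 hi'.2).u_per R Ψ S]

theorem per_nearΨ {L : ℕ → AvgLevel} {p : ℕ} (hL : ∀ i, 1 ≤ i → i ≤ p → P.IsSmoothLevel (L i))
    (τ : ℝ) : P.Per (nearΨ L p τ) := by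
  intro R Ψ S
  unfold nearΨ
  congr 1
  refine Finset.sum_congr rfl fun i hi => ?_
  have hi' := Finset.mem_Icc.1 hi
  rw [(hL i hi'.1 hi'.2).v_per R Ψ S]

theorem smooth_near_comp {L : ℕ → AvgLevel} {p : ℕ} {A : ℝ → ℝ → ℝ}
    (hA : ContDiff ℝ ∞ (fun p : ℝ × ℝ => A p.1 p.2))
    (hL : ∀ i, 1 ≤ i → i ≤ p → P.IsSmoothLevel (L i)) :
    ContDiff ℝ ∞ (fun y : ℝ × ℝ × ℝ × ℝ => A (nearR L p y.1 y.2.1 y.2.2.1 y.2.2.2)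
      (nearΨ L p y.1 y.2.1 y.2.2.1 y.2.2.2)) :=
  ContDiff.comp (g := fun p : ℝ × ℝ => A p.1 p.2) hA ((smooth_nearR hL).prodMk (smooth_nearΨ hL))

theorem smooth_substCoeff {L : ℕ → AvgLevel} {p : ℕ} {A : ℝ → ℝ → ℝ}
    (hA : ContDiff ℝ ∞ (fun p : ℝ × ℝ => A p.1 p.2))
    (hL : ∀ i, 1 ≤ i → i ≤ p → P.IsSmoothLevel (L i)) : Smooth3 (substCoeff L A p) := by
  have h := contDiff_iteratedDeriv_fst (E := ℝ × ℝ × ℝ)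
    (g := fun τ y => A (nearR L p τ y.1 y.2.1 y.2.2) (nearΨ L p τ y.1 y.2.1 y.2.2))
    (smooth_near_comp hA hL) p
  exact (h.comp (contDiff_const (c := (0 : ℝ)).prodMk contDiff_id)).div_const _

theorem per_substCoeff {L : ℕ → AvgLevel} {p : ℕ} {A : ℝ → ℝ → ℝ}
    (hL : ∀ i, 1 ≤ i → i ≤ p → P.IsSmoothLevel (L i)) : P.Per (substCoeff L A p) := by
  intro R Ψ S
  have h : (fun τ => A (nearR L p τ R Ψ (S + 2 * Real.pi * P.ϰ))
      (nearΨ L p τ R Ψ (S + 2 * Real.pi * P.ϰ))) =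
      fun τ => A (nearR L p τ R Ψ S) (nearΨ L p τ R Ψ S) := by
    ext τ
    rw [per_nearR hL τ R Ψ S, per_nearΨ hL τ R Ψ S]
  exact congrArg (taylorCoeff p) h

theorem smooth_transport (hP : P.Standing) (k j : ℕ) {w : ℝ → ℝ → ℝ → ℝ} (hw : Smooth3 w) :
    Smooth3 (P.transport k j w) := by
  refine ContDiff.add (ContDiff.add (ContDiff.add ?_ ?_) ?_) ?_
  · exact (smooth_Fk hP j).mul hw.deriv1
  · exact (smooth_Gk hP j).mul hw.deriv2
  · exact contDiff_const.mul hw.deriv3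
  · split_ifs
    · exact contDiff_const.mul hw
    · exact contDiff_const

theorem Per.deriv1 {w : ℝ → ℝ → ℝ → ℝ} (hw : P.Per w) :
    P.Per (fun R Ψ S => deriv (fun x => w x Ψ S) R) := by
  intro R Ψ S
  simp only [hw _ _ _]

theorem Per.deriv2 {w : ℝ → ℝ → ℝ → ℝ} (hw : P.Per w) :
    P.Per (fun R Ψ S => deriv (fun x => w R x S) Ψ) := by
  intro R Ψ S
  simp only [hw _ _ _]

theorem Per.deriv3 {w : ℝ → ℝ → ℝ → ℝ} (hw : P.Per w) :
    P.Per (fun R Ψ S => deriv (fun x => w R Ψ x) S) := by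
  intro R Ψ S
  have h := deriv_comp_add_const (fun x => w R Ψ x) (2 * Real.pi * P.ϰ) S
  simp only [hw _ _ _] at h
  exact h.symm

theorem per_transport (hP : P.Standing) (k j : ℕ) {w : ℝ → ℝ → ℝ → ℝ} (hw : P.Per w) :
    P.Per (P.transport k j w) := by
  intro R Ψ S
  have h1 := hw.deriv1 R Ψ S
  have h2 := hw.deriv2 R Ψ S
  have h3 := hw.deriv3 R Ψ S
  simp only at h1 h2 h3
  simp only [transport, per_Fk hP j R Ψ S, per_Gk hP j R Ψ S, h1, h2, h3, hw R Ψ S]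

theorem smooth_Ftilde (hP : P.Standing) {L : ℕ → AvgLevel} {k : ℕ}
    (hL : ∀ i, 1 ≤ i → i < k → P.IsSmoothLevel (L i)) : Smooth3 (P.Ftilde L k) := by
  refine ContDiff.sub (ContDiff.sum fun j hj => ?_) (ContDiff.sum fun j hj => ?_)
  all_goals have hj' := Finset.mem_Ico.1 hj
  · exact smooth_substCoeff (hL j hj'.1 hj'.2).Lam fun i h1 h2 => hL i h1 (by omega)
  · exact smooth_transport hP k j (hL (k - j) (by omega) (by omega)).u

theorem smooth_Gtilde (hP : P.Standing) {L : ℕ → AvgLevel} {k : ℕ}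
    (hL : ∀ i, 1 ≤ i → i < k → P.IsSmoothLevel (L i)) : Smooth3 (P.Gtilde L k) := by
  refine ContDiff.sub (ContDiff.sum fun j hj => ?_) (ContDiff.sum fun j hj => ?_)
  all_goals have hj' := Finset.mem_Ico.1 hj
  · exact smooth_substCoeff (hL j hj'.1 hj'.2).Om fun i h1 h2 => hL i h1 (by omega)
  · exact smooth_transport hP k j (hL (k - j) (by omega) (by omega)).v

theorem per_Ftilde (hP : P.Standing) {L : ℕ → AvgLevel} {k : ℕ}
    (hL : ∀ i, 1 ≤ i → i < k → P.IsSmoothLevel (L i)) : P.Per (P.Ftilde L k) := by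
  intro R Ψ S
  unfold Ftilde
  congr 1 <;> refine Finset.sum_congr rfl fun j hj => ?_
  all_goals have hj' := Finset.mem_Ico.1 hj
  · exact per_substCoeff (fun i h1 h2 => hL i h1 (by omega)) R Ψ S
  · exact per_transport hP k j (hL (k - j) (by omega) (by omega)).u_per R Ψ S

theorem per_Gtilde (hP : P.Standing) {L : ℕ → AvgLevel} {k : ℕ}
    (hL : ∀ i, 1 ≤ i → i < k → P.IsSmoothLevel (L i)) : P.Per (P.Gtilde L k) := by
  intro R Ψ S
  unfold Gtilde
  congr 1 <;> refine Finset.sum_congr rfl fun j hj => ?_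
  all_goals have hj' := Finset.mem_Ico.1 hj
  · exact per_substCoeff (fun i h1 h2 => hL i h1 (by omega)) R Ψ S
  · exact per_transport hP k j (hL (k - j) (by omega) (by omega)).v_per R Ψ S

/-! #### Means and primitives -/

theorem smooth_mean {w : ℝ → ℝ → ℝ → ℝ} (hw : Smooth3 w) :
    ContDiff ℝ ∞ (fun p : ℝ × ℝ => P.mean (fun S => w p.1 p.2 S)) := by
  refine contDiff_const.mul (contDiff_parametric_integral (E := ℝ × ℝ)
    (f := fun p S => w p.1 p.2 S) ?_ _ _)
  exact hw.comp (by fun_prop) (by fun_prop) (by fun_prop)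

theorem smooth_zeroMeanPrimitive {w : ℝ → ℝ → ℝ → ℝ} (hw : Smooth3 w) :
    Smooth3 (fun R Ψ S => P.zeroMeanPrimitive (fun x => w R Ψ x) S) := by
  have h1 : Smooth3 (fun R Ψ S => ∫ x in (0 : ℝ)..S, w R Ψ x) := by
    have := contDiff_parametric_primitive (E := ℝ × ℝ) (f := fun p S => w p.1 p.2 S)
      (hw.comp (by fun_prop) (by fun_prop) (by fun_prop))
    exact this.comp (f := fun p : ℝ × ℝ × ℝ => ((p.1, p.2.1), p.2.2)) (by fun_prop)
  refine ContDiff.sub h1 ?_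
  exact (smooth_mean (P := P) h1).comp (f := fun p : ℝ × ℝ × ℝ => (p.1, p.2.1)) (by fun_prop)

theorem mean_const_sub_add (hP : P.Standing) {w : ℝ → ℝ} (hw : Continuous w) :
    ∫ x in (0 : ℝ)..(2 * Real.pi * P.ϰ), (P.mean w - w x) = 0 := by
  rw [intervalIntegral.integral_sub intervalIntegrable_const (hw.intervalIntegrable _ _),
    intervalIntegral.integral_const, mean]
  have h0 : (P.ϰ : ℝ) ≠ 0 := by exact_mod_cast hP.ϰ_pos.ne'
  have := Real.pi_ne_zero
  simp only [smul_eq_mul, sub_zero]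
  field_simp
  ring

theorem per_zeroMeanPrimitive {w : ℝ → ℝ} (hw : Continuous w)
    (hper : ∀ S, w (S + 2 * Real.pi * P.ϰ) = w S)
    (h0 : ∫ x in (0 : ℝ)..(2 * Real.pi * P.ϰ), w x = 0) (S : ℝ) :
    P.zeroMeanPrimitive w (S + 2 * Real.pi * P.ϰ) = P.zeroMeanPrimitive w S := by
  unfold zeroMeanPrimitive
  congr 1
  have hp : Function.Periodic w (2 * Real.pi * P.ϰ) := hper
  rw [hp.intervalIntegral_add_eq_add 0 S (fun _ _ => hw.intervalIntegrable _ _), zero_add, h0,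
    add_zero]

theorem deriv_zeroMeanPrimitive {w : ℝ → ℝ} (hw : Continuous w) (S : ℝ) :
    HasDerivAt (P.zeroMeanPrimitive w) (w S) S := by
  unfold zeroMeanPrimitive
  exact (hw.integral_hasStrictDerivAt 0 S).hasDerivAt.sub_const _

theorem isSmoothLevel_nextLevel (hP : P.Standing) {L : ℕ → AvgLevel} {k : ℕ}
    (hL : ∀ i, 1 ≤ i → i < k → P.IsSmoothLevel (L i)) : P.IsSmoothLevel (P.nextLevel L k) := by
  have key : ∀ {X Y : ℝ → ℝ → ℝ → ℝ}, Smooth3 X → Smooth3 Y → P.Per X → P.Per Y →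
      ContDiff ℝ ∞ (fun p : ℝ × ℝ => P.mean (fun S => X p.1 p.2 S - Y p.1 p.2 S)) ∧
      Smooth3 (fun R Ψ S => P.zeroMeanPrimitive (fun x =>
        P.mean (fun y => X R Ψ y - Y R Ψ y) - X R Ψ x + Y R Ψ x) S / P.s 0) ∧
      P.Per (fun R Ψ S => P.zeroMeanPrimitive (fun x =>
        P.mean (fun y => X R Ψ y - Y R Ψ y) - X R Ψ x + Y R Ψ x) S / P.s 0) := by
    intro X Y hX hY hXp hYp
    have hm := smooth_mean (P := P) (hX.sub hY)
    have hw : Smooth3 (fun R Ψ S => P.mean (fun y => X R Ψ y - Y R Ψ y) - X R Ψ S + Y R Ψ S) :=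
      ContDiff.add (ContDiff.sub (hm.comp (f := fun p : ℝ × ℝ × ℝ => (p.1, p.2.1)) (by fun_prop))
        hX) hY
    refine ⟨hm, (smooth_zeroMeanPrimitive hw).div_const _, fun R Ψ S => ?_⟩
    dsimp only
    congr 1
    have hc : ∀ {w : ℝ → ℝ → ℝ → ℝ}, Smooth3 w → Continuous (fun S => w R Ψ S) := fun h =>
      ContDiff.continuous (n := ∞) (h.comp (by fun_prop) (by fun_prop) (by fun_prop))
    refine per_zeroMeanPrimitive (hc hw) (fun S => ?_) ?_ S
    · rw [hXp R Ψ S, hYp R Ψ S]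
    · have := mean_const_sub_add hP (hc (hX.sub hY))
      simpa [sub_sub_eq_add_sub, sub_add_eq_add_sub] using this
  obtain ⟨f1, f2, f3⟩ := key (smooth_Fk hP k) (smooth_Ftilde hP hL) (per_Fk hP k) (per_Ftilde hP hL)
  obtain ⟨g1, g2, g3⟩ := key (smooth_Gk hP k) (smooth_Gtilde hP hL) (per_Gk hP k) (per_Gtilde hP hL)
  exact ⟨f1, g1, f2, g2, f3, g3⟩

/-- The order `k` of the averaging procedure. -/
noncomputable def lev (P : OscSystem) (k : ℕ) : AvgLevel := P.levels k k

theorem levels_of_le {k K : ℕ} (h : k ≤ K) : P.levels K k = P.lev k := by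
  induction K with
  | zero => obtain rfl : k = 0 := by omega
            rfl
  | succ K ih =>
    rcases Nat.lt_or_ge k (K + 1) with h1 | h1
    · rw [levels, Function.update_of_ne (by omega), ih (by omega)]
    · obtain rfl : k = K + 1 := by omega
      rfl

theorem nextLevel_congr {L L' : ℕ → AvgLevel} {k : ℕ} (h : ∀ j, 1 ≤ j → j < k → L j = L' j) :
    P.nextLevel L k = P.nextLevel L' k := by
  have hs : ∀ (A : ℝ → ℝ → ℝ) (p : ℕ), p < k → substCoeff L A p = substCoeff L' A p := by
    intro A p hp
    ext R Ψ S
    unfold substCoeff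
    congr 1
    ext τ
    congr 2 <;> refine Finset.sum_congr rfl fun i hi => ?_
    all_goals
      have := Finset.mem_Icc.1 hi
      rw [h i this.1 (by omega)]
  have hF : P.Ftilde L k = P.Ftilde L' k := by
    ext R Ψ S
    unfold Ftilde
    congr 1 <;> refine Finset.sum_congr rfl fun j hj => ?_
    all_goals have := Finset.mem_Ico.1 hj
    · rw [h j this.1 this.2, hs _ _ (by omega)]
    · rw [h (k - j) (by omega) (by omega)]
  have hG : P.Gtilde L k = P.Gtilde L' k := by
    ext R Ψ S
    unfold Gtilde
    congr 1 <;> refine Finset.sum_congr rfl fun j hj => ?_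
    all_goals have := Finset.mem_Ico.1 hj
    · rw [h j this.1 this.2, hs _ _ (by omega)]
    · rw [h (k - j) (by omega) (by omega)]
  unfold nextLevel
  rw [hF, hG]

theorem lev_eq {k : ℕ} (hk : 1 ≤ k) : P.lev k = P.nextLevel P.lev k := by
  obtain ⟨k, rfl⟩ : ∃ j, k = j + 1 := ⟨k - 1, by omega⟩
  have : P.lev (k + 1) = P.nextLevel (P.levels k) (k + 1) := by
    simp [lev, levels]
  rw [this]
  exact nextLevel_congr fun j _ h => levels_of_le (by omega)

theorem isSmoothLevel_lev (hP : P.Standing) (k : ℕ) (hk : 1 ≤ k) : P.IsSmoothLevel (P.lev k) := by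
  induction k using Nat.strong_induction_on with
  | _ k ih =>
    rw [lev_eq hk]
    exact isSmoothLevel_nextLevel hP fun i h1 h2 => ih i h2 h1

end OscSystem

/-! ### Uniform expansions in powers of a small parameter -/

/-- `Φ(τ, y) = ∑_{k ≤ K} τ^k c_k(y) + O(τ^{K+1})` uniformly for `y ∈ D` and `0 < τ ≤ 1`, with bounded
coefficients. -/
def UExp {Y : Type} (D : Set Y) (K : ℕ) (Φ : ℝ → Y → ℝ) (c : ℕ → Y → ℝ) : Prop :=
  ∃ C, 0 ≤ C ∧ ∀ y ∈ D, (∀ k, k ≤ K → |c k y| ≤ C) ∧ ∀ τ, 0 < τ → τ ≤ 1 →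
    |Φ τ y - ∑ k ∈ Finset.range (K + 1), τ ^ k * c k y| ≤ C * τ ^ (K + 1)

section UExp

variable {Y : Type} {D : Set Y} {K : ℕ}

theorem UExp.congr {Φ Φ' : ℝ → Y → ℝ} {c c' : ℕ → Y → ℝ} (h : UExp D K Φ c)
    (h1 : ∀ τ, 0 < τ → τ ≤ 1 → ∀ y ∈ D, Φ' τ y = Φ τ y)
    (h2 : ∀ k ≤ K, ∀ y ∈ D, c' k y = c k y) : UExp D K Φ' c' := by
  obtain ⟨C, hC, h⟩ := h
  refine ⟨C, hC, fun y hy => ⟨fun k hk => ?_, fun τ h0 h1' => ?_⟩⟩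
  · rw [h2 k hk y hy]; exact (h y hy).1 k hk
  · rw [h1 τ h0 h1' y hy, Finset.sum_congr rfl fun k hk => by
      rw [h2 k (Nat.lt_succ_iff.1 (Finset.mem_range.1 hk)) y hy]]
    exact (h y hy).2 τ h0 h1'

theorem UExp.add {Φ Φ' : ℝ → Y → ℝ} {c c' : ℕ → Y → ℝ} (h : UExp D K Φ c) (h' : UExp D K Φ' c') :
    UExp D K (fun τ y => Φ τ y + Φ' τ y) (fun k y => c k y + c' k y) := by
  obtain ⟨C, hC, h⟩ := h
  obtain ⟨C', hC', h'⟩ := h'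
  refine ⟨C + C', by positivity, fun y hy => ⟨fun k hk => ?_, fun τ h0 h1 => ?_⟩⟩
  · exact (abs_add_le _ _).trans (add_le_add ((h y hy).1 k hk) ((h' y hy).1 k hk))
  · have e : Φ τ y + Φ' τ y - ∑ k ∈ Finset.range (K + 1), τ ^ k * (c k y + c' k y) =
        (Φ τ y - ∑ k ∈ Finset.range (K + 1), τ ^ k * c k y) +
        (Φ' τ y - ∑ k ∈ Finset.range (K + 1), τ ^ k * c' k y) := by
      simp only [mul_add, Finset.sum_add_distrib]; ring
    rw [e, add_mul]
    exact (abs_add_le _ _).trans (add_le_add ((h y hy).2 τ h0 h1) ((h' y hy).2 τ h0 h1))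

theorem UExp.zero : UExp D K (fun _ _ => 0) (fun _ _ => 0) :=
  ⟨0, le_rfl, fun y _ => ⟨by simp, by simp⟩⟩

theorem UExp.neg {Φ : ℝ → Y → ℝ} {c : ℕ → Y → ℝ} (h : UExp D K Φ c) :
    UExp D K (fun τ y => -Φ τ y) (fun k y => -c k y) := by
  obtain ⟨C, hC, h⟩ := h
  refine ⟨C, hC, fun y hy => ⟨fun k hk => by rw [abs_neg]; exact (h y hy).1 k hk,
    fun τ h0 h1 => ?_⟩⟩
  have := (h y hy).2 τ h0 h1
  rw [← abs_neg] at this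
  convert this using 2
  simp only [mul_neg, Finset.sum_neg_distrib]; ring

theorem UExp.sum {ι : Type} {s : Finset ι} {Φ : ι → ℝ → Y → ℝ} {c : ι → ℕ → Y → ℝ}
    (h : ∀ i ∈ s, UExp D K (Φ i) (c i)) :
    UExp D K (fun τ y => ∑ i ∈ s, Φ i τ y) (fun k y => ∑ i ∈ s, c i k y) := by
  classical
  induction s using Finset.induction_on with
  | empty => simpa using UExp.zero
  | insert i s hi ih =>
    simp only [Finset.sum_insert hi]
    exact (h i (Finset.mem_insert_self _ _)).add
      (ih fun j hj => h j (Finset.mem_insert_of_mem hj))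

theorem UExp.shift_one {Φ : ℝ → Y → ℝ} {c : ℕ → Y → ℝ} (h : UExp D K Φ c) :
    UExp D (K + 1) (fun τ y => τ * Φ τ y) (fun k y => if 1 ≤ k then c (k - 1) y else 0) := by
  obtain ⟨C, hC, h⟩ := h
  refine ⟨C, hC, fun y hy => ⟨fun k hk => ?_, fun τ h0 h1 => ?_⟩⟩
  · dsimp only
    split_ifs
    · exact (h y hy).1 _ (by omega)
    · simpa using hC
  · have e : τ * Φ τ y - ∑ k ∈ Finset.range (K + 1 + 1), τ ^ k * (if 1 ≤ k then c (k - 1) y else 0)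
        = τ * (Φ τ y - ∑ k ∈ Finset.range (K + 1), τ ^ k * c k y) := by
      rw [Finset.sum_range_succ']
      simp only [pow_succ, Nat.le_add_left, if_true, Nat.add_sub_cancel]
      simp only [Nat.reduceLeDiff, if_false, mul_zero, add_zero, mul_sub, Finset.mul_sum]
      congr 1
      exact Finset.sum_congr rfl fun _ _ => by ring
    rw [e, abs_mul, abs_of_pos h0]
    calc τ * _ ≤ τ * (C * τ ^ (K + 1)) := by gcongr; exact (h y hy).2 τ h0 h1
      _ = C * τ ^ (K + 1 + 1) := by ring

theorem UExp.shift {Φ : ℝ → Y → ℝ} {c : ℕ → Y → ℝ} (j : ℕ) (h : UExp D K Φ c) :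
    UExp D (K + j) (fun τ y => τ ^ j * Φ τ y) (fun k y => if j ≤ k then c (k - j) y else 0) := by
  induction j with
  | zero => simpa using h
  | succ j ih =>
    refine ih.shift_one.congr (fun τ _ _ y _ => by ring) fun k _ y _ => ?_
    by_cases h1 : j + 1 ≤ k
    · rw [if_pos h1, if_pos (by omega), if_pos (by omega)]
      congr 1; omega
    · rw [if_neg h1]
      split_ifs
      · omega
      · rfl
      · rfl

theorem UExp.shift' {Φ : ℝ → Y → ℝ} {c : ℕ → Y → ℝ} {j : ℕ} (hj : j ≤ K) (h : UExp D (K - j) Φ c) :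
    UExp D K (fun τ y => τ ^ j * Φ τ y) (fun k y => if j ≤ k then c (k - j) y else 0) := by
  have := h.shift j
  rwa [Nat.sub_add_cancel hj] at this

theorem UExp.truncate {Φ : ℝ → Y → ℝ} {c : ℕ → Y → ℝ} {K' : ℕ} (hK : K ≤ K')
    (h : UExp D K' Φ c) : UExp D K Φ c := by
  induction K', hK using Nat.le_induction with
  | base => exact h
  | succ K' _ ih =>
    refine ih ?_
    obtain ⟨C, hC, h⟩ := h
    refine ⟨C + C, by positivity, fun y hy => ⟨fun k hk => ?_, fun τ h0 h1 => ?_⟩⟩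
    · linarith [(h y hy).1 k (by omega)]
    · have h2 := (h y hy).2 τ h0 h1
      rw [Finset.sum_range_succ] at h2
      have h3 := (h y hy).1 (K' + 1) le_rfl
      have h4 : |τ ^ (K' + 1) * c (K' + 1) y| ≤ C * τ ^ (K' + 1) := by
        rw [abs_mul, abs_of_pos (by positivity), mul_comm]
        gcongr
      have h5 : C * τ ^ (K' + 1 + 1) ≤ C * τ ^ (K' + 1) := by
        exact mul_le_mul_of_nonneg_left (pow_le_pow_of_le_one h0.le h1 (by omega)) hC
      have h6 := abs_add_le (Φ τ y - ∑ k ∈ Finset.range (K' + 1), τ ^ k * c k y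
        - τ ^ (K' + 1) * c (K' + 1) y) (τ ^ (K' + 1) * c (K' + 1) y)
      rw [sub_add_cancel, sub_sub] at h6
      linarith

theorem UExp.const {w : Y → ℝ} (hw : ∃ C, ∀ y ∈ D, |w y| ≤ C) :
    UExp D K (fun _ y => w y) (fun k y => if k = 0 then w y else 0) := by
  obtain ⟨C, hC⟩ := hw
  refine ⟨max C 0, le_max_right _ _, fun y hy => ⟨fun k _ => ?_, fun τ h0 _ => ?_⟩⟩
  · dsimp only
    split_ifs
    · exact (hC y hy).trans (le_max_left _ _)
    · simp
  · simp only [mul_ite, mul_zero, Finset.sum_ite_eq', Finset.mem_range, Nat.succ_pos, if_true,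
      pow_zero, one_mul, sub_self, abs_zero]
    positivity

/-- The expansion of `∑_j τ^j Φ_j(τ, y)`. -/
theorem UExp.sum_pow {Φ : ℕ → ℝ → Y → ℝ} {c : ℕ → ℕ → Y → ℝ}
    (h : ∀ j ≤ K, UExp D (K - j) (Φ j) (c j)) :
    UExp D K (fun τ y => ∑ j ∈ Finset.range (K + 1), τ ^ j * Φ j τ y)
      (fun k y => ∑ j ∈ Finset.range (k + 1), c j (k - j) y) := by
  refine (UExp.sum (s := Finset.range (K + 1)) fun j hj =>
    (h j (Nat.lt_succ_iff.1 (Finset.mem_range.1 hj))).shift'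
      (Nat.lt_succ_iff.1 (Finset.mem_range.1 hj))).congr (fun _ _ _ _ _ => rfl) fun k hk y _ => ?_
  rw [← Finset.sum_filter]
  refine Finset.sum_congr ?_ fun _ _ => rfl
  ext j
  simp only [Finset.mem_range, Finset.mem_filter]
  omega

theorem UExp.poly {w : ℕ → Y → ℝ} (hw : ∀ j ≤ K, ∃ C, ∀ y ∈ D, |w j y| ≤ C) :
    UExp D K (fun τ y => ∑ j ∈ Finset.range (K + 1), τ ^ j * w j y) w := by
  refine (UExp.sum_pow fun j hj => UExp.const (hw j hj)).congr (fun _ _ _ _ _ => rfl)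
    fun k _ y _ => ?_
  rw [Finset.sum_eq_single k]
  · simp
  · intro j hj hjk
    have := Finset.mem_range.1 hj
    rw [if_neg (by omega)]
  · intro h; exact absurd (Finset.mem_range.2 (Nat.lt_succ_self k)) h

end UExp

theorem iteratedDeriv_pow_mul_zero (l : ℕ) : ∀ {h : ℝ → ℝ}, ContDiff ℝ ∞ h →
    iteratedDeriv l (fun τ => τ ^ (l + 1) * h τ) 0 = 0 := by
  induction l with
  | zero => intro h _; simp
  | succ l ih =>
    intro h hh
    have hd : ContDiff ℝ ∞ (deriv h) := (contDiff_infty_iff_deriv.1 hh).2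
    rw [iteratedDeriv_succ']
    have : deriv (fun τ => τ ^ (l + 1 + 1) * h τ)
        = fun τ => τ ^ (l + 1) * ((l + 2) * h τ + τ * deriv h τ) := by
      ext τ
      have h1 := (hasDerivAt_pow (l + 1 + 1) τ).mul (hh.differentiable (by simp) τ).hasDerivAt
      rw [show (fun τ => τ ^ (l + 1 + 1) * h τ) = (fun τ => τ ^ (l + 1 + 1)) * h from rfl, h1.deriv]
      push_cast
      ring
    rw [this]
    exact ih (by fun_prop)

namespace OscSystem

variable {P : OscSystem}

/-! ### The near-identity transformation -/

/-- The region of the variables `(R, Ψ, S)` in which the averaging is carried out. -/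
def region (ψ₀ : ℝ) : Set (ℝ × ℝ × ℝ) := {y | |y.1| ≤ 1 ∧ |y.2.1 - ψ₀| ≤ 1}

theorem exists_region_bound (hP : P.Standing) (ψ₀ : ℝ) {p : ℝ × ℝ × ℝ → Prop}
    (hp : ∀ R Ψ S, p (R, Ψ, S + 2 * Real.pi * P.ϰ) ↔ p (R, Ψ, S))
    (h : ∀ y ∈ Set.Icc (-1 : ℝ) 1 ×ˢ Set.Icc (ψ₀ - 1) (ψ₀ + 1) ×ˢ
      Set.Icc (0 : ℝ) (2 * Real.pi * P.ϰ), p y) : ∀ y ∈ region ψ₀, p y := by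
  rintro ⟨R, Ψ, S⟩ ⟨h1, h2⟩
  have hper : Function.Periodic (fun S => p (R, Ψ, S)) (2 * Real.pi * P.ϰ) :=
    fun S => propext (hp R Ψ S)
  have hpos : 0 < 2 * Real.pi * P.ϰ := by
    have : (0 : ℝ) < P.ϰ := by exact_mod_cast hP.ϰ_pos
    have := Real.pi_pos
    positivity
  obtain ⟨S', hS', he⟩ := hper.exists_mem_Ico₀ hpos S
  change p (R, Ψ, S) = p (R, Ψ, S') at he
  rw [he]
  have h1' := abs_le.1 h1
  have h2' := abs_le.1 h2
  exact h _ ⟨h1', ⟨⟨by linarith [h2'.1], by linarith [h2'.2]⟩, ⟨hS'.1, hS'.2.le⟩⟩⟩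

theorem exists_bound_of_smooth_per (hP : P.Standing) (ψ₀ : ℝ) {w : ℝ → ℝ → ℝ → ℝ}
    (hw : Smooth3 w) (hper : P.Per w) : ∃ C, ∀ y ∈ region ψ₀, |w y.1 y.2.1 y.2.2| ≤ C := by
  obtain ⟨C, hC⟩ := ((isCompact_Icc (a := (-1 : ℝ)) (b := 1)).prod
    ((isCompact_Icc (a := ψ₀ - 1) (b := ψ₀ + 1)).prod
    (isCompact_Icc (a := (0 : ℝ)) (b := 2 * Real.pi * P.ϰ)))).exists_bound_of_continuousOn
    (ContDiff.continuous hw).continuousOn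
  refine ⟨C, exists_region_bound hP ψ₀ (fun R Ψ S => ?_) hC⟩
  simp only [hper R Ψ S]

theorem taylorCoeff_near {L : ℕ → AvgLevel} {l K : ℕ} (hl : l ≤ K) {A : ℝ → ℝ → ℝ}
    (hA : ContDiff ℝ ∞ (fun p : ℝ × ℝ => A p.1 p.2)) (R Ψ S : ℝ) :
    taylorCoeff l (fun τ => A (nearR L K τ R Ψ S) (nearΨ L K τ R Ψ S)) =
      substCoeff L A l R Ψ S := by
  have hsplit : ∀ (c : ℕ → ℝ) (τ : ℝ), ∑ i ∈ Finset.Icc 1 K, τ ^ i * c i =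
      ∑ i ∈ Finset.Icc 1 l, τ ^ i * c i +
        τ ^ (l + 1) * ∑ i ∈ Finset.Icc (l + 1) K, τ ^ (i - (l + 1)) * c i := by
    intro c τ
    rw [Finset.mul_sum, ← Finset.Ico_add_one_right_eq_Icc, ← Finset.Ico_add_one_right_eq_Icc,
      ← Finset.Ico_add_one_right_eq_Icc,
      ← Finset.sum_Ico_consecutive _ (show 1 ≤ l + 1 by omega) (show l + 1 ≤ K + 1 by omega)]
    congr 1
    refine Finset.sum_congr rfl fun i hi => ?_
    have := (Finset.mem_Ico.1 hi).1
    rw [← mul_assoc, ← pow_add, show l + 1 + (i - (l + 1)) = i by omega]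
  set m₁ : ℝ → ℝ := fun τ => ∑ i ∈ Finset.Icc (l + 1) K, τ ^ (i - (l + 1)) * (L i).u R Ψ S with hm₁
  set m₂ : ℝ → ℝ := fun τ => ∑ i ∈ Finset.Icc (l + 1) K, τ ^ (i - (l + 1)) * (L i).v R Ψ S with hm₂
  have hm₁s : ContDiff ℝ ∞ m₁ := ContDiff.sum fun i _ => by fun_prop
  have hm₂s : ContDiff ℝ ∞ m₂ := ContDiff.sum fun i _ => by fun_prop
  set n₁ : ℝ → ℝ := fun τ => nearR L l τ R Ψ S with hn₁
  set n₂ : ℝ → ℝ := fun τ => nearΨ L l τ R Ψ S with hn₂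
  have hn₁s : ContDiff ℝ ∞ n₁ := contDiff_const.add (ContDiff.sum fun i _ => by fun_prop)
  have hn₂s : ContDiff ℝ ∞ n₂ := contDiff_const.add (ContDiff.sum fun i _ => by fun_prop)
  have hB : ContDiff ℝ ∞ (fun p : ℝ × ℝ => A (n₁ p.2 + p.1 * m₁ p.2) (n₂ p.2 + p.1 * m₂ p.2)) :=
    hA.comp (f := fun p : ℝ × ℝ => (n₁ p.2 + p.1 * m₁ p.2, n₂ p.2 + p.1 * m₂ p.2)) (by fun_prop)
  obtain ⟨B₁, hB₁, hB₁e, -⟩ := exists_hadamard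
    (g := fun s τ => A (n₁ τ + s * m₁ τ) (n₂ τ + s * m₂ τ)) hB
  have e : (fun τ => A (nearR L K τ R Ψ S) (nearΨ L K τ R Ψ S)) =
      fun τ => A (n₁ τ) (n₂ τ) + τ ^ (l + 1) * B₁ (τ ^ (l + 1)) τ := by
    ext τ
    have h1 : nearR L K τ R Ψ S = n₁ τ + τ ^ (l + 1) * m₁ τ := by
      simp only [nearR, hn₁, hm₁, hsplit]; ring
    have h2 : nearΨ L K τ R Ψ S = n₂ τ + τ ^ (l + 1) * m₂ τ := by
      simp only [nearΨ, hn₂, hm₂, hsplit]; ring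
    rw [h1, h2]
    simpa using hB₁e (τ ^ (l + 1)) τ
  have hh : ContDiff ℝ ∞ (fun τ => B₁ (τ ^ (l + 1)) τ) :=
    hB₁.comp (f := fun τ : ℝ => (τ ^ (l + 1), τ)) (by fun_prop)
  have hg : ContDiff ℝ ∞ (fun τ => A (n₁ τ) (n₂ τ)) :=
    hA.comp (f := fun τ => (n₁ τ, n₂ τ)) (by fun_prop)
  unfold substCoeff taylorCoeff
  congr 1
  rw [e]
  rw [iteratedDeriv_fun_add, iteratedDeriv_pow_mul_zero l hh, add_zero]
  · rfl
  · exact (contDiff_infty.1 hg l).contDiffAt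
  · exact (contDiff_infty.1 ((contDiff_id.pow _).mul hh) l).contDiffAt

/-- The expansion of `A(R + ∑ τ^i u_i, Ψ + ∑ τ^i v_i)`. -/
theorem uExp_near (hP : P.Standing) (ψ₀ : ℝ) {L : ℕ → AvgLevel}
    (hL : ∀ i, 1 ≤ i → P.IsSmoothLevel (L i)) {A : ℝ → ℝ → ℝ}
    (hA : ContDiff ℝ ∞ (fun p : ℝ × ℝ => A p.1 p.2)) {K J : ℕ} (hJ : J ≤ K) :
    UExp (region ψ₀) J
      (fun τ y => A (nearR L K τ y.1 y.2.1 y.2.2) (nearΨ L K τ y.1 y.2.1 y.2.2))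
      (fun l y => substCoeff L A l y.1 y.2.1 y.2.2) := by
  refine UExp.truncate hJ ?_
  have hLs : ∀ l, Smooth3 (substCoeff L A l) := fun l => smooth_substCoeff hA fun i h _ => hL i h
  have hLp : ∀ l, P.Per (substCoeff L A l) := fun l => per_substCoeff fun i h _ => hL i h
  have hb : ∀ l, ∃ C, ∀ y ∈ region ψ₀, |substCoeff L A l y.1 y.2.1 y.2.2| ≤ C := fun l =>
    exists_bound_of_smooth_per hP ψ₀ (hLs l) (hLp l)
  choose Cl hCl using hb
  obtain ⟨C, hC0, hC⟩ := exists_taylor_bound (E := ℝ × ℝ × ℝ) (a := 0) (r := 1)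
    ((isCompact_Icc (a := (-1 : ℝ)) (b := 1)).prod
    ((isCompact_Icc (a := ψ₀ - 1) (b := ψ₀ + 1)).prod
    (isCompact_Icc (a := (0 : ℝ)) (b := 2 * Real.pi * P.ϰ)))) isOpen_univ (Set.subset_univ _)
    (K + 1) (g := fun τ y => A (nearR L K τ y.1 y.2.1 y.2.2) (nearΨ L K τ y.1 y.2.1 y.2.2))
    (by
      rw [Set.univ_prod_univ, contDiffOn_univ]
      exact smooth_near_comp hA fun i h _ => hL i h)
  refine ⟨C + ∑ l ∈ Finset.range (K + 1), |Cl l|, by positivity, fun y hy => ⟨fun k hk => ?_, ?_⟩⟩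
  · have h1 := Finset.single_le_sum (f := fun l => |Cl l|) (fun i _ => abs_nonneg _)
      (Finset.mem_range.2 (Nat.lt_succ_of_le hk))
    have h2 := (hCl k y hy).trans (le_abs_self _)
    linarith
  · revert hy
    revert y
    refine exists_region_bound hP ψ₀ ?_ ?_
    · intro R Ψ S
      simp only [per_nearR (P := P) (fun i h _ => hL i h) _ R Ψ S,
        per_nearΨ (P := P) (fun i h _ => hL i h) _ R Ψ S, hLp _ R Ψ S]
    · intro y hy τ h0 h1
      have h2 := hC τ (by rw [abs_of_pos h0]; exact h1) y hy
      rw [zero_add, abs_of_pos h0] at h2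
      have h3 : ∀ l ∈ Finset.range (K + 1), τ ^ l * (iteratedDeriv l (fun x =>
          A (nearR L K x y.1 y.2.1 y.2.2) (nearΨ L K x y.1 y.2.1 y.2.2)) 0 / (Nat.factorial l : ℝ))
          = τ ^ l * substCoeff L A l y.1 y.2.1 y.2.2 := by
        intro l hl
        rw [← taylorCoeff_near (Nat.lt_succ_iff.1 (Finset.mem_range.1 hl)) hA]
        rfl
      rw [Finset.sum_congr rfl h3] at h2
      refine h2.trans ?_
      gcongr
      have : 0 ≤ ∑ l ∈ Finset.range (K + 1), |Cl l| := by positivity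
      linarith

theorem Fk_zero (hP : P.Standing) (R Ψ S : ℝ) : P.Fk 0 R Ψ S = 0 := by
  have := hP.q_pos
  simp [Fk, this.ne']

theorem sDot_zero (hP : P.Standing) : P.sDot 0 = P.s 0 := by
  have := hP.q_pos
  simp [sDot, this.ne']

theorem Gk_zero (hP : P.Standing) (R Ψ S : ℝ) : P.Gk 0 R Ψ S = 0 := by
  have h := hP.resonance
  have h0 : (P.ϰ : ℝ) ≠ 0 := by exact_mod_cast hP.ϰ_pos.ne'
  simp only [Gk, iteratedDeriv_zero, pow_zero, mul_one, Nat.factorial_zero, Nat.cast_one, div_one,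
    sDot_zero hP, Nat.zero_div]
  rw [Finset.Icc_eq_empty_of_lt one_pos, Finset.sum_empty, add_zero]
  field_simp
  linarith

theorem transport_zero_fun (k j : ℕ) (R Ψ S : ℝ) : P.transport k j 0 R Ψ S = 0 := by
  simp [transport]

/-- The residual of the near-identity transformation: `X` stands for `F` or `G`, `w` for `u` or
`v`, and `A` for `Λ` or `Ω`. -/
theorem uExp_residual (hP : P.Standing) (ψ₀ : ℝ) {X : ℕ → ℝ → ℝ → ℝ → ℝ}
    {w : ℕ → ℝ → ℝ → ℝ → ℝ} {A : ℕ → ℝ → ℝ → ℝ}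
    (hX : ∀ k, Smooth3 (X k)) (hXp : ∀ k, P.Per (X k)) (hX0 : ∀ R Ψ S, X 0 R Ψ S = 0)
    (hw : ∀ k, 1 ≤ k → Smooth3 (w k)) (hwp : ∀ k, 1 ≤ k → P.Per (w k)) (hw0 : w 0 = 0)
    (hA : ∀ k, 1 ≤ k → ContDiff ℝ ∞ (fun p : ℝ × ℝ => A k p.1 p.2)) (hA0 : A 0 = 0)
    (heq : ∀ k, 1 ≤ k → ∀ R Ψ S, P.s 0 * deriv (fun x => w k R Ψ x) S = A k R Ψ - X k R Ψ S
      + (∑ j ∈ Finset.Ico 1 k, substCoeff P.lev (A j) (k - j) R Ψ S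
        - ∑ j ∈ Finset.Ico 1 k, P.transport k j (w (k - j)) R Ψ S)) (K : ℕ) :
    UExp (region ψ₀) K
      (fun τ y => ∑ k ∈ Finset.range (K + 1), τ ^ k * X k y.1 y.2.1 y.2.2
        + ∑ j ∈ Finset.range (K + 1), τ ^ j * ∑ k ∈ Finset.range (K + 1), τ ^ k *
            P.transport (k + j) j (w k) y.1 y.2.1 y.2.2
        - ∑ j ∈ Finset.range (K + 1), τ ^ j *
            A j (nearR P.lev K τ y.1 y.2.1 y.2.2) (nearΨ P.lev K τ y.1 y.2.1 y.2.2))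
      (fun _ _ => 0) := by
  have hwall : ∀ k, Smooth3 (w k) ∧ P.Per (w k) := by
    intro k
    rcases Nat.eq_zero_or_pos k with rfl | h
    · rw [hw0]; exact ⟨contDiff_const, fun _ _ _ => rfl⟩
    · exact ⟨hw k h, hwp k h⟩
  have hAall : ∀ k, ContDiff ℝ ∞ (fun p : ℝ × ℝ => A k p.1 p.2) := by
    intro k
    rcases Nat.eq_zero_or_pos k with rfl | h
    · rw [hA0]; exact contDiff_const
    · exact hA k h
  have h1 : UExp (region ψ₀) K (fun τ y => ∑ k ∈ Finset.range (K + 1), τ ^ k * X k y.1 y.2.1 y.2.2)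
      (fun k y => X k y.1 y.2.1 y.2.2) :=
    UExp.poly (w := fun k (y : ℝ × ℝ × ℝ) => X k y.1 y.2.1 y.2.2) fun k _ =>
      exists_bound_of_smooth_per hP ψ₀ (hX k) (hXp k)
  have h2 := UExp.sum_pow (D := region ψ₀) (K := K)
    (Φ := fun j τ (y : ℝ × ℝ × ℝ) => ∑ k ∈ Finset.range (K + 1), τ ^ k *
            P.transport (k + j) j (w k) y.1 y.2.1 y.2.2)
    (c := fun j k (y : ℝ × ℝ × ℝ) => P.transport (k + j) j (w k) y.1 y.2.1 y.2.2) fun j _ =>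
      (UExp.poly (w := fun k (y : ℝ × ℝ × ℝ) => P.transport (k + j) j (w k) y.1 y.2.1 y.2.2)
        fun k _ => exists_bound_of_smooth_per hP ψ₀ (smooth_transport hP (k + j) j (hwall k).1)
          (per_transport hP (k + j) j (hwall k).2)).truncate (Nat.sub_le K j)
  have h3 := UExp.sum_pow (D := region ψ₀) (K := K)
    (Φ := fun j τ (y : ℝ × ℝ × ℝ) => A j (nearR P.lev K τ y.1 y.2.1 y.2.2) (nearΨ P.lev K τ y.1 y.2.1 y.2.2))
    (c := fun j l (y : ℝ × ℝ × ℝ) => substCoeff P.lev (A j) l y.1 y.2.1 y.2.2) fun j _ =>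
      uExp_near hP ψ₀ (isSmoothLevel_lev hP) (hAall j) (Nat.sub_le K j)
  refine ((h1.add h2).add h3.neg).congr (fun τ _ _ y _ => by ring) ?_
  rintro k - ⟨R, Ψ, S⟩ -
  dsimp only
  have e1 : ∑ j ∈ Finset.range (k + 1), P.transport (k - j + j) j (w (k - j)) R Ψ S =
      ∑ j ∈ Finset.range (k + 1), P.transport k j (w (k - j)) R Ψ S := by
    refine Finset.sum_congr rfl fun j hj => ?_
    rw [Nat.sub_add_cancel (Nat.lt_succ_iff.1 (Finset.mem_range.1 hj))]
  have hs0 : ∀ l, substCoeff P.lev (A 0) l R Ψ S = 0 := by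
    intro l
    rw [hA0]
    simp [substCoeff, taylorCoeff]
  rw [e1]
  rcases Nat.eq_zero_or_pos k with rfl | hk
  · simp [hX0, hw0, transport_zero_fun, hs0]
  · have hq := hP.q_pos
    rw [Finset.range_eq_Ico, Finset.sum_eq_sum_Ico_succ_bot (Nat.succ_pos k),
      Finset.sum_Ico_succ_top (by omega : 0 + 1 ≤ k),
      Finset.sum_eq_sum_Ico_succ_bot (Nat.succ_pos k),
      Finset.sum_Ico_succ_top (by omega : 0 + 1 ≤ k)]
    have e2 : P.transport k 0 (w (k - 0)) R Ψ S = P.s 0 * deriv (fun x => w k R Ψ x) S := by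
      have : (0 : ℕ) ≠ 2 * P.q := by omega
      simp [transport, Fk_zero hP, Gk_zero hP, sDot_zero hP, this]
    have e3 : substCoeff P.lev (A k) 0 R Ψ S = A k R Ψ := by
      simp [substCoeff, taylorCoeff]
    rw [e2, heq k hk, Nat.sub_self, hw0, transport_zero_fun, hs0, e3]
    ring

theorem deriv_u_lev (hP : P.Standing) (k : ℕ) (hk : 1 ≤ k) (R Ψ S : ℝ) :
    P.s 0 * deriv (fun x => (P.lev k).u R Ψ x) S = (P.lev k).Lam R Ψ - P.Fk k R Ψ S
      + P.Ftilde P.lev k R Ψ S := by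
  have hc : ∀ {w : ℝ → ℝ → ℝ → ℝ}, Smooth3 w → Continuous (fun S => w R Ψ S) := fun h =>
    ContDiff.continuous (n := ∞) (h.comp (by fun_prop) (by fun_prop) (by fun_prop))
  have h1 := hc (smooth_Fk hP k)
  have h2 := hc (smooth_Ftilde hP (L := P.lev) (k := k) fun i h _ => isSmoothLevel_lev hP i h)
  have h := deriv_zeroMeanPrimitive (P := P) (w := fun x =>
    P.mean (fun y => P.Fk k R Ψ y - P.Ftilde P.lev k R Ψ y) - P.Fk k R Ψ x
      + P.Ftilde P.lev k R Ψ x) (by fun_prop) S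
  rw [lev_eq hk]
  have h3 := (h.div_const (P.s 0)).deriv
  have := hP.s_pos.ne'
  change P.s 0 * deriv (fun x => _ / P.s 0) S = _
  rw [h3]
  simp only [nextLevel]
  field_simp

theorem deriv_v_lev (hP : P.Standing) (k : ℕ) (hk : 1 ≤ k) (R Ψ S : ℝ) :
    P.s 0 * deriv (fun x => (P.lev k).v R Ψ x) S = (P.lev k).Om R Ψ - P.Gk k R Ψ S
      + P.Gtilde P.lev k R Ψ S := by
  have hc : ∀ {w : ℝ → ℝ → ℝ → ℝ}, Smooth3 w → Continuous (fun S => w R Ψ S) := fun h =>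
    ContDiff.continuous (n := ∞) (h.comp (by fun_prop) (by fun_prop) (by fun_prop))
  have h1 := hc (smooth_Gk hP k)
  have h2 := hc (smooth_Gtilde hP (L := P.lev) (k := k) fun i h _ => isSmoothLevel_lev hP i h)
  have h := deriv_zeroMeanPrimitive (P := P) (w := fun x =>
    P.mean (fun y => P.Gk k R Ψ y - P.Gtilde P.lev k R Ψ y) - P.Gk k R Ψ x
      + P.Gtilde P.lev k R Ψ x) (by fun_prop) S
  rw [lev_eq hk]
  have h3 := (h.div_const (P.s 0)).deriv
  have := hP.s_pos.ne'
  change P.s 0 * deriv (fun x => _ / P.s 0) S = _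
  rw [h3]
  simp only [nextLevel]
  field_simp

/-! ### The small parameter and the phase -/

theorem tau_pos (t : ℝ) (ht : 0 < t) : 0 < P.tau t := Real.rpow_pos_of_pos ht _

theorem tau_pow (hP : P.Standing) {t : ℝ} (ht : 0 < t) (k : ℕ) :
    P.tau t ^ k = t ^ (-((k : ℝ) / (2 * P.q))) := by
  rw [tau, ← Real.rpow_natCast, ← Real.rpow_mul ht.le]
  congr 1
  have : (P.q : ℝ) ≠ 0 := by exact_mod_cast hP.q_pos.ne'
  field_simp

theorem tau_pow_two_mul (hP : P.Standing) {t : ℝ} (ht : 0 < t) (j : ℕ) :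
    P.tau t ^ (2 * j) = t ^ (-((j : ℝ) / P.q)) := by
  rw [tau_pow hP ht]
  congr 2
  have : (P.q : ℝ) ≠ 0 := by exact_mod_cast hP.q_pos.ne'
  push_cast
  field_simp

theorem tau_pow_two_q (hP : P.Standing) {t : ℝ} (ht : 0 < t) : P.tau t ^ (2 * P.q) = t⁻¹ := by
  rw [tau_pow_two_mul hP ht, div_self (by exact_mod_cast hP.q_pos.ne'), Real.rpow_neg_one]

theorem tau_le_one {t : ℝ} (ht : 1 ≤ t) : P.tau t ≤ 1 := by
  refine Real.rpow_le_one_of_one_le_of_nonpos ht ?_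
  simp only [one_div, Left.neg_nonpos_iff]
  positivity

theorem tau_anti {s t : ℝ} (hs : 0 < s) (h : s ≤ t) : P.tau t ≤ P.tau s := by
  refine Real.rpow_le_rpow_of_nonpos hs h ?_
  simp only [one_div, Left.neg_nonpos_iff]
  positivity

theorem tendsto_tau (hP : P.Standing) : Tendsto P.tau atTop (nhds 0) := by
  refine tendsto_rpow_neg_atTop (y := 1 / (2 * (P.q : ℝ))) ?_
  have : (0 : ℝ) < P.q := by exact_mod_cast hP.q_pos
  positivity

theorem hasDerivAt_tau (hP : P.Standing) {t : ℝ} (ht : 0 < t) :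
    HasDerivAt P.tau (-(1 / (2 * (P.q : ℝ))) * P.tau t ^ (2 * P.q + 1)) t := by
  have h := Real.hasDerivAt_rpow_const (x := t) (p := -(1 / (2 * (P.q : ℝ)))) (Or.inl ht.ne')
  refine h.congr_deriv ?_
  rw [pow_succ, tau_pow_two_q hP ht, Real.rpow_sub_one ht.ne', tau]
  ring

theorem hasDerivAt_phase (hP : P.Standing) {t : ℝ} (ht : 0 < t) {K : ℕ} (hK : 2 * P.q ≤ K) :
    HasDerivAt P.phase (∑ k ∈ Finset.range (K + 1), P.tau t ^ k * P.sDot k) t := by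
  have hq : (P.q : ℝ) ≠ 0 := by exact_mod_cast hP.q_pos.ne'
  have h1 : HasDerivAt P.phase (P.s 0 * 1 + ∑ j ∈ Finset.Ico 1 P.q,
      P.s j * ((1 - (j : ℝ) / (P.q : ℝ)) * t ^ (1 - (j : ℝ) / (P.q : ℝ) - 1))
      + P.s P.q * t⁻¹) t := by
    refine HasDerivAt.add (HasDerivAt.add ?_ (HasDerivAt.fun_sum fun j _ => ?_)) ?_
    · exact (hasDerivAt_id t).const_mul _
    · exact (Real.hasDerivAt_rpow_const (Or.inl ht.ne')).const_mul _
    · exact (Real.hasDerivAt_log ht.ne').const_mul _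
  refine h1.congr_deriv ?_
  have h2 : ∑ k ∈ Finset.range (K + 1), P.tau t ^ k * P.sDot k =
      ∑ j ∈ Finset.range (P.q + 1), P.tau t ^ (2 * j) * P.sDot (2 * j) := by
    rw [← Finset.sum_image (f := fun k => P.tau t ^ k * P.sDot k) (g := fun j => 2 * j)
      (fun _ _ _ _ h => by simpa using h)]
    refine (Finset.sum_subset ?_ fun k _ hk => ?_).symm
    · intro k hk
      obtain ⟨j, hj, rfl⟩ := Finset.mem_image.1 hk
      have := Finset.mem_range.1 hj
      exact Finset.mem_range.2 (by omega)
    · have : ¬ (Even k ∧ k ≤ 2 * P.q) := by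
        rintro ⟨⟨j, rfl⟩, hle⟩
        exact hk (Finset.mem_image.2 ⟨j, Finset.mem_range.2 (by omega), by ring⟩)
      simp [sDot, this]
  have hpos := hP.q_pos
  rw [h2, Finset.range_eq_Ico, Finset.sum_eq_sum_Ico_succ_bot (Nat.succ_pos _),
    Finset.sum_Ico_succ_top (by omega), add_assoc]
  congr 1
  · rw [mul_zero, sDot_zero hP]; ring
  congr 1
  · refine Finset.sum_congr (by simp) fun j hj => ?_
    have hj' := Finset.mem_Ico.1 hj
    rw [tau_pow_two_mul hP ht]
    have h3 : Even (2 * j) ∧ 2 * j ≤ 2 * P.q := ⟨even_two_mul j, by omega⟩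
    have h4 : 2 * j ≠ 2 * P.q := by omega
    simp only [sDot, h3, and_self, if_true, h4, if_false]
    rw [Nat.mul_div_cancel_left _ (by norm_num : 0 < 2)]
    push_cast
    rw [show 1 - (j : ℝ) / P.q - 1 = -((j : ℝ) / P.q) by ring]
    field_simp
    ring
  · rw [tau_pow_two_q hP ht]
    simp only [sDot, even_two_mul, le_refl, and_self, if_true]
    rw [Nat.mul_div_cancel_left _ (by norm_num : 0 < 2)]
    push_cast
    field_simp
    ring

/-! ### Expansion of the perturbations near the resonant amplitude -/

theorem IsCoeff.iteratedDeriv_periodic (hP : P.Standing) {F : ℝ → ℝ → ℝ → ℝ} (hF : P.IsCoeff F)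
    (l : ℕ) (φ S : ℝ) :
    iteratedDeriv l (fun r => F r (φ + 2 * Real.pi) S) P.a = iteratedDeriv l (fun r => F r φ S) P.a ∧
    iteratedDeriv l (fun r => F r φ (S + 2 * Real.pi)) P.a
      = iteratedDeriv l (fun r => F r φ S) P.a := by
  constructor <;> refine Filter.EventuallyEq.iteratedDeriv_eq l ?_
  · filter_upwards [hP.eventually_strip] with r hr using hF.periodic_φ r φ S hr
  · filter_upwards [hP.eventually_strip] with r hr using hF.periodic_S r φ S hr

theorem forall_torus {p : ℝ → ℝ → Prop} (h1 : ∀ φ S, p (φ + 2 * Real.pi) S ↔ p φ S)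
    (h2 : ∀ φ S, p φ (S + 2 * Real.pi) ↔ p φ S)
    (h : ∀ φ ∈ Set.Icc 0 (2 * Real.pi), ∀ S ∈ Set.Icc 0 (2 * Real.pi), p φ S) (φ S : ℝ) :
    p φ S := by
  have hp1 : ∀ S, Function.Periodic (fun φ => p φ S) (2 * Real.pi) := fun S φ => propext (h1 φ S)
  have hp2 : ∀ φ, Function.Periodic (fun S => p φ S) (2 * Real.pi) := fun φ S => propext (h2 φ S)
  obtain ⟨φ', hφ', e1⟩ := (hp1 S).exists_mem_Ico₀ Real.two_pi_pos φ
  obtain ⟨S', hS', e2⟩ := (hp2 φ').exists_mem_Ico₀ Real.two_pi_pos S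
  change p φ S = p φ' S at e1
  change p φ' S = p φ' S' at e2
  rw [e1, e2]
  exact h _ ⟨hφ'.1, hφ'.2.le⟩ _ ⟨hS'.1, hS'.2.le⟩

theorem IsCoeff.exists_taylor (hP : P.Standing) {F : ℝ → ℝ → ℝ → ℝ} (hF : P.IsCoeff F) (n : ℕ) :
    ∃ C, 0 ≤ C ∧ ∀ z, |z| ≤ (P.Rmax - |P.a|) / 2 → ∀ φ S, |F (P.a + z) φ S -
      ∑ l ∈ Finset.range n, z ^ l * (iteratedDeriv l (fun x => F x φ S) P.a / (Nat.factorial l : ℝ))|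
      ≤ C * |z| ^ n := by
  have hlt := hP.a_lt
  have hin : ∀ z, |z| ≤ (P.Rmax - |P.a|) / 2 → |P.a + z| ≤ P.Rmax := fun z hz => by
    have := abs_add_le P.a z
    linarith
  obtain ⟨C, hC0, hC⟩ := exists_taylor_bound (E := ℝ × ℝ) (a := P.a) (r := (P.Rmax - |P.a|) / 2)
    ((isCompact_Icc (a := (0 : ℝ)) (b := 2 * Real.pi)).prod
    (isCompact_Icc (a := (0 : ℝ)) (b := 2 * Real.pi))) (isOpen_Ioo (a := -P.Rmax) (b := P.Rmax))
    (by
      intro x hx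
      have h1 := neg_abs_le P.a
      have h2 := le_abs_self P.a
      exact ⟨by linarith [hx.1], by linarith [hx.2]⟩) n
    (g := fun r y => F r y.1 y.2) hF.contDiffOn_Ioo
  refine ⟨C, hC0, fun z hz => forall_torus (fun φ S => ?_) (fun φ S => ?_) fun φ hφ S hS =>
    hC z hz (φ, S) ⟨hφ, hS⟩⟩
  · simp only [hF.periodic_φ _ _ _ (hin z hz), (hF.iteratedDeriv_periodic hP _ φ S).1]
  · simp only [hF.periodic_S _ _ _ (hin z hz), (hF.iteratedDeriv_periodic hP _ φ S).2]

theorem IsCoeff.exists_bound_iteratedDeriv (hP : P.Standing) {F : ℝ → ℝ → ℝ → ℝ}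
    (hF : P.IsCoeff F) (l : ℕ) :
    ∃ C, ∀ φ S, |iteratedDeriv l (fun x => F x φ S) P.a| ≤ C := by
  have h := contDiffOn_iteratedDeriv_fst (E := ℝ × ℝ) (g := fun r y => F r y.1 y.2) isOpen_Ioo
    hF.contDiffOn_Ioo l
  have hc : Continuous (fun y : ℝ × ℝ => iteratedDeriv l (fun x => F x y.1 y.2) P.a) := by
    have := h.continuousOn.comp (f := fun y : ℝ × ℝ => (P.a, y)) (s := Set.univ)
      (Continuous.continuousOn (by fun_prop)) fun y _ => ⟨hP.strip, Set.mem_univ _⟩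
    exact continuousOn_univ.1 this
  obtain ⟨C, hC⟩ := ((isCompact_Icc (a := (0 : ℝ)) (b := 2 * Real.pi)).prod
    (isCompact_Icc (a := (0 : ℝ)) (b := 2 * Real.pi))).exists_bound_of_continuousOn hc.continuousOn
  refine ⟨C, forall_torus (fun φ S => ?_) (fun φ S => ?_) fun φ hφ S hS => hC (φ, S) ⟨hφ, hS⟩⟩
  · rw [(hF.iteratedDeriv_periodic hP _ φ S).1]
  · rw [(hF.iteratedDeriv_periodic hP _ φ S).2]

theorem IsPerturbation.exists_expansion (hP : P.Standing) {F : ℝ → ℝ → ℝ → ℝ → ℝ}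
    {Fc : ℕ → ℝ → ℝ → ℝ → ℝ} (hF : P.IsPerturbation F Fc) (K : ℕ) :
    ∃ C T : ℝ, 0 ≤ C ∧ 1 ≤ T ∧ ∀ t, T ≤ t → ∀ R φ S, |R| ≤ 1 →
      |F (P.a + P.tau t * R) φ S t - ∑ k ∈ Finset.range (K + 1), P.tau t ^ k *
        ∑ j ∈ Finset.Icc 1 (k / 2), iteratedDeriv (k - 2 * j) (fun r => Fc j r φ S) P.a
          * R ^ (k - 2 * j) / (Nat.factorial (k - 2 * j) : ℝ)| ≤ C * P.tau t ^ (K + 1) := by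
  obtain ⟨C₁, T₁, hT₁, h₁⟩ := hF.expansion (K + 1) (by omega)
  have hc : ∀ j, 1 ≤ j → P.IsCoeff (Fc j) := hF.coeff
  have hT := fun j (hj : 1 ≤ j) => (hc j hj).exists_taylor hP (K + 1)
  choose C₂ hC₂0 hC₂ using hT
  set D : Set (ℝ × ℝ × ℝ) := {y | |y.1| ≤ 1} with hD
  set c : ℕ → ℕ → ℝ × ℝ × ℝ → ℝ := fun j l y =>
    iteratedDeriv l (fun r => Fc j r y.2.1 y.2.2) P.a * y.1 ^ l / (Nat.factorial l : ℝ) with hcdef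
  have hcb : ∀ j, 1 ≤ j → ∀ l, ∃ C, ∀ y ∈ D, |c j l y| ≤ C := by
    intro j hj l
    obtain ⟨C, hC⟩ := (hc j hj).exists_bound_iteratedDeriv hP l
    refine ⟨C, fun y hy => ?_⟩
    have h1 := hC y.2.1 y.2.2
    have h2 : |y.1| ^ l ≤ 1 := pow_le_one₀ (abs_nonneg _) hy
    have h3 : (1 : ℝ) ≤ (Nat.factorial l : ℝ) := by exact_mod_cast Nat.factorial_pos l
    simp only [hcdef]
    rw [abs_div, abs_mul, abs_pow, Nat.abs_cast]
    rw [div_le_iff₀ (by linarith)]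
    have h0 := abs_nonneg (iteratedDeriv l (fun r => Fc j r y.2.1 y.2.2) P.a)
    calc _ ≤ |iteratedDeriv l (fun r => Fc j r y.2.1 y.2.2) P.a| * 1 := by gcongr
      _ ≤ C * 1 := by gcongr
      _ ≤ C * (Nat.factorial l : ℝ) := mul_le_mul_of_nonneg_left h3 (h0.trans h1)
  have hU := UExp.sum (D := D) (K := K) (s := Finset.Ico 1 (K + 1))
    (Φ := fun j τ y => τ ^ (2 * j) * ∑ l ∈ Finset.range (K + 1), τ ^ l * c j l y)
    (c := fun j k y => if 2 * j ≤ k then c j (k - 2 * j) y else 0) fun j hj =>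
      ((UExp.poly (D := D) (K := K) (w := c j)
        fun l _ => hcb j (Finset.mem_Ico.1 hj).1 l).shift (2 * j)).truncate (by omega)
  obtain ⟨C₃, hC₃0, hC₃⟩ := hU
  have hlt := hP.a_lt
  obtain ⟨T₂, hT₂⟩ := Filter.eventually_atTop.1 ((tendsto_tau hP).eventually
    (ge_mem_nhds (show (0 : ℝ) < (P.Rmax - |P.a|) / 2 by linarith)))
  refine ⟨|C₁| + ∑ j ∈ (Finset.Ico 1 (K + 1)).attach, C₂ j.1 (Finset.mem_Ico.1 j.2).1 + C₃,
    max 1 (max T₁ T₂), ?_, le_max_left _ _, ?_⟩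
  · have : 0 ≤ ∑ j ∈ (Finset.Ico 1 (K + 1)).attach, C₂ j.1 (Finset.mem_Ico.1 j.2).1 :=
      Finset.sum_nonneg fun j _ => hC₂0 _ _
    positivity
  intro t ht R φ S hR
  have ht1 : 1 ≤ t := (le_max_left _ _).trans ht
  have htT₁ : T₁ ≤ t := ((le_max_left _ _).trans (le_max_right _ _)).trans ht
  have htT₂ : T₂ ≤ t := ((le_max_right _ _).trans (le_max_right _ _)).trans ht
  have ht0 : 0 < t := by linarith
  set τ := P.tau t with hτ
  have hτ0 : 0 < τ := tau_pos t ht0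
  have hτ1 : τ ≤ 1 := tau_le_one ht1
  have hz : |τ * R| ≤ (P.Rmax - |P.a|) / 2 := by
    rw [abs_mul, abs_of_pos hτ0]
    calc τ * |R| ≤ τ * 1 := by gcongr
      _ ≤ _ := by rw [mul_one]; exact hT₂ t htT₂
  have hr : |P.a + τ * R| ≤ P.Rmax := by
    have := abs_add_le P.a (τ * R)
    linarith
  have e1 := h₁ t htT₁ (P.a + τ * R) φ S hr
  simp only [← tau_pow_two_mul hP ht0, ← hτ] at e1
  have e2 : |∑ j ∈ Finset.Ico 1 (K + 1), τ ^ (2 * j) * Fc j (P.a + τ * R) φ S -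
      ∑ j ∈ Finset.Ico 1 (K + 1), τ ^ (2 * j) * ∑ l ∈ Finset.range (K + 1), τ ^ l * c j l (R, φ, S)|
      ≤ (∑ j ∈ (Finset.Ico 1 (K + 1)).attach, C₂ j.1 (Finset.mem_Ico.1 j.2).1) * τ ^ (K + 1) := by
    rw [← Finset.sum_sub_distrib, Finset.sum_mul, ← Finset.sum_attach]
    refine (Finset.abs_sum_le_sum_abs _ _).trans (Finset.sum_le_sum fun j _ => ?_)
    have hj := (Finset.mem_Ico.1 j.2).1
    rw [← mul_sub, abs_mul, abs_of_pos (by positivity)]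
    have h1 := hC₂ j.1 hj (τ * R) hz φ S
    have h2 : ∑ l ∈ Finset.range (K + 1), τ ^ l * c j.1 l (R, φ, S) =
      ∑ l ∈ Finset.range (K + 1), (τ * R) ^ l *
        (iteratedDeriv l (fun x => Fc j.1 x φ S) P.a / (Nat.factorial l : ℝ)) := by
      refine Finset.sum_congr rfl fun l _ => ?_
      simp only [hcdef, mul_pow]; ring
    rw [h2]
    have h3 : |τ * R| ^ (K + 1) ≤ τ ^ (K + 1) := by
      refine pow_le_pow_left₀ (abs_nonneg _) ?_ _
      rw [abs_mul, abs_of_pos hτ0]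
      calc τ * |R| ≤ τ * 1 := by gcongr
        _ = τ := mul_one _
    calc τ ^ (2 * j.1) * _ ≤ 1 * (C₂ j.1 hj * τ ^ (K + 1)) := by
          refine mul_le_mul (pow_le_one₀ hτ0.le hτ1) (h1.trans ?_) (abs_nonneg _) zero_le_one
          exact mul_le_mul_of_nonneg_left h3 (hC₂0 _ _)
      _ = _ := one_mul _
  have e3 := (hC₃ (R, φ, S) hR).2 τ hτ0 hτ1
  have e4 : ∑ k ∈ Finset.range (K + 1), τ ^ k * ∑ j ∈ Finset.Ico 1 (K + 1),
        (if 2 * j ≤ k then c j (k - 2 * j) (R, φ, S) else 0) =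
      ∑ k ∈ Finset.range (K + 1), τ ^ k *
        ∑ j ∈ Finset.Icc 1 (k / 2), iteratedDeriv (k - 2 * j) (fun r => Fc j r φ S) P.a
          * R ^ (k - 2 * j) / (Nat.factorial (k - 2 * j) : ℝ) := by
    refine Finset.sum_congr rfl fun k hk => ?_
    congr 1
    rw [← Finset.sum_filter]
    refine Finset.sum_congr ?_ fun j _ => rfl
    ext j
    have := Finset.mem_range.1 hk
    simp only [Finset.mem_filter, Finset.mem_Ico, Finset.mem_Icc]
    omega
  rw [e4] at e3
  have e5 : C₁ * τ ^ (2 * (K + 1)) ≤ |C₁| * τ ^ (K + 1) := by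
    have := pow_le_pow_of_le_one hτ0.le hτ1 (show K + 1 ≤ 2 * (K + 1) by omega)
    calc _ ≤ |C₁| * τ ^ (2 * (K + 1)) := by gcongr; exact le_abs_self _
      _ ≤ _ := by gcongr
  rw [abs_le] at e1 e2 e3 ⊢
  simp only [add_mul]
  constructor <;> linarith [e1.1, e1.2, e2.1, e2.2, e3.1, e3.2]

/-! ### The averaged equations along a solution -/

theorem exists_taylor_omega (hP : P.Standing) (n : ℕ) :
    ∃ C, 0 ≤ C ∧ ∀ z, |z| ≤ (P.Rmax - |P.a|) / 2 → |P.ω (P.a + z) -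
      ∑ l ∈ Finset.range n, z ^ l * (iteratedDeriv l P.ω P.a / (Nat.factorial l : ℝ))|
      ≤ C * |z| ^ n := by
  have hlt := hP.a_lt
  obtain ⟨C, hC0, hC⟩ := exists_taylor_bound (E := ℝ) (a := P.a) (r := (P.Rmax - |P.a|) / 2)
    (isCompact_singleton (x := (0 : ℝ))) (isOpen_Ioo (a := -P.Rmax) (b := P.Rmax))
    (by
      intro x hx
      have h1 := neg_abs_le P.a
      have h2 := le_abs_self P.a
      exact ⟨by linarith [hx.1], by linarith [hx.2]⟩) n
    (g := fun r _ => P.ω r)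
    ((hP.ω_smooth.mono (fun x (hx : x ∈ Set.Ioo (-P.Rmax) P.Rmax) => (abs_lt.2 hx).le)).comp
      contDiffOn_fst fun p hp => hp.1)
  exact ⟨C, hC0, fun z hz => hC z hz 0 rfl⟩

/-- The equation for `R = t^{1/(2q)} (r - a)`. -/
theorem exists_expansion_R (hP : P.Standing) {K : ℕ} (hK : 2 * P.q ≤ K) :
    ∃ C T : ℝ, 0 ≤ C ∧ 1 ≤ T ∧ ∀ t, T ≤ t → ∀ R Ψ S, |R| ≤ 1 →
      |P.f (P.a + P.tau t * R) ((P.κ : ℝ) / (P.ϰ : ℝ) * S + Ψ) S t / P.tau t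
        + 1 / (2 * P.q) * P.tau t ^ (2 * P.q) * R
        - ∑ k ∈ Finset.range (K + 1), P.tau t ^ k * P.Fk k R Ψ S| ≤ C * P.tau t ^ (K + 1) := by
  obtain ⟨C, T, hC, hT, h⟩ := hP.pert_f.exists_expansion hP (K + 1)
  refine ⟨C, T, hC, hT, fun t ht R Ψ S hR => ?_⟩
  have hτ : 0 < P.tau t := tau_pos t (by linarith)
  have h1 := h t ht R ((P.κ : ℝ) / (P.ϰ : ℝ) * S + Ψ) S hR
  rw [Finset.sum_range_succ'] at h1
  simp only [pow_zero, one_mul, Nat.zero_div, Finset.Icc_eq_empty_of_lt one_pos, Finset.sum_empty,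
    add_zero] at h1
  have h2 : ∑ k ∈ Finset.range (K + 1), P.tau t ^ k * P.Fk k R Ψ S =
      (∑ k ∈ Finset.range (K + 1), P.tau t ^ (k + 1) *
        ∑ j ∈ Finset.Icc 1 ((k + 1) / 2), iteratedDeriv (k + 1 - 2 * j)
          (fun r => P.fc j r ((P.κ : ℝ) / (P.ϰ : ℝ) * S + Ψ) S) P.a
          * R ^ (k + 1 - 2 * j) / (Nat.factorial (k + 1 - 2 * j) : ℝ)) / P.tau t
        + 1 / (2 * P.q) * P.tau t ^ (2 * P.q) * R := by
    simp only [Fk, mul_add, Finset.sum_add_distrib]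
    congr 1
    · rw [Finset.sum_div]
      refine Finset.sum_congr rfl fun k _ => ?_
      field_simp
      ring
    · simp only [mul_ite, mul_zero, Finset.sum_ite_eq', Finset.mem_range]
      rw [if_pos (by omega)]
      ring
  rw [h2, add_sub_add_right_eq_sub, ← sub_div, abs_div, abs_of_pos hτ, div_le_iff₀ hτ]
  calc _ ≤ _ := h1
    _ = _ := by ring

/-- The equation for `Ψ = φ - (κ/ϰ) S(t)`. -/
theorem exists_expansion_Ψ (hP : P.Standing) (K : ℕ) :
    ∃ C T : ℝ, 0 ≤ C ∧ 1 ≤ T ∧ ∀ t, T ≤ t → ∀ R Ψ S, |R| ≤ 1 →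
      |P.ω (P.a + P.tau t * R) + P.g (P.a + P.tau t * R) ((P.κ : ℝ) / (P.ϰ : ℝ) * S + Ψ) S t
        - (P.κ : ℝ) / (P.ϰ : ℝ) * ∑ k ∈ Finset.range (K + 1), P.tau t ^ k * P.sDot k
        - ∑ k ∈ Finset.range (K + 1), P.tau t ^ k * P.Gk k R Ψ S| ≤ C * P.tau t ^ (K + 1) := by
  obtain ⟨C, T, hC, hT, h⟩ := hP.pert_g.exists_expansion hP K
  obtain ⟨C', hC', h'⟩ := exists_taylor_omega hP (K + 1)
  have hlt := hP.a_lt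
  obtain ⟨T₂, hT₂⟩ := Filter.eventually_atTop.1 ((tendsto_tau hP).eventually
    (ge_mem_nhds (show (0 : ℝ) < (P.Rmax - |P.a|) / 2 by linarith)))
  refine ⟨C + C', max T T₂, by positivity, hT.trans (le_max_left _ _), fun t ht R Ψ S hR => ?_⟩
  have htT : T ≤ t := (le_max_left _ _).trans ht
  have hτ : 0 < P.tau t := tau_pos t (by linarith)
  have h1 := h t htT R ((P.κ : ℝ) / (P.ϰ : ℝ) * S + Ψ) S hR
  have hz1 : |P.tau t * R| ≤ P.tau t := by
    rw [abs_mul, abs_of_pos hτ]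
    calc P.tau t * |R| ≤ P.tau t * 1 := by gcongr
      _ = _ := mul_one _
  have h2 := h' (P.tau t * R) (hz1.trans (hT₂ t ((le_max_right _ _).trans ht)))
  have h3 : C' * |P.tau t * R| ^ (K + 1) ≤ C' * P.tau t ^ (K + 1) := by gcongr
  have h4 : ∑ l ∈ Finset.range (K + 1), (P.tau t * R) ^ l *
      (iteratedDeriv l P.ω P.a / (Nat.factorial l : ℝ)) =
      ∑ k ∈ Finset.range (K + 1), P.tau t ^ k *
        (iteratedDeriv k P.ω P.a * R ^ k / (Nat.factorial k : ℝ)) :=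
    Finset.sum_congr rfl fun l _ => by rw [mul_pow]; ring
  have h5 : ∑ k ∈ Finset.range (K + 1), P.tau t ^ k * P.Gk k R Ψ S =
      ∑ k ∈ Finset.range (K + 1), P.tau t ^ k *
        (iteratedDeriv k P.ω P.a * R ^ k / (Nat.factorial k : ℝ))
      - (P.κ : ℝ) / (P.ϰ : ℝ) * ∑ k ∈ Finset.range (K + 1), P.tau t ^ k * P.sDot k
      + ∑ k ∈ Finset.range (K + 1), P.tau t ^ k *
        ∑ j ∈ Finset.Icc 1 (k / 2), iteratedDeriv (k - 2 * j)
          (fun r => P.gc j r ((P.κ : ℝ) / (P.ϰ : ℝ) * S + Ψ) S) P.a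
          * R ^ (k - 2 * j) / (Nat.factorial (k - 2 * j) : ℝ) := by
    rw [Finset.mul_sum, ← Finset.sum_sub_distrib, ← Finset.sum_add_distrib]
    refine Finset.sum_congr rfl fun k _ => ?_
    simp only [Gk]
    ring
  rw [h5]
  rw [h4] at h2
  rw [abs_le] at h1 h2 ⊢
  constructor <;> linarith [h1.1, h1.2, h2.1, h2.2]

theorem Smooth3.hasDerivWithinAt {w : ℝ → ℝ → ℝ → ℝ} (hw : Smooth3 w) {x y z : ℝ → ℝ}
    {x' y' z' t : ℝ} {s : Set ℝ} (hx : HasDerivWithinAt x x' s t) (hy : HasDerivWithinAt y y' s t)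
    (hz : HasDerivWithinAt z z' s t) :
    HasDerivWithinAt (fun t => w (x t) (y t) (z t))
      (deriv (fun ξ => w ξ (y t) (z t)) (x t) * x' + deriv (fun ξ => w (x t) ξ (z t)) (y t) * y'
        + deriv (fun ξ => w (x t) (y t) ξ) (z t) * z') s t := by
  set W : ℝ × ℝ × ℝ → ℝ := fun p => w p.1 p.2.1 p.2.2 with hW
  have hd : HasFDerivAt W (fderiv ℝ W (x t, y t, z t)) (x t, y t, z t) :=
    (ContDiff.differentiable hw (by simp) _).hasFDerivAt
  have h0 := hd.comp_hasDerivWithinAt t (hx.prodMk (hy.prodMk hz))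
  refine HasDerivWithinAt.congr_deriv h0 ?_
  have e1 : deriv (fun ξ => w ξ (y t) (z t)) (x t) = fderiv ℝ W (x t, y t, z t) (1, 0, 0) :=
    (HasFDerivAt.comp_hasDerivAt (f := fun ξ : ℝ => (ξ, y t, z t)) (x t) hd ((hasDerivAt_id (x t)).prodMk
      ((hasDerivAt_const _ _).prodMk (hasDerivAt_const _ _)))).deriv
  have e2 : deriv (fun ξ => w (x t) ξ (z t)) (y t) = fderiv ℝ W (x t, y t, z t) (0, 1, 0) :=
    (HasFDerivAt.comp_hasDerivAt (f := fun ξ : ℝ => (x t, ξ, z t)) (y t) hd ((hasDerivAt_const _ _).prodMk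
      ((hasDerivAt_id (y t)).prodMk (hasDerivAt_const _ _)))).deriv
  have e3 : deriv (fun ξ => w (x t) (y t) ξ) (z t) = fderiv ℝ W (x t, y t, z t) (0, 0, 1) :=
    (HasFDerivAt.comp_hasDerivAt (f := fun ξ : ℝ => (x t, y t, ξ)) (z t) hd ((hasDerivAt_const _ _).prodMk
      ((hasDerivAt_const _ _).prodMk (hasDerivAt_id (z t))))).deriv
  rw [e1, e2, e3]
  have e4 : ((x', y', z') : ℝ × ℝ × ℝ) = x' • ((1 : ℝ), (0 : ℝ), (0 : ℝ))
      + y' • ((0 : ℝ), (1 : ℝ), (0 : ℝ)) + z' • ((0 : ℝ), (0 : ℝ), (1 : ℝ)) := by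
    ext <;> simp
  rw [e4, map_add, map_add, map_smul, map_smul, map_smul]
  simp only [smul_eq_mul]
  ring

theorem sum_transport (hP : P.Standing) {K : ℕ} (hK : 2 * P.q ≤ K) {w : ℕ → ℝ → ℝ → ℝ → ℝ}
    (hw0 : w 0 = 0) (τ R Ψ S : ℝ) :
    ∑ j ∈ Finset.range (K + 1), τ ^ j * ∑ k ∈ Finset.range (K + 1), τ ^ k *
      P.transport (k + j) j (w k) R Ψ S =
    ∑ k ∈ Finset.Icc 1 K, τ ^ k * (deriv (fun x => w k x Ψ S) R *
        (∑ j ∈ Finset.range (K + 1), τ ^ j * P.Fk j R Ψ S)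
      + deriv (fun x => w k R x S) Ψ * (∑ j ∈ Finset.range (K + 1), τ ^ j * P.Gk j R Ψ S)
      + deriv (fun x => w k R Ψ x) S * (∑ j ∈ Finset.range (K + 1), τ ^ j * P.sDot j)
      - (k : ℝ) / (2 * P.q) * τ ^ (2 * P.q) * w k R Ψ S) := by
  simp only [Finset.mul_sum]
  rw [Finset.sum_comm, Finset.sum_range_succ', ← Finset.Ico_add_one_right_eq_Icc,
    Finset.sum_Ico_eq_sum_range]
  have h0 : ∑ j ∈ Finset.range (K + 1), τ ^ j * (τ ^ 0 * P.transport (0 + j) j (w 0) R Ψ S) = 0 :=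
    Finset.sum_eq_zero fun j _ => by rw [hw0, transport_zero_fun]; ring
  rw [h0, add_zero]
  refine Finset.sum_congr rfl fun k _ => ?_
  rw [add_comm 1 k]
  generalize k + 1 = k
  have hq : (P.q : ℝ) ≠ 0 := by exact_mod_cast hP.q_pos.ne'
  have h1 : ∑ j ∈ Finset.range (K + 1), τ ^ j * (τ ^ k *
      (if j = 2 * P.q then (2 * (P.q : ℝ) - (k + j : ℕ)) / (2 * P.q) * w k R Ψ S else 0)) =
      -(τ ^ k * ((k : ℝ) / (2 * P.q) * τ ^ (2 * P.q) * w k R Ψ S)) := by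
    simp only [mul_ite, mul_zero, Finset.sum_ite_eq', Finset.mem_range]
    rw [if_pos (by omega)]
    push_cast
    field_simp
    ring
  rw [mul_sub, sub_eq_add_neg, ← h1, mul_add, mul_add, Finset.mul_sum, Finset.mul_sum,
    Finset.mul_sum, ← Finset.sum_add_distrib, ← Finset.sum_add_distrib, ← Finset.sum_add_distrib]
  refine Finset.sum_congr rfl fun j _ => ?_
  simp only [transport]
  push_cast
  ring

/-- The derivative of `x + ∑ τ^k w_k` in terms of the expansions. -/
theorem exists_near_deriv (hP : P.Standing) (ψ₀ : ℝ) {K : ℕ} (hK : 2 * P.q ≤ K)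
    {w : ℕ → ℝ → ℝ → ℝ → ℝ} (hw : ∀ k, 1 ≤ k → Smooth3 (w k)) (hwp : ∀ k, 1 ≤ k → P.Per (w k))
    (hw0 : w 0 = 0) :
    ∃ C, 0 ≤ C ∧ ∀ (x R Ψ : ℝ → ℝ) (x' e e₁ e₂ E t : ℝ) (s : Set ℝ), 1 ≤ t →
      (R t, Ψ t, P.phase t) ∈ region ψ₀ → HasDerivWithinAt x (x' + e) s t →
      HasDerivWithinAt R (∑ k ∈ Finset.range (K + 1), P.tau t ^ k *
        P.Fk k (R t) (Ψ t) (P.phase t) + e₁) s t →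
      HasDerivWithinAt Ψ (∑ k ∈ Finset.range (K + 1), P.tau t ^ k *
        P.Gk k (R t) (Ψ t) (P.phase t) + e₂) s t →
      |e| ≤ E → |e₁| ≤ E → |e₂| ≤ E →
      ∃ d, HasDerivWithinAt (fun t => x t + ∑ k ∈ Finset.Icc 1 K, P.tau t ^ k *
        w k (R t) (Ψ t) (P.phase t)) d s t ∧
        |d - (x' + ∑ j ∈ Finset.range (K + 1), P.tau t ^ j * ∑ k ∈ Finset.range (K + 1),
          P.tau t ^ k * P.transport (k + j) j (w k) (R t) (Ψ t) (P.phase t))| ≤ C * E := by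
  have hb1 : ∀ k, 1 ≤ k → ∃ C, ∀ y ∈ region ψ₀, |deriv (fun x => w k x y.2.1 y.2.2) y.1| ≤ C :=
    fun k hk => exists_bound_of_smooth_per hP ψ₀ (hw k hk).deriv1 (hwp k hk).deriv1
  have hb2 : ∀ k, 1 ≤ k → ∃ C, ∀ y ∈ region ψ₀, |deriv (fun x => w k y.1 x y.2.2) y.2.1| ≤ C :=
    fun k hk => exists_bound_of_smooth_per hP ψ₀ (hw k hk).deriv2 (hwp k hk).deriv2
  choose! C₁ hC₁ using hb1
  choose! C₂ hC₂ using hb2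
  refine ⟨1 + ∑ k ∈ Finset.Icc 1 K, (|C₁ k| + |C₂ k|), by positivity, ?_⟩
  intro x R Ψ x' e e₁ e₂ E t s ht hreg hx hR hΨ he he₁ he₂
  have ht0 : 0 < t := by linarith
  have hτ0 := tau_pos (P := P) t ht0
  have hτ1 := tau_le_one (P := P) ht
  have hS := (hasDerivAt_phase hP ht0 hK).hasDerivWithinAt (s := s)
  have hτ := (hasDerivAt_tau hP ht0).hasDerivWithinAt (s := s)
  have hsum := HasDerivWithinAt.fun_sum (u := Finset.Icc 1 K) fun k hk =>
    (hτ.fun_pow k).mul ((hw k (Finset.mem_Icc.1 hk).1).hasDerivWithinAt hR hΨ hS)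
  refine ⟨_, hx.add hsum, ?_⟩
  rw [sum_transport hP hK hw0]
  rw [add_sub_add_comm, ← Finset.sum_sub_distrib, add_sub_cancel_left, add_mul, one_mul,
    Finset.sum_mul]
  refine (abs_add_le _ _).trans (add_le_add he ?_)
  refine (Finset.abs_sum_le_sum_abs _ _).trans (Finset.sum_le_sum fun k hk => ?_)
  have hk1 := (Finset.mem_Icc.1 hk).1
  have b1 := (hC₁ k hk1 _ hreg).trans (le_abs_self _)
  have b2 := (hC₂ k hk1 _ hreg).trans (le_abs_self _)
  dsimp only at b1 b2
  set D₁ := deriv (fun ξ => w k ξ (Ψ t) (P.phase t)) (R t)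
  set D₂ := deriv (fun ξ => w k (R t) ξ (P.phase t)) (Ψ t)
  have hpow : (k : ℝ) * P.tau t ^ (k - 1) * (-(1 / (2 * (P.q : ℝ))) * P.tau t ^ (2 * P.q + 1)) =
      -(P.tau t ^ k * ((k : ℝ) / (2 * P.q) * P.tau t ^ (2 * P.q))) := by
    obtain ⟨k, rfl⟩ : ∃ j, k = j + 1 := ⟨k - 1, by omega⟩
    rw [Nat.add_sub_cancel]
    ring
  rw [hpow]
  have hE : 0 ≤ E := (abs_nonneg _).trans he
  have e5 : ∀ A B G X Y Z V T : ℝ, -(T * A) * V + T * (D₁ * (X + e₁) + D₂ * (Y + e₂) + B * Z)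
      - T * (D₁ * X + D₂ * Y + B * Z - A * V) = T * (D₁ * e₁ + D₂ * e₂) := by
    intros; ring
  rw [e5 _ _ 0, abs_mul, abs_of_pos (pow_pos hτ0 k)]
  calc _ ≤ 1 * (|C₁ k| * E + |C₂ k| * E) := by
        refine mul_le_mul (pow_le_one₀ hτ0.le hτ1) ?_ (abs_nonneg _) zero_le_one
        refine (abs_add_le _ _).trans ?_
        rw [abs_mul, abs_mul]
        gcongr
    _ = _ := by ring

/-- The averaged amplitude along a solution. -/
noncomputable def avgR (P : OscSystem) (K : ℕ) (r φ : ℝ → ℝ) (t : ℝ) : ℝ :=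
  nearR P.lev K (P.tau t) ((r t - P.a) / P.tau t) (φ t - (P.κ : ℝ) / (P.ϰ : ℝ) * P.phase t)
    (P.phase t)

/-- The averaged phase shift along a solution. -/
noncomputable def avgΨ (P : OscSystem) (K : ℕ) (r φ : ℝ → ℝ) (t : ℝ) : ℝ :=
  nearΨ P.lev K (P.tau t) ((r t - P.a) / P.tau t) (φ t - (P.κ : ℝ) / (P.ϰ : ℝ) * P.phase t)
    (P.phase t)

theorem LamHat_eq_sum (K : ℕ) (ρ ψ τ : ℝ) :
    P.LamHat K ρ ψ τ = ∑ j ∈ Finset.range (K + 1), τ ^ j * (P.lev j).Lam ρ ψ := by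
  rw [LamHat, ← Finset.Ico_add_one_right_eq_Icc, Finset.sum_Ico_eq_sum_range,
    Finset.sum_range_succ']
  have : (P.lev 0).Lam ρ ψ = 0 := rfl
  rw [this, mul_zero, add_zero]
  exact Finset.sum_congr rfl fun k _ => by rw [add_comm 1 k]; rfl

theorem OmHat_eq_sum (K : ℕ) (ρ ψ τ : ℝ) :
    P.OmHat K ρ ψ τ = ∑ j ∈ Finset.range (K + 1), τ ^ j * (P.lev j).Om ρ ψ := by
  rw [OmHat, ← Finset.Ico_add_one_right_eq_Icc, Finset.sum_Ico_eq_sum_range,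
    Finset.sum_range_succ']
  have : (P.lev 0).Om ρ ψ = 0 := rfl
  rw [this, mul_zero, add_zero]
  exact Finset.sum_congr rfl fun k _ => by rw [add_comm 1 k]; rfl

/-- Along a solution the averaged variables satisfy the truncated system up to `O(τ^{K+1})`. -/
theorem exists_averaged (hP : P.Standing) (ψ₀ : ℝ) {K : ℕ} (hK : 2 * P.q ≤ K) :
    ∃ C T : ℝ, 0 ≤ C ∧ 1 ≤ T ∧ ∀ (r φ : ℝ → ℝ) (t₁ t₂ : ℝ), P.IsSolution r φ t₁ t₂ → T ≤ t₁ →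
      ∀ t ∈ Set.Icc t₁ t₂, |r t - P.a| ≤ P.tau t →
      |φ t - (P.κ : ℝ) / (P.ϰ : ℝ) * P.phase t - ψ₀| ≤ 1 →
      ∃ d₁ d₂, HasDerivWithinAt (P.avgR K r φ) d₁ (Set.Icc t₁ t₂) t ∧
        HasDerivWithinAt (P.avgΨ K r φ) d₂ (Set.Icc t₁ t₂) t ∧
        |d₁ - P.LamHat K (P.avgR K r φ t) (P.avgΨ K r φ t) (P.tau t)| ≤ C * P.tau t ^ (K + 1) ∧
        |d₂ - P.OmHat K (P.avgR K r φ t) (P.avgΨ K r φ t) (P.tau t)| ≤ C * P.tau t ^ (K + 1) := by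
  have hlev := isSmoothLevel_lev hP
  obtain ⟨C₁, T₁, hC₁, hT₁, h₁⟩ := exists_expansion_R hP hK
  obtain ⟨C₂, T₂, hC₂, hT₂, h₂⟩ := exists_expansion_Ψ hP K
  obtain ⟨C₃, hC₃, h₃⟩ := exists_near_deriv hP ψ₀ hK (w := fun k => (P.lev k).u)
    (fun k hk => (hlev k hk).u) (fun k hk => (hlev k hk).u_per) rfl
  obtain ⟨C₄, hC₄, h₄⟩ := exists_near_deriv hP ψ₀ hK (w := fun k => (P.lev k).v)
    (fun k hk => (hlev k hk).v) (fun k hk => (hlev k hk).v_per) rfl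
  obtain ⟨C₅, hC₅, h₅⟩ := uExp_residual hP ψ₀ (X := P.Fk) (w := fun k => (P.lev k).u)
    (A := fun k => (P.lev k).Lam) (smooth_Fk hP) (per_Fk hP) (Fk_zero hP)
    (fun k hk => (hlev k hk).u) (fun k hk => (hlev k hk).u_per) rfl (fun k hk => (hlev k hk).Lam) rfl
    (deriv_u_lev hP) K
  obtain ⟨C₆, hC₆, h₆⟩ := uExp_residual hP ψ₀ (X := P.Gk) (w := fun k => (P.lev k).v)
    (A := fun k => (P.lev k).Om) (smooth_Gk hP) (per_Gk hP) (Gk_zero hP)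
    (fun k hk => (hlev k hk).v) (fun k hk => (hlev k hk).v_per) rfl (fun k hk => (hlev k hk).Om) rfl
    (deriv_v_lev hP) K
  refine ⟨C₃ * (C₁ + C₂) + C₄ * (C₁ + C₂) + C₅ + C₆, max T₁ T₂, by positivity,
    hT₁.trans (le_max_left _ _), ?_⟩
  intro r φ t₁ t₂ hsol ht₁ t ht hr hφ
  have htT₁ : T₁ ≤ t := (le_max_left _ _).trans (ht₁.trans ht.1)
  have htT₂ : T₂ ≤ t := (le_max_right _ _).trans (ht₁.trans ht.1)
  have ht1 : 1 ≤ t := hT₁.trans htT₁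
  have ht0 : 0 < t := by linarith
  have hτ0 := tau_pos (P := P) t ht0
  have hτ1 := tau_le_one (P := P) ht1
  obtain ⟨-, hdr, hdφ⟩ := hsol t ht
  set R : ℝ → ℝ := fun t => (r t - P.a) / P.tau t with hRdef
  set Ψ : ℝ → ℝ := fun t => φ t - (P.κ : ℝ) / (P.ϰ : ℝ) * P.phase t with hΨdef
  have hR1 : |R t| ≤ 1 := by
    simp only [hRdef]
    rw [abs_div, abs_of_pos hτ0, div_le_one hτ0]
    exact hr
  have hreg : (R t, Ψ t, P.phase t) ∈ region ψ₀ := ⟨hR1, hφ⟩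
  have er : r t = P.a + P.tau t * R t := by
    simp only [hRdef]; field_simp; ring
  have eφ : φ t = (P.κ : ℝ) / (P.ϰ : ℝ) * P.phase t + Ψ t := by
    simp only [hΨdef]; ring
  have x₁ := h₁ t htT₁ (R t) (Ψ t) (P.phase t) hR1
  have x₂ := h₂ t htT₂ (R t) (Ψ t) (P.phase t) hR1
  rw [← er, ← eφ] at x₁ x₂
  set e₁ := P.f (r t) (φ t) (P.phase t) t / P.tau t + 1 / (2 * P.q) * P.tau t ^ (2 * P.q) * R t
        - ∑ k ∈ Finset.range (K + 1), P.tau t ^ k * P.Fk k (R t) (Ψ t) (P.phase t) with he₁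
  set e₂ := P.ω (r t) + P.g (r t) (φ t) (P.phase t) t
        - (P.κ : ℝ) / (P.ϰ : ℝ) * ∑ k ∈ Finset.range (K + 1), P.tau t ^ k * P.sDot k
        - ∑ k ∈ Finset.range (K + 1), P.tau t ^ k * P.Gk k (R t) (Ψ t) (P.phase t) with he₂
  have hdτ := (hasDerivAt_tau hP ht0).hasDerivWithinAt (s := Set.Icc t₁ t₂)
  have hdR : HasDerivWithinAt R (∑ k ∈ Finset.range (K + 1), P.tau t ^ k *
        P.Fk k (R t) (Ψ t) (P.phase t) + e₁) (Set.Icc t₁ t₂) t := by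
    refine ((hdr.sub_const P.a).fun_div hdτ hτ0.ne').congr_deriv ?_
    rw [he₁, er]
    field_simp
    ring
  have hdΨ : HasDerivWithinAt Ψ (∑ k ∈ Finset.range (K + 1), P.tau t ^ k *
        P.Gk k (R t) (Ψ t) (P.phase t) + e₂) (Set.Icc t₁ t₂) t := by
    have := hdφ.sub ((hasDerivAt_phase hP ht0 hK).hasDerivWithinAt.const_mul
      ((P.κ : ℝ) / (P.ϰ : ℝ)))
    refine this.congr_deriv ?_
    rw [he₂]
    ring
  set E := (C₁ + C₂) * P.tau t ^ (K + 1) with hE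
  have hpow : 0 < P.tau t ^ (K + 1) := pow_pos hτ0 _
  have hE₁ : |e₁| ≤ E := x₁.trans (by
    rw [hE, add_mul]; have := mul_nonneg hC₂ hpow.le; linarith)
  have hE₂ : |e₂| ≤ E := x₂.trans (by
    rw [hE, add_mul]; have := mul_nonneg hC₁ hpow.le; linarith)
  obtain ⟨d₁, hd₁, hb₁⟩ := h₃ R R Ψ _ e₁ e₁ e₂ E t _ ht1 hreg hdR hdR hdΨ hE₁ hE₁ hE₂
  obtain ⟨d₂, hd₂, hb₂⟩ := h₄ Ψ R Ψ _ e₂ e₁ e₂ E t _ ht1 hreg hdΨ hdR hdΨ hE₂ hE₁ hE₂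
  refine ⟨d₁, d₂, hd₁, hd₂, ?_, ?_⟩
  · have y := (h₅ _ hreg).2 _ hτ0 hτ1
    simp only [mul_zero, Finset.sum_const_zero, sub_zero] at y
    rw [LamHat_eq_sum]
    have hp2 := mul_nonneg hC₆ hpow.le
    have hp3 := mul_nonneg (mul_nonneg hC₄ (add_nonneg hC₁ hC₂)) hpow.le
    have y2 : C₃ * E = C₃ * (C₁ + C₂) * P.tau t ^ (K + 1) := by rw [hE]; ring
    rw [y2] at hb₁
    have z := (abs_add_le _ _).trans (add_le_add hb₁ y)
    refine le_trans (le_of_eq ?_) (z.trans ?_)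
    · congr 1
      simp only [avgR, avgΨ, hRdef, hΨdef]
      ring
    · simp only [add_mul]
      linarith
  · have y := (h₆ _ hreg).2 _ hτ0 hτ1
    simp only [mul_zero, Finset.sum_const_zero, sub_zero] at y
    rw [OmHat_eq_sum]
    have hp2 := mul_nonneg hC₅ hpow.le
    have hp3 := mul_nonneg (mul_nonneg hC₃ (add_nonneg hC₁ hC₂)) hpow.le
    have y2 : C₄ * E = C₄ * (C₁ + C₂) * P.tau t ^ (K + 1) := by rw [hE]; ring
    rw [y2] at hb₂
    have z := (abs_add_le _ _).trans (add_le_add hb₂ y)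
    refine le_trans (le_of_eq ?_) (z.trans ?_)
    · congr 1
      simp only [avgR, avgΨ, hRdef, hΨdef]
      ring
    · simp only [add_mul]
      linarith

/-! ### Factorizations of smooth functions of three variables -/

theorem Smooth3.hadamard1 {g : ℝ → ℝ → ℝ → ℝ} (hg : Smooth3 g) : ∃ g₁ : ℝ → ℝ → ℝ → ℝ,
    Smooth3 g₁ ∧ (∀ x y z, g x y z = g 0 y z + x * g₁ x y z) ∧
      ∀ y z, g₁ 0 y z = deriv (fun x => g x y z) 0 := by
  obtain ⟨g₁, h1, h2, h3⟩ := exists_hadamard (E := ℝ × ℝ) (g := fun x p => g x p.1 p.2) hg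
  exact ⟨fun x y z => g₁ x (y, z), h1, fun x y z => h2 x (y, z), fun y z => h3 (y, z)⟩

theorem Smooth3.hadamard2 {g : ℝ → ℝ → ℝ → ℝ} (hg : Smooth3 g) : ∃ g₁ : ℝ → ℝ → ℝ → ℝ,
    Smooth3 g₁ ∧ (∀ x y z, g x y z = g x 0 z + y * g₁ x y z) ∧
      ∀ x z, g₁ x 0 z = deriv (fun y => g x y z) 0 := by
  have h : Smooth3 (fun y x z => g x y z) := hg.comp (by fun_prop) (by fun_prop) (by fun_prop)
  obtain ⟨g₁, h1, h2, h3⟩ := h.hadamard1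
  exact ⟨fun x y z => g₁ y x z, h1.comp (by fun_prop) (by fun_prop) (by fun_prop),
    fun x y z => h2 y x z, fun x z => h3 x z⟩

theorem Smooth3.hadamard3 {g : ℝ → ℝ → ℝ → ℝ} (hg : Smooth3 g) : ∃ g₁ : ℝ → ℝ → ℝ → ℝ,
    Smooth3 g₁ ∧ (∀ x y z, g x y z = g x y 0 + z * g₁ x y z) ∧
      ∀ x y, g₁ x y 0 = deriv (fun z => g x y z) 0 := by
  have h : Smooth3 (fun z x y => g x y z) := hg.comp (by fun_prop) (by fun_prop) (by fun_prop)
  obtain ⟨g₁, h1, h2, h3⟩ := h.hadamard1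
  exact ⟨fun x y z => g₁ z x y, h1.comp (by fun_prop) (by fun_prop) (by fun_prop),
    fun x y z => h2 z x y, fun x z => h3 x z⟩

theorem exists_factor {g : ℝ → ℝ} (hg : ContDiff ℝ ∞ g) (h0 : g 0 = 0) :
    ∃ g₁ : ℝ → ℝ, ContDiff ℝ ∞ g₁ ∧ ∀ x, g x = x * g₁ x := by
  obtain ⟨g₁, h1, h2, -⟩ := exists_hadamard (E := ℝ) (g := fun x _ => g x) (hg.comp contDiff_fst)
  refine ⟨fun x => g₁ x 0, h1.comp (f := fun x : ℝ => (x, (0 : ℝ))) (by fun_prop), fun x => ?_⟩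
  have := h2 x 0
  rw [h0, zero_add] at this
  exact this

/-! ### The centre of the oscillations -/

/-- Approximate invariant curves of the averaged system, to any order. -/
theorem exists_centre {lam om : ℝ → ℝ → ℝ → ℝ} (hlam : Smooth3 lam) (hom : Smooth3 om)
    {ψ₀ η ν c₀ : ℝ} (h0 : lam 0 ψ₀ 0 = 0) (hη : ∀ ρ ψ, om ρ ψ 0 = η * ρ)
    (hν : deriv (fun ψ => lam 0 ψ 0) ψ₀ = ν) (hη0 : η ≠ 0) (hν0 : ν ≠ 0) {i₁ i₂ : ℕ}
    (hi₁ : 1 ≤ i₁) (hi₂ : 1 ≤ i₂) (j : ℕ) :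
    ∃ X Y s₁ s₂ : ℝ → ℝ, ContDiff ℝ ∞ X ∧ ContDiff ℝ ∞ Y ∧ ContDiff ℝ ∞ s₁ ∧ ContDiff ℝ ∞ s₂ ∧
      X 0 = 0 ∧ Y 0 = ψ₀ ∧
      (∀ τ, lam (X τ) (Y τ) τ + c₀ * τ ^ (i₁ + 1) * deriv X τ = τ ^ (j + 1) * s₁ τ) ∧
      ∀ τ, om (X τ) (Y τ) τ + c₀ * τ ^ (i₂ + 1) * deriv Y τ = τ ^ (j + 1) * s₂ τ := by
  induction j with
  | zero =>
    obtain ⟨s₁, hs₁, e₁⟩ := exists_factor (g := fun τ => lam 0 ψ₀ τ)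
      (hlam.comp contDiff_const contDiff_const contDiff_id) h0
    obtain ⟨s₂, hs₂, e₂⟩ := exists_factor (g := fun τ => om 0 ψ₀ τ)
      (hom.comp contDiff_const contDiff_const contDiff_id) (by simp [hη])
    exact ⟨fun _ => 0, fun _ => ψ₀, s₁, s₂, contDiff_const, contDiff_const, hs₁, hs₂, rfl, rfl,
      fun τ => by simp [e₁], fun τ => by simp [e₂]⟩
  | succ j ih =>
    obtain ⟨X, Y, s₁, s₂, hX, hY, hs₁, hs₂, hX0, hY0, e₁, e₂⟩ := ih
    set μ := deriv (fun ρ => lam ρ ψ₀ 0) 0 with hμ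
    set c := -s₂ 0 / η with hc
    set c' := -(s₁ 0 + c * μ) / ν with hc'
    have step : ∀ {F : ℝ → ℝ → ℝ → ℝ}, Smooth3 F → ∃ g : ℝ → ℝ, ContDiff ℝ ∞ g ∧
        (∀ τ, F (X τ + τ ^ (j + 1) * c) (Y τ + τ ^ (j + 1) * c') τ =
          F (X τ) (Y τ) τ + τ ^ (j + 1) * g τ) ∧
        g 0 = deriv (fun ρ => F ρ ψ₀ 0) 0 * c + deriv (fun ψ => F 0 ψ 0) ψ₀ * c' := by
      intro F hF
      obtain ⟨g, hg, hge, hgd⟩ := exists_hadamard (E := ℝ)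
        (g := fun s τ => F (X τ + s * c) (Y τ + s * c') τ)
        (hF.comp (by fun_prop) (by fun_prop) (by fun_prop))
      refine ⟨fun τ => g (τ ^ (j + 1)) τ,
        hg.comp (f := fun τ : ℝ => (τ ^ (j + 1), τ)) (by fun_prop), fun τ => ?_, ?_⟩
      · simpa using hge (τ ^ (j + 1)) τ
      · have h1 := hgd 0
        have h2 := (hF.hasDerivWithinAt (s := Set.univ) (t := 0) (x := fun s => X 0 + s * c)
          (y := fun s => Y 0 + s * c') (z := fun _ => 0)
          (((hasDerivAt_id (0 : ℝ)).mul_const c).const_add _).hasDerivWithinAt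
          (((hasDerivAt_id (0 : ℝ)).mul_const c').const_add _).hasDerivWithinAt
          (hasDerivWithinAt_const _ _ _)).hasDerivAt Filter.univ_mem
        rw [h2.deriv] at h1
        simpa [hX0, hY0] using h1
    obtain ⟨g₁, hg₁, ge₁, gd₁⟩ := step hlam
    obtain ⟨g₂, hg₂, ge₂, gd₂⟩ := step hom
    have hη1 : deriv (fun ρ => om ρ ψ₀ 0) 0 = η := by
      simp [hη]
    have hη2 : deriv (fun ψ => om 0 ψ 0) ψ₀ = 0 := by
      simp [hη]
    have hpos : ∀ {i : ℕ}, 1 ≤ i → ((0 : ℝ) ^ i) = 0 := fun h => zero_pow (by omega)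
    obtain ⟨u₁, hu₁, ue₁⟩ := exists_factor
      (g := fun τ => s₁ τ + g₁ τ + c₀ * τ ^ i₁ * ((j + 1 : ℕ) * c)) (by fun_prop) (by
        simp only [gd₁, hpos hi₁, hν, ← hμ, hc']
        field_simp
        ring)
    obtain ⟨u₂, hu₂, ue₂⟩ := exists_factor
      (g := fun τ => s₂ τ + g₂ τ + c₀ * τ ^ i₂ * ((j + 1 : ℕ) * c')) (by fun_prop) (by
        simp only [gd₂, hpos hi₂, hη1, hη2, hc]
        field_simp
        ring)
    have hdX : ∀ τ, deriv (fun τ => X τ + τ ^ (j + 1) * c) τ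
        = deriv X τ + (j + 1 : ℕ) * τ ^ j * c := fun τ =>
      ((hX.differentiable (by simp) τ).hasDerivAt.add ((hasDerivAt_pow (j + 1) τ).mul_const c)).deriv
    have hdY : ∀ τ, deriv (fun τ => Y τ + τ ^ (j + 1) * c') τ
        = deriv Y τ + (j + 1 : ℕ) * τ ^ j * c' := fun τ =>
      ((hY.differentiable (by simp) τ).hasDerivAt.add
        ((hasDerivAt_pow (j + 1) τ).mul_const c')).deriv
    refine ⟨fun τ => X τ + τ ^ (j + 1) * c, fun τ => Y τ + τ ^ (j + 1) * c', u₁, u₂, by fun_prop,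
      by fun_prop, hu₁, hu₂, by simp [hX0], by simp [hY0], fun τ => ?_, fun τ => ?_⟩
    · rw [hdX, ge₁]
      have h1 := ue₁ τ
      have h2 := e₁ τ
      linear_combination h2 + τ ^ (j + 1) * h1
    · rw [hdY, ge₂]
      have h1 := ue₂ τ
      have h2 := e₂ τ
      linear_combination h2 + τ ^ (j + 1) * h1

/-! ### The normal form near the centre -/

/-- `y ↦ y g(x, y, z)` is the primitive of `y ↦ f(x, y, z)` that vanishes at `y = 0`. -/
theorem Smooth3.exists_primitive2 {f : ℝ → ℝ → ℝ → ℝ} (hf : Smooth3 f) :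
    ∃ g : ℝ → ℝ → ℝ → ℝ, Smooth3 g ∧ (∀ x y z, HasDerivAt (fun y => y * g x y z) (f x y z) y) ∧
      ∀ x z, g x 0 z = f x 0 z := by
  have h1 := contDiff_parametric_primitive (E := ℝ × ℝ) (f := fun p y => f p.1 y p.2)
    (hf.comp (by fun_prop) (by fun_prop) (by fun_prop))
  have hG : Smooth3 (fun x y z => ∫ s in (0 : ℝ)..y, f x s z) :=
    h1.comp (f := fun p : ℝ × ℝ × ℝ => ((p.1, p.2.2), p.2.1)) (by fun_prop)
  obtain ⟨g, hg, hge, hgd⟩ := hG.hadamard2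
  have hd : ∀ x y z, HasDerivAt (fun y => ∫ s in (0 : ℝ)..y, f x s z) (f x y z) y := by
    intro x y z
    have hc : Continuous (fun s => f x s z) :=
      ContDiff.continuous (n := ∞) (hf.comp (by fun_prop) (by fun_prop) (by fun_prop))
    exact (hc.integral_hasStrictDerivAt 0 y).hasDerivAt
  refine ⟨g, hg, fun x y z => ?_, fun x z => ?_⟩
  · have e : (fun y => y * g x y z) = fun y => ∫ s in (0 : ℝ)..y, f x s z := by
      ext y
      have := hge x y z
      simp only [intervalIntegral.integral_same, zero_add] at this
      exact this.symm
    rw [e]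
    exact hd x y z
  · rw [hgd, (hd x 0 z).deriv]

theorem Smooth3.continuous_fst {f : ℝ → ℝ → ℝ → ℝ} (hf : Smooth3 f) (y z : ℝ) :
    Continuous (fun x => f x y z) :=
  ContDiff.continuous (n := ∞) (hf.comp (by fun_prop) (by fun_prop) (by fun_prop))

theorem Smooth3.continuous_snd {f : ℝ → ℝ → ℝ → ℝ} (hf : Smooth3 f) (x z : ℝ) :
    Continuous (fun y => f x y z) :=
  ContDiff.continuous (n := ∞) (hf.comp (by fun_prop) (by fun_prop) (by fun_prop))

theorem Smooth3.hasDerivAt1 {f : ℝ → ℝ → ℝ → ℝ} (hf : Smooth3 f) (x y z : ℝ) :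
    HasDerivAt (fun x => f x y z) (deriv (fun x => f x y z) x) x :=
  (ContDiff.differentiable (n := ∞) (hf.comp (a := fun x => x) (b := fun _ => y) (c := fun _ => z)
    (by fun_prop) (by fun_prop) (by fun_prop)) (by simp) x).hasDerivAt

theorem Smooth3.hasDerivAt2 {f : ℝ → ℝ → ℝ → ℝ} (hf : Smooth3 f) (x y z : ℝ) :
    HasDerivAt (fun y => f x y z) (deriv (fun y => f x y z) y) y :=
  (ContDiff.differentiable (n := ∞) (hf.comp (a := fun _ => x) (b := fun y => y) (c := fun _ => z)
    (by fun_prop) (by fun_prop) (by fun_prop)) (by simp) y).hasDerivAt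

theorem Smooth3.hasDerivAt3 {f : ℝ → ℝ → ℝ → ℝ} (hf : Smooth3 f) (x y z : ℝ) :
    HasDerivAt (fun z => f x y z) (deriv (fun z => f x y z) z) z :=
  (ContDiff.differentiable (n := ∞) (hf.comp (a := fun _ => x) (b := fun _ => y) (c := fun z => z)
    (by fun_prop) (by fun_prop) (by fun_prop)) (by simp) z).hasDerivAt

/-- `y ↦ y² g(x, y, z)` is the primitive of `y ↦ y f(x, y, z)` that vanishes at `y = 0`. -/
theorem Smooth3.exists_primitive_mul2 {f : ℝ → ℝ → ℝ → ℝ} (hf : Smooth3 f) :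
    ∃ g : ℝ → ℝ → ℝ → ℝ, Smooth3 g ∧
      (∀ x y z, HasDerivAt (fun y => y ^ 2 * g x y z) (y * f x y z) y) ∧
      ∀ x z, g x 0 z = f x 0 z / 2 := by
  have hyf : Smooth3 (fun x y z => y * f x y z) :=
    ContDiff.mul (f := fun p : ℝ × ℝ × ℝ => p.2.1) (by fun_prop) hf
  obtain ⟨k, hk, hkd, hk0⟩ := hyf.exists_primitive2
  obtain ⟨g, hg, hge, -⟩ := hk.hadamard2
  have e : ∀ x y z, k x y z = y * g x y z := fun x y z => by
    rw [hge x y z, hk0 x z]; ring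
  have hd : ∀ x y z, HasDerivAt (fun y => y ^ 2 * g x y z) (y * f x y z) y := by
    intro x y z
    have := hkd x y z
    simp only [e] at this
    convert this using 2
    ring
  refine ⟨g, hg, hd, fun x z => ?_⟩
  have h1 : ∀ y, y * (2 * g x y z + y * deriv (fun y => g x y z) y - f x y z) = 0 := by
    intro y
    have h2 := (hasDerivAt_pow 2 y).mul (hg.hasDerivAt2 x y z)
    have h3 := h2.unique (hd x y z)
    simp only [Nat.cast_ofNat, Nat.add_one_sub_one, pow_one] at h3
    linear_combination h3
  have h4 := eq_zero_of_mul_eq_zero (g := fun y => 2 * g x y z + y * deriv (fun y => g x y z) y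
    - f x y z) (by
      have a1 := hg.continuous_snd x z
      have a2 := hg.deriv2.continuous_snd x z
      have a3 := hf.continuous_snd x z
      fun_prop) h1 0
  simp only [zero_mul, add_zero] at h4
  linarith

theorem Smooth3.deriv1_eq_fderiv {f : ℝ → ℝ → ℝ → ℝ} (hf : Smooth3 f) (x y z : ℝ) :
    deriv (fun ξ => f ξ y z) x =
      fderiv ℝ (fun p : ℝ × ℝ × ℝ => f p.1 p.2.1 p.2.2) (x, y, z) (1, 0, 0) :=
  (HasFDerivAt.comp_hasDerivAt (f := fun ξ : ℝ => (ξ, y, z)) x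
    (ContDiff.differentiable hf (by simp) _).hasFDerivAt ((hasDerivAt_id x).prodMk
      ((hasDerivAt_const _ _).prodMk (hasDerivAt_const _ _)))).deriv

theorem Smooth3.deriv2_eq_fderiv {f : ℝ → ℝ → ℝ → ℝ} (hf : Smooth3 f) (x y z : ℝ) :
    deriv (fun ξ => f x ξ z) y =
      fderiv ℝ (fun p : ℝ × ℝ × ℝ => f p.1 p.2.1 p.2.2) (x, y, z) (0, 1, 0) :=
  (HasFDerivAt.comp_hasDerivAt (f := fun ξ : ℝ => (x, ξ, z)) y
    (ContDiff.differentiable hf (by simp) _).hasFDerivAt ((hasDerivAt_const _ _).prodMk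
      ((hasDerivAt_id y).prodMk (hasDerivAt_const _ _)))).deriv

theorem Smooth3.deriv_comm {f : ℝ → ℝ → ℝ → ℝ} (hf : Smooth3 f) (x y z : ℝ) :
    deriv (fun η => deriv (fun ξ => f ξ η z) x) y =
      deriv (fun ξ => deriv (fun η => f ξ η z) y) x := by
  rw [hf.deriv1.deriv2_eq_fderiv, hf.deriv2.deriv1_eq_fderiv]
  set W : ℝ × ℝ × ℝ → ℝ := fun p => f p.1 p.2.1 p.2.2 with hW
  have e1 : (fun p : ℝ × ℝ × ℝ => deriv (fun ξ => f ξ p.2.1 p.2.2) p.1) =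
      fun p => fderiv ℝ W p (1, 0, 0) := by
    ext p; exact hf.deriv1_eq_fderiv _ _ _
  have e2 : (fun p : ℝ × ℝ × ℝ => deriv (fun ξ => f p.1 ξ p.2.2) p.2.1) =
      fun p => fderiv ℝ W p (0, 1, 0) := by
    ext p; exact hf.deriv2_eq_fderiv _ _ _
  have hd : DifferentiableAt ℝ (fderiv ℝ W) (x, y, z) :=
    ((ContDiff.fderiv_right (m := ∞) hf (by simp)).differentiable (by simp)) _
  have hs : IsSymmSndFDerivAt ℝ W (x, y, z) :=
    (ContDiff.contDiffAt hf).isSymmSndFDerivAt (by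
      rw [minSmoothness_of_isRCLikeNormedField]; exact WithTop.coe_le_coe.2 (le_top : (2 : ℕ∞) ≤ ⊤))
  rw [e1, e2, fderiv_clm_apply hd (differentiableAt_const _),
    fderiv_clm_apply hd (differentiableAt_const _)]
  simpa using hs (0, 1, 0) (1, 0, 0)

theorem Smooth3.exists_bound {g : ℝ → ℝ → ℝ → ℝ} (hg : Smooth3 g) :
    ∃ C, 0 < C ∧ ∀ x y z, |x| ≤ 1 → |y| ≤ 1 → |z| ≤ 1 → |g x y z| ≤ C := by
  obtain ⟨C, hC⟩ := ((isCompact_Icc (a := (-1 : ℝ)) (b := 1)).prod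
    ((isCompact_Icc (a := (-1 : ℝ)) (b := 1)).prod
    (isCompact_Icc (a := (-1 : ℝ)) (b := 1)))).exists_bound_of_continuousOn
    (ContDiff.continuous hg).continuousOn
  refine ⟨max C 1, by positivity, fun x y z hx hy hz => ?_⟩
  exact (hC (x, y, z) ⟨abs_le.1 hx, abs_le.1 hy, abs_le.1 hz⟩).trans (le_max_left _ _)

theorem Smooth3.exists_near {g : ℝ → ℝ → ℝ → ℝ} (hg : Smooth3 g) {ζ : ℝ} (hζ : 0 < ζ) :
    ∃ ε, 0 < ε ∧ ∀ x y z, |x| ≤ ε → |y| ≤ ε → |z| ≤ ε → |g x y z - g 0 0 0| ≤ ζ := by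
  obtain ⟨δ, hδ, h⟩ := Metric.continuous_iff.1 (ContDiff.continuous hg) (0, 0, 0) ζ hζ
  refine ⟨δ / 2, by positivity, fun x y z hx hy hz => (h (x, y, z) ?_).le⟩
  simp only [dist_eq_norm, Prod.mk_sub_mk, sub_zero, Prod.norm_mk, Real.norm_eq_abs]
  exact max_lt (by linarith) (max_lt (by linarith) (by linarith))

set_option maxHeartbeats 1000000 in
/-- The energy of the oscillations near the centre. -/
theorem exists_normal_form {a b w : ℝ → ℝ → ℝ → ℝ} (ha : Smooth3 a) (hb : Smooth3 b)
    (hw : Smooth3 w) {n h : ℕ} (hn : 1 ≤ n) {η ν d : ℝ} (ha0 : ∀ τ, a 0 0 τ = 0)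
    (hb0 : ∀ τ, b 0 0 τ = 0) (hν : deriv (fun y => a 0 y 0) 0 = ν) (hη : ∀ x y, b x y 0 = η * x)
    (hn1 : n = 1 → ∀ x y, a x y 0 = a 0 y 0)
    (hdiv : ∀ x y τ, τ ^ n * deriv (fun ξ => a ξ y τ) x + τ * deriv (fun ξ => b x ξ τ) y
      = τ ^ h * w x y τ) (hd : w 0 0 0 = d) :
    ∃ E θ : ℝ → ℝ → ℝ → ℝ, Smooth3 E ∧
      (∀ x y τ, deriv (fun ξ => E x ξ τ) y = -(τ ^ n * a x y τ)) ∧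
      (∀ x y τ, deriv (fun ξ => E ξ y τ) x = τ * b x y τ - τ ^ h * (y * θ x y τ)) ∧
      ∃ C, 0 < C ∧ ∀ ζ, 0 < ζ → ∃ ε, 0 < ε ∧ ε ≤ 1 ∧ ∀ x y τ, |x| ≤ ε → |y| ≤ ε → 0 < τ → τ ≤ ε →
        |E x y τ - (τ * η * x ^ 2 / 2 - τ ^ n * ν * y ^ 2 / 2)|
          ≤ ζ * (τ * x ^ 2 + τ ^ n * y ^ 2) + C * τ ^ (max n 2) * (|x| * |y|) ∧
        |τ ^ n * a x y τ - τ ^ n * ν * y| ≤ ζ * τ ^ n * |y| + C * τ ^ (max n 2) * |x| ∧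
        |τ * b x y τ - τ * η * x| ≤ ζ * τ * |x| + C * (τ ^ h + τ ^ (max n 2)) * |y| ∧
        |τ * deriv (fun z => E x y z) τ|
          ≤ C * (τ * x ^ 2 + τ ^ n * y ^ 2 + τ ^ (max n 2) * (|x| * |y|)) ∧
        |θ x y τ - d| ≤ ζ := by
  obtain ⟨ã, hã, hãe⟩ : ∃ ã : ℝ → ℝ → ℝ → ℝ, Smooth3 ã ∧
      ∀ x y τ, τ ^ n * (a x y τ - a 0 y τ) = τ ^ (max n 2) * (x * ã x y τ) := by
    obtain ⟨a₁, ha₁, ha₁e, -⟩ := ha.hadamard1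
    rcases Nat.eq_or_lt_of_le hn with h1 | h1
    · obtain ⟨a₂, ha₂, ha₂e, -⟩ := ha₁.hadamard3
      refine ⟨a₂, ha₂, fun x y τ => ?_⟩
      have hz : ∀ x y, a₁ x y 0 = 0 := fun x y =>
        eq_zero_of_mul_eq_zero (ha₁.continuous_fst y 0) (fun x => by
          have h2 := ha₁e x y 0
          rw [hn1 h1.symm x y] at h2
          linarith) x
      rw [ha₁e x y τ, ha₂e x y τ, hz, ← h1]
      simp only [Nat.one_le_ofNat, sup_of_le_right]
      ring
    · refine ⟨a₁, ha₁, fun x y τ => ?_⟩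
      rw [ha₁e x y τ, max_eq_left h1]
      ring
  obtain ⟨a₀, ha₀, ha₀e, ha₀d⟩ := Smooth3.hadamard2 (g := fun _ y z => a 0 y z)
    (ha.comp contDiff_const (by fun_prop) (by fun_prop))
  have ha₀0 : a₀ 0 0 0 = ν := by rw [ha₀d, hν]
  have ha₀e' : ∀ y τ, a 0 y τ = y * a₀ 0 y τ := fun y τ => by rw [ha₀e 0 y τ, ha0]; ring
  obtain ⟨α, hα, hαd, hα0⟩ := ha₀.exists_primitive_mul2
  obtain ⟨γ, hγ, hγd, -⟩ := hã.exists_primitive2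
  obtain ⟨b₁, hb₁, hb₁e, hb₁d⟩ := Smooth3.hadamard1 (g := fun x _ z => b x 0 z)
    (hb.comp (by fun_prop) contDiff_const (by fun_prop))
  have hb₁0 : b₁ 0 0 0 = η := by
    rw [hb₁d]
    simp [hη]
  have hb₁e' : ∀ x τ, b x 0 τ = x * b₁ x 0 τ := fun x τ => by rw [hb₁e x 0 τ, hb0]; ring
  obtain ⟨β, hβ, hβd, hβ0⟩ := Smooth3.exists_primitive_mul2 (f := fun _ y z => b₁ y 0 z)
    (hb₁.comp (by fun_prop) contDiff_const (by fun_prop))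
  obtain ⟨θ, hθ, hθd, hθ0⟩ := hw.exists_primitive2
  set G : ℝ → ℝ → ℝ → ℝ := fun x y τ => y * γ x y τ with hG
  have hGs : Smooth3 G := ContDiff.mul (f := fun p : ℝ × ℝ × ℝ => p.2.1) (by fun_prop) hγ
  have hGx : ∀ x y τ, HasDerivAt (fun x => G x y τ) (y * deriv (fun ξ => γ ξ y τ) x) x :=
    fun x y τ => (hγ.hasDerivAt1 x y τ).const_mul y
  set E : ℝ → ℝ → ℝ → ℝ := fun x y τ => τ * (x ^ 2 * β 0 x τ) - τ ^ n * (y ^ 2 * α 0 y τ)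
    - τ ^ (max n 2) * (x * G x y τ) with hE
  have hβs : Smooth3 (fun x _ τ => β 0 x τ) := hβ.comp contDiff_const (by fun_prop) (by fun_prop)
  have hαs : Smooth3 (fun _ y τ => α 0 y τ) := hα.comp contDiff_const (by fun_prop) (by fun_prop)
  have hEs : Smooth3 E := by
    have h1 : ContDiff ℝ ∞ (fun p : ℝ × ℝ × ℝ => β 0 p.1 p.2.2) := hβs
    have h2 : ContDiff ℝ ∞ (fun p : ℝ × ℝ × ℝ => α 0 p.2.1 p.2.2) := hαs
    have h3 : ContDiff ℝ ∞ (fun p : ℝ × ℝ × ℝ => G p.1 p.2.1 p.2.2) := hGs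
    change ContDiff ℝ ∞ (fun p : ℝ × ℝ × ℝ => p.2.2 * (p.1 ^ 2 * β 0 p.1 p.2.2)
      - p.2.2 ^ n * (p.2.1 ^ 2 * α 0 p.2.1 p.2.2)
      - p.2.2 ^ (max n 2) * (p.1 * G p.1 p.2.1 p.2.2))
    have k1 : ContDiff ℝ ∞ (fun p : ℝ × ℝ × ℝ => p.1) := by fun_prop
    have k2 : ContDiff ℝ ∞ (fun p : ℝ × ℝ × ℝ => p.2.1) := by fun_prop
    have k3 : ContDiff ℝ ∞ (fun p : ℝ × ℝ × ℝ => p.2.2) := by fun_prop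
    exact ((k3.mul ((k1.pow 2).mul h1)).sub ((k3.pow n).mul ((k2.pow 2).mul h2))).sub
      ((k3.pow _).mul (k1.mul h3))
  have hEx : ∀ x y τ, deriv (fun ξ => E ξ y τ) x = τ * (x * b₁ x 0 τ)
      - τ ^ (max n 2) * (y * (γ x y τ + x * deriv (fun ξ => γ ξ y τ) x)) := by
    intro x y τ
    have h1 := (((hβd 0 x τ).const_mul τ).sub_const (τ ^ n * (y ^ 2 * α 0 y τ))).sub
      (((hasDerivAt_id x).fun_mul (hGx x y τ)).const_mul (τ ^ (max n 2)))
    refine h1.deriv.trans ?_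
    simp only [hG, id]
    ring
  have hEy : ∀ x y τ, deriv (fun ξ => E x ξ τ) y = -(τ ^ n * a x y τ) := by
    intro x y τ
    have h1 := (((hαd 0 y τ).const_mul (τ ^ n)).const_sub (τ * (x ^ 2 * β 0 x τ))).sub
      (((hγd x y τ).const_mul x).const_mul (τ ^ (max n 2)))
    refine h1.deriv.trans ?_
    have h2 := hãe x y τ
    rw [ha₀e' y τ] at h2
    linear_combination h2
  have hExb : ∀ x y τ, deriv (fun ξ => E ξ y τ) x = τ * b x y τ - τ ^ h * (y * θ x y τ) := by
    intro x y τ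
    have hconst : ∀ y, HasDerivAt (fun y => deriv (fun ξ => E ξ y τ) x
        - (τ * b x y τ - τ ^ h * (y * θ x y τ))) 0 y := by
      intro y
      have h1 := hEs.deriv1.hasDerivAt2 x y τ
      rw [hEs.deriv_comm x y τ] at h1
      have h2 : deriv (fun ξ => deriv (fun η => E ξ η τ) y) x =
          -(τ ^ n * deriv (fun ξ => a ξ y τ) x) := by
        simp only [hEy]
        exact ((ha.hasDerivAt1 x y τ).const_mul (τ ^ n)).fun_neg.deriv
      rw [h2] at h1
      have h3 := h1.fun_sub (((hb.hasDerivAt2 x y τ).const_mul τ).fun_sub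
        ((hθd x y τ).const_mul (τ ^ h)))
      refine h3.congr_deriv ?_
      linear_combination -(hdiv x y τ)
    have h1 := is_const_of_deriv_eq_zero (fun y => (hconst y).differentiableAt)
      (fun y => (hconst y).deriv) y 0
    rw [hEx x 0 τ, hb₁e' x τ] at h1
    linear_combination h1
  refine ⟨E, θ, hEs, hEy, hExb, ?_⟩
  have hαz := hαs.deriv3
  have hβz := hβs.deriv3
  obtain ⟨B₁, hB₁, b₁'⟩ := hγ.exists_bound
  obtain ⟨B₂, hB₂, b₂'⟩ := hγ.deriv1.exists_bound
  obtain ⟨B₃, hB₃, b₃'⟩ := hã.exists_bound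
  obtain ⟨B₄, hB₄, b₄'⟩ := hθ.exists_bound
  obtain ⟨B₅, hB₅, b₅'⟩ := hαs.exists_bound
  obtain ⟨B₆, hB₆, b₆'⟩ := hβs.exists_bound
  obtain ⟨B₇, hB₇, b₇'⟩ := hαz.exists_bound
  obtain ⟨B₈, hB₈, b₈'⟩ := hβz.exists_bound
  obtain ⟨B₉, hB₉, b₉'⟩ := hγ.deriv3.exists_bound
  refine ⟨B₁ + B₂ + B₃ + B₄ + (B₆ + B₈) + (n * B₅ + B₇) + ((max n 2 : ℕ) * B₁ + B₉),
    by positivity, fun ζ hζ => ?_⟩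
  set C := B₁ + B₂ + B₃ + B₄ + (B₆ + B₈) + (n * B₅ + B₇) + ((max n 2 : ℕ) * B₁ + B₉) with hC
  have hp1 : 0 ≤ n * B₅ := by positivity
  have hp2 : 0 ≤ (max n 2 : ℕ) * B₁ := by positivity
  obtain ⟨ε₁, hε₁, n₁⟩ := hα.exists_near hζ
  obtain ⟨ε₂, hε₂, n₂⟩ := hβ.exists_near hζ
  obtain ⟨ε₃, hε₃, n₃⟩ := ha₀.exists_near hζ
  obtain ⟨ε₄, hε₄, n₄⟩ := hb₁.exists_near hζ
  obtain ⟨ε₅, hε₅, n₅⟩ := hθ.exists_near hζ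
  refine ⟨min 1 (min ε₁ (min ε₂ (min ε₃ (min ε₄ ε₅)))), by positivity, min_le_left _ _, ?_⟩
  intro x y τ hx hy hτ hτε
  have hz : |τ| ≤ min 1 (min ε₁ (min ε₂ (min ε₃ (min ε₄ ε₅)))) := by rwa [abs_of_pos hτ]
  simp only [le_min_iff] at hx hy hz
  obtain ⟨hx0, hx1, hx2, hx3, hx4, hx5⟩ := hx
  obtain ⟨hy0, hy1, hy2, hy3, hy4, hy5⟩ := hy
  obtain ⟨hz0, hz1, hz2, hz3, hz4, hz5⟩ := hz
  have k₁ := n₁ 0 y τ (by simpa using hε₁.le) hy1 hz1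
  have k₂ := n₂ 0 x τ (by simpa using hε₂.le) hx2 hz2
  have k₃ := n₃ 0 y τ (by simpa using hε₃.le) hy3 hz3
  have k₄ := n₄ x 0 τ hx4 (by simpa using hε₄.le) hz4
  have k₅ := n₅ x y τ hx5 hy5 hz5
  rw [hα0, ha₀0] at k₁
  rw [hβ0, hb₁0] at k₂
  rw [ha₀0] at k₃
  rw [hb₁0] at k₄
  rw [hθ0, hd] at k₅
  have c₁ := b₁' x y τ hx0 hy0 hz0
  have c₂ := b₂' x y τ hx0 hy0 hz0
  have c₃ := b₃' x y τ hx0 hy0 hz0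
  have c₄ := b₄' x y τ hx0 hy0 hz0
  have c₅ := b₅' x y τ hx0 hy0 hz0
  have c₆ := b₆' x y τ hx0 hy0 hz0
  have c₇ := b₇' x y τ hx0 hy0 hz0
  have c₈ := b₈' x y τ hx0 hy0 hz0
  have c₉ := b₉' x y τ hx0 hy0 hz0
  have hτn : 0 < τ ^ n := pow_pos hτ n
  have hτm : 0 < τ ^ (max n 2) := pow_pos hτ _
  have hτh : 0 < τ ^ h := pow_pos hτ _
  have hτ1 : τ ≤ 1 := by rwa [abs_of_pos hτ] at hz0
  refine ⟨?_, ?_, ?_, ?_, k₅⟩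
  · have e : E x y τ - (τ * η * x ^ 2 / 2 - τ ^ n * ν * y ^ 2 / 2) =
        τ * x ^ 2 * (β 0 x τ - η / 2) - τ ^ n * y ^ 2 * (α 0 y τ - ν / 2)
        - τ ^ (max n 2) * (x * y) * γ x y τ := by
      simp only [hE, hG]; ring
    rw [e]
    refine (abs_sub _ _).trans ((add_le_add_left (abs_sub _ _) _).trans ?_)
    rw [abs_mul (τ * x ^ 2), abs_mul (τ ^ n * y ^ 2), abs_mul (τ ^ max n 2 * (x * y)),
      abs_mul (τ ^ max n 2), abs_mul x y,
      abs_of_nonneg (show 0 ≤ τ * x ^ 2 by positivity),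
      abs_of_nonneg (show 0 ≤ τ ^ n * y ^ 2 by positivity), abs_of_pos hτm]
    have h1 : τ * x ^ 2 * |β 0 x τ - η / 2| ≤ τ * x ^ 2 * ζ := by gcongr
    have h2 : τ ^ n * y ^ 2 * |α 0 y τ - ν / 2| ≤ τ ^ n * y ^ 2 * ζ := by gcongr
    have h3 : τ ^ max n 2 * (|x| * |y|) * |γ x y τ| ≤ τ ^ max n 2 * (|x| * |y|) * C := by
      gcongr; linarith
    linarith
  · have e : τ ^ n * a x y τ - τ ^ n * ν * y = τ ^ n * y * (a₀ 0 y τ - ν)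
        + τ ^ (max n 2) * x * ã x y τ := by
      have h2 := hãe x y τ
      rw [ha₀e' y τ] at h2
      linear_combination h2
    rw [e]
    refine (abs_add_le _ _).trans ?_
    rw [abs_mul, abs_mul, abs_mul, abs_mul, abs_of_pos hτn, abs_of_pos hτm]
    have h1 : τ ^ n * |y| * |a₀ 0 y τ - ν| ≤ τ ^ n * |y| * ζ := by gcongr
    have h2 : τ ^ max n 2 * |x| * |ã x y τ| ≤ τ ^ max n 2 * |x| * C := by
      gcongr; linarith
    linarith
  · have e : τ * b x y τ - τ * η * x = τ * x * (b₁ x 0 τ - η)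
        + (-(τ ^ (max n 2) * y) * (γ x y τ + x * deriv (fun ξ => γ ξ y τ) x)
        + τ ^ h * y * θ x y τ) := by
      have h1 := hExb x y τ
      rw [hEx x y τ] at h1
      linear_combination -h1
    rw [e]
    refine (abs_add_le _ _).trans ((add_le_add_right (abs_add_le _ _) _).trans ?_)
    rw [abs_mul, abs_mul, abs_mul, abs_mul (τ ^ h * y), abs_mul (τ ^ h), abs_neg, abs_mul,
      abs_of_pos hτ, abs_of_pos hτm, abs_of_pos hτh]
    have h1 : τ * |x| * |b₁ x 0 τ - η| ≤ τ * |x| * ζ := by gcongr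
    have h2 : |γ x y τ + x * deriv (fun ξ => γ ξ y τ) x| ≤ C := by
      refine (abs_add_le _ _).trans ?_
      rw [abs_mul]
      have : |x| * |deriv (fun ξ => γ ξ y τ) x| ≤ 1 * B₂ := by gcongr
      linarith
    have h3 : τ ^ max n 2 * |y| * |γ x y τ + x * deriv (fun ξ => γ ξ y τ) x|
        ≤ τ ^ max n 2 * |y| * C := by gcongr
    have h4 : τ ^ h * |y| * |θ x y τ| ≤ τ ^ h * |y| * C := by
      gcongr; linarith
    linarith
  · have d1 := ((hasDerivAt_id τ).fun_mul ((hβs.hasDerivAt3 x y τ).const_mul (x ^ 2)))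
    have d2 := ((hasDerivAt_pow n τ).fun_mul ((hαs.hasDerivAt3 x y τ).const_mul (y ^ 2)))
    have d3 := ((hasDerivAt_pow (max n 2) τ).fun_mul
      (((hγ.hasDerivAt3 x y τ).const_mul y).const_mul x))
    have e : τ * deriv (fun z => E x y z) τ =
        τ * x ^ 2 * (β 0 x τ + τ * deriv (fun z => β 0 x z) τ)
        - τ ^ n * y ^ 2 * (n * α 0 y τ + τ * deriv (fun z => α 0 y z) τ)
        - τ ^ (max n 2) * (x * y) * ((max n 2 : ℕ) * γ x y τ
          + τ * deriv (fun z => γ x y z) τ) := by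
      have h0 := ((d1.fun_sub d2).fun_sub d3).deriv
      have h1 : deriv (fun z => E x y z) τ = _ := h0
      rw [h1]
      have p1 : τ * τ ^ (n - 1) = τ ^ n := by rw [← pow_succ', Nat.sub_add_cancel hn]
      have p2 : τ * τ ^ (max n 2 - 1) = τ ^ (max n 2) := by
        rw [← pow_succ', Nat.sub_add_cancel (hn.trans (le_max_left _ _))]
      simp only [id]
      linear_combination -(n * (y ^ 2 * α 0 y τ)) * p1 - ((max n 2 : ℕ) * (x * (y * γ x y τ))) * p2
    rw [e]
    refine (abs_sub _ _).trans ((add_le_add_left (abs_sub _ _) _).trans ?_)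
    rw [abs_mul (τ * x ^ 2), abs_mul (τ ^ n * y ^ 2), abs_mul (τ ^ max n 2 * (x * y)),
      abs_mul (τ ^ max n 2), abs_mul x y,
      abs_of_nonneg (show 0 ≤ τ * x ^ 2 by positivity),
      abs_of_nonneg (show 0 ≤ τ ^ n * y ^ 2 by positivity), abs_of_pos hτm]
    have hmul : ∀ {z B : ℝ}, |z| ≤ B → |τ * z| ≤ B := fun {z B} h => by
      rw [abs_mul, abs_of_pos hτ]
      exact (mul_le_of_le_one_left (abs_nonneg z) hτ1).trans h
    have h1 : |β 0 x τ + τ * deriv (fun z => β 0 x z) τ| ≤ C :=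
      (abs_add_le _ _).trans (by have := hmul c₈; linarith)
    have h2 : |n * α 0 y τ + τ * deriv (fun z => α 0 y z) τ| ≤ C := by
      refine (abs_add_le _ _).trans ?_
      have := hmul c₇
      rw [abs_mul, Nat.abs_cast]
      have : (n : ℝ) * |α 0 y τ| ≤ n * B₅ := by gcongr
      linarith
    have h3 : |(max n 2 : ℕ) * γ x y τ + τ * deriv (fun z => γ x y z) τ| ≤ C := by
      refine (abs_add_le _ _).trans ?_
      have := hmul c₉
      rw [abs_mul, Nat.abs_cast]
      have : ((max n 2 : ℕ) : ℝ) * |γ x y τ| ≤ (max n 2 : ℕ) * B₁ := by gcongr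
      linarith
    have j1 := mul_le_mul_of_nonneg_left h1 (show 0 ≤ τ * x ^ 2 by positivity)
    have j2 := mul_le_mul_of_nonneg_left h2 (show 0 ≤ τ ^ n * y ^ 2 by positivity)
    have j3 := mul_le_mul_of_nonneg_left h3 (show 0 ≤ τ ^ max n 2 * (|x| * |y|) by positivity)
    linarith

/-! ### The Lyapunov function -/

theorem sq_pow_mul_le {τ X Y : ℝ} (hτ : 0 < τ) (hτ1 : τ ≤ 1) {e i j : ℕ}
    (h : i + j ≤ 2 * e) :
    (τ ^ e * (X * Y)) ^ 2 ≤ (τ ^ i * X ^ 2) * (τ ^ j * Y ^ 2) := by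
  have h1 : τ ^ (2 * e) ≤ τ ^ (i + j) := pow_le_pow_of_le_one hτ.le hτ1 h
  calc (τ ^ e * (X * Y)) ^ 2 = τ ^ (2 * e) * (X * Y) ^ 2 := by ring
    _ ≤ τ ^ (i + j) * (X * Y) ^ 2 := by gcongr
    _ = _ := by ring

theorem pow_mul_le_of_lt {τ X Y ζ : ℝ} (hτ : 0 < τ) (hτ1 : τ ≤ 1) (hζ : 0 < ζ) (hτζ : τ ≤ ζ ^ 2)
    {e i j : ℕ} (h : i + j + 1 ≤ 2 * e) :
    τ ^ e * (X * Y) ≤ ζ * (τ ^ i * X ^ 2 + τ ^ j * Y ^ 2) := by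
  have h1 := sq_pow_mul_le (X := X) (Y := Y) hτ hτ1 (i := i + 1) (j := j) (e := e) (by omega)
  have hu : 0 ≤ τ ^ i * X ^ 2 := by positivity
  have hv : 0 ≤ τ ^ j * Y ^ 2 := by positivity
  refine abs_le_of_sq_le_sq' ?_ (by positivity) |>.2
  set u := τ ^ i * X ^ 2
  set v := τ ^ j * Y ^ 2
  calc (τ ^ e * (X * Y)) ^ 2 ≤ τ ^ (i + 1) * X ^ 2 * v := h1
    _ = τ * (u * v) := by simp only [u]; ring
    _ ≤ ζ ^ 2 * (u * v) := by gcongr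
    _ ≤ ζ ^ 2 * (u + v) ^ 2 := by
      gcongr
      nlinarith [sq_nonneg u, sq_nonneg v, mul_nonneg hu hv]
    _ = _ := by ring

theorem pow_mul_le_of_le {τ X Y K c : ℝ} (hτ : 0 < τ) (hτ1 : τ ≤ 1) (hc : 0 < c)
    {e i j : ℕ} (h : i + j ≤ 2 * e) :
    K * (τ ^ e * (X * Y)) ≤ c / 4 * (τ ^ i * X ^ 2) + K ^ 2 / c * (τ ^ j * Y ^ 2) := by
  have h1 := sq_pow_mul_le (X := X) (Y := Y) hτ hτ1 h
  have hu : 0 ≤ τ ^ i * X ^ 2 := by positivity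
  have hv : 0 ≤ τ ^ j * Y ^ 2 := by positivity
  refine abs_le_of_sq_le_sq' ?_ (by positivity) |>.2
  set u := τ ^ i * X ^ 2
  set v := τ ^ j * Y ^ 2
  set z := τ ^ e * (X * Y)
  have h2 : (c / 4 * u + K ^ 2 / c * v) ^ 2 = (c / 4 * u - K ^ 2 / c * v) ^ 2 + K ^ 2 * (u * v) := by
    field_simp
    ring
  rw [h2, mul_pow]
  nlinarith [sq_nonneg (c / 4 * u - K ^ 2 / c * v), mul_le_mul_of_nonneg_left h1 (sq_nonneg K)]

/-- The dissipation inequality at a point, with all the functions replaced by their values. -/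
theorem dissipation_estimate {n h m p Q : ℕ} {η ν d β ζ C c₀ σ τ x y A B θ Eτ : ℝ}
    (hn : 1 ≤ n) (hm : (m = n ∧ 2 ≤ n) ∨ (m = 2 ∧ n ≤ 2)) (hh : 2 ≤ h)
    (hp : (p = h ∧ n + 1 - h ≤ h) ∨ (p = n + 1 - h ∧ h ≤ n + 1 - h)) (hQ : n + h ≤ Q)
    (hσ : |σ| = 1) (hη : 0 < η) (hν : 0 < ν) (hd : 0 < d) (hβ : 0 < β) (hβ1 : β ≤ 1) (hC : 0 < C) (hc₀ : 0 ≤ c₀)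
    (hζ : 0 < ζ) (hζ1 : ζ ≤ 1) (hζd : ζ ≤ d / 2) (hτ : 0 < τ) (hτ1 : τ ≤ 1) (hτζ : τ ≤ ζ ^ 2)
    (hβv : β * (C ^ 2 / η + ν) ≤ d * ν / 8)
    (hζM : ζ * (2 * d + 2 * d * C + 2 + 2 * C + 2 * c₀ * C + p * c₀)
      ≤ min (d * ν / 8) (β * η / 4))
    (hA : |A + τ ^ n * ν * y| ≤ ζ * τ ^ n * |y| + C * τ ^ m * |x|)
    (hB : |B - τ * η * x| ≤ ζ * τ * |x| + C * (τ ^ h + τ ^ m) * |y|)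
    (hE : |τ * Eτ| ≤ C * (τ * x ^ 2 + τ ^ n * y ^ 2 + τ ^ m * (|x| * |y|)))
    (hθ : |θ - d| ≤ ζ) :
    min (d * ν / 8) (β * η / 4) * (τ ^ (p + 1) * x ^ 2 + τ ^ (h + n) * y ^ 2) ≤
      -(τ ^ h * (y * θ) * A) + β * (τ ^ p * (A * y + x * B)) + Eτ * -(c₀ * τ ^ (Q + 1))
        + β * (p * τ ^ (p - 1) * -(c₀ * τ ^ (Q + 1)) * (σ * (x * y))) := by
  set X := |x| with hX
  set Y := |y| with hY
  have hX0 : 0 ≤ X := abs_nonneg _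
  have hY0 : 0 ≤ Y := abs_nonneg _
  have hXx : X ^ 2 = x ^ 2 := sq_abs x
  have hYy : Y ^ 2 = y ^ 2 := sq_abs y
  have hxy : |x * y| = X * Y := abs_mul x y
  set u := τ ^ (p + 1) * X ^ 2 with hu
  set v := τ ^ (h + n) * Y ^ 2 with hv
  have hu0 : 0 ≤ u := by positivity
  have hv0 : 0 ≤ v := by positivity
  have hζsq : ζ ^ 2 ≤ ζ := by nlinarith
  have hτζ' : τ ≤ ζ := hτζ.trans hζsq
  have k1 := pow_mul_le_of_lt (X := X) (Y := Y) hτ hτ1 hζ hτζ (e := h + m) (i := p + 1) (j := h + n)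
    (by omega)
  have k2 := pow_mul_le_of_lt (X := X) (Y := Y) hτ hτ1 hζ hτζ (e := p + m) (i := p + 1) (j := h + n)
    (by omega)
  have k3 := pow_mul_le_of_le (X := X) (Y := Y) hτ hτ1 hη (K := C) (e := p + h) (i := p + 1)
    (j := h + n) (by omega)
  have k4 := pow_mul_le_of_lt (X := X) (Y := Y) hτ hτ1 hζ hτζ (e := Q + m) (i := p + 1) (j := h + n)
    (by omega)
  have k5 := pow_mul_le_of_lt (X := X) (Y := Y) hτ hτ1 hζ hτζ (e := p + Q) (i := p + 1) (j := h + n)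
    (by omega)
  rw [← hu, ← hv] at k1 k2 k3 k4 k5
  have hpow : ∀ {i j : ℕ}, j ≤ i → τ ^ i ≤ τ ^ j := fun h => pow_le_pow_of_le_one hτ.le hτ1 h
  have hpow' : ∀ {i j : ℕ}, j + 1 ≤ i → τ ^ i ≤ ζ * τ ^ j := fun {i j} h =>
    (hpow h).trans (by rw [pow_succ']; gcongr)
  have l1 : τ ^ (p + n) * Y ^ 2 ≤ v := by
    rw [hv]; gcongr ?_ * _; exact hpow (by omega)
  have l2 : τ ^ (Q + 1) * X ^ 2 ≤ ζ * u := by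
    rw [hu, ← mul_assoc]; gcongr ?_ * _; exact hpow' (by omega)
  have l3 : τ ^ (Q + n) * Y ^ 2 ≤ ζ * v := by
    rw [hv, ← mul_assoc]; gcongr ?_ * _; exact hpow' (by omega)
  -- the term with the divergence
  set A₁ := A + τ ^ n * ν * y with hA₁
  have a1 : |y * A₁| ≤ ζ * τ ^ n * Y ^ 2 + C * τ ^ m * (X * Y) := by
    rw [abs_mul]
    calc Y * |A₁| ≤ Y * (ζ * τ ^ n * Y + C * τ ^ m * X) := by gcongr
      _ = _ := by ring
  have a2 := abs_le.1 a1
  have hθ2 := abs_le.1 hθ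
  have t1 : d / 2 * ν * v - 2 * d * (ζ * v + C * (ζ * (u + v))) ≤ -(τ ^ h * (y * θ) * A) := by
    have e : -(τ ^ h * (y * θ) * A) = θ * ν * v - θ * τ ^ h * (y * A₁) := by
      rw [hv, hYy, hA₁, pow_add]; ring
    rw [e]
    have hθp : 0 ≤ θ := by linarith
    have h1 : d / 2 * ν * v ≤ θ * ν * v := by gcongr; linarith
    have h2 : θ * τ ^ h * (y * A₁) ≤ 2 * d * (ζ * v + C * (ζ * (u + v))) := by
      calc θ * τ ^ h * (y * A₁) ≤ θ * τ ^ h * (ζ * τ ^ n * Y ^ 2 + C * τ ^ m * (X * Y)) := by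
            gcongr; exact a2.2
        _ = θ * (ζ * v + C * (τ ^ (h + m) * (X * Y))) := by rw [hv, pow_add, pow_add]; ring
        _ ≤ (2 * d) * (ζ * v + C * (ζ * (u + v))) := by gcongr; linarith
    linarith
  have t2 : β * (3 / 4 * η * u) - β * (C ^ 2 / η + ν) * v
      - (ζ * u + ζ * v + 2 * C * (ζ * (u + v))) ≤ β * (τ ^ p * (A * y + x * B)) := by
    have b1 : -(X * (ζ * τ * X + C * (τ ^ h + τ ^ m) * Y)) ≤ x * (B - τ * η * x) := by
      refine (abs_le.1 ?_).1
      rw [abs_mul]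
      gcongr
    have h1 : 3 / 4 * η * u - (C ^ 2 / η + ν) * v - (ζ * u + ζ * v + 2 * C * (ζ * (u + v)))
        ≤ τ ^ p * (A * y + x * B) := by
      have e : τ ^ p * (A * y + x * B) = η * u - ν * (τ ^ (p + n) * Y ^ 2) + τ ^ p * (y * A₁)
          + τ ^ p * (x * (B - τ * η * x)) := by
        rw [hu, hXx, hYy, hA₁, pow_add, pow_add]; ring
      have h2 : τ ^ p * (y * A₁) ≥ -(ζ * v + C * (ζ * (u + v))) := by
        calc τ ^ p * (y * A₁) ≥ τ ^ p * -(ζ * τ ^ n * Y ^ 2 + C * τ ^ m * (X * Y)) := by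
              exact mul_le_mul_of_nonneg_left a2.1 (by positivity)
          _ = -(ζ * (τ ^ (p + n) * Y ^ 2) + C * (τ ^ (p + m) * (X * Y))) := by
              rw [pow_add, pow_add]; ring
          _ ≥ _ := by gcongr
      have h3 : τ ^ p * (x * (B - τ * η * x)) ≥
          -(ζ * u + (η / 4 * u + C ^ 2 / η * v) + C * (ζ * (u + v))) := by
        calc τ ^ p * (x * (B - τ * η * x)) ≥
              τ ^ p * -(X * (ζ * τ * X + C * (τ ^ h + τ ^ m) * Y)) := by
              exact mul_le_mul_of_nonneg_left b1 (by positivity)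
          _ = -(ζ * u + C * (τ ^ (p + h) * (X * Y)) + C * (τ ^ (p + m) * (X * Y))) := by
              rw [hu, pow_add, pow_add, pow_add]; ring
          _ ≥ _ := by gcongr
      rw [e]
      have h4 : ν * (τ ^ (p + n) * Y ^ 2) ≤ ν * v := by gcongr
      linarith
    have h2 := mul_le_mul_of_nonneg_left h1 hβ.le
    have h3 : 0 ≤ ζ * u + ζ * v + 2 * C * (ζ * (u + v)) := by positivity
    have h4 := mul_le_mul_of_nonneg_right hβ1 h3
    linarith
  have t3 : -(c₀ * (2 * C * (ζ * (u + v)))) ≤ Eτ * -(c₀ * τ ^ (Q + 1)) := by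
    have e : Eτ * -(c₀ * τ ^ (Q + 1)) = -(c₀ * (τ ^ Q * (τ * Eτ))) := by ring
    rw [e]
    have h1 : τ ^ Q * (τ * Eτ) ≤ 2 * C * (ζ * (u + v)) := by
      calc τ ^ Q * (τ * Eτ) ≤ τ ^ Q * (C * (τ * x ^ 2 + τ ^ n * y ^ 2 + τ ^ m * (X * Y))) := by
            exact mul_le_mul_of_nonneg_left (abs_le.1 hE).2 (by positivity)
        _ = C * (τ ^ (Q + 1) * X ^ 2 + τ ^ (Q + n) * Y ^ 2 + τ ^ (Q + m) * (X * Y)) := by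
            rw [hXx, hYy, pow_add, pow_add, pow_add]; ring
        _ ≤ C * (ζ * u + ζ * v + ζ * (u + v)) := by gcongr
        _ = _ := by ring
    have := mul_le_mul_of_nonneg_left h1 hc₀
    linarith
  have t4 : -(p * c₀ * (ζ * (u + v))) ≤ β * (p * τ ^ (p - 1) * -(c₀ * τ ^ (Q + 1)) * (σ * (x * y))) := by
    have e : β * (p * τ ^ (p - 1) * -(c₀ * τ ^ (Q + 1)) * (σ * (x * y))) =
        -(β * (p * c₀ * (τ ^ (p + Q) * (σ * (x * y))))) := by
      obtain ⟨p', rfl⟩ : ∃ p', p = p' + 1 := ⟨p - 1, by omega⟩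
      rw [Nat.add_sub_cancel]; ring
    rw [e]
    have h1 : τ ^ (p + Q) * (σ * (x * y)) ≤ ζ * (u + v) := by
      refine (mul_le_mul_of_nonneg_left ((le_abs_self _).trans ?_) (by positivity)).trans k5
      rw [abs_mul, hσ, one_mul, hxy]
    have h2 : p * c₀ * (τ ^ (p + Q) * (σ * (x * y))) ≤ p * c₀ * (ζ * (u + v)) := by gcongr
    have h3 : 0 ≤ p * c₀ * (ζ * (u + v)) := by positivity
    have h4 := mul_le_mul_of_nonneg_left h2 hβ.le
    have h5 := mul_le_mul_of_nonneg_right hβ1 h3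
    linarith
  have hfin := mul_le_mul_of_nonneg_right hζM (add_nonneg hu0 hv0)
  have hv1 := mul_le_mul_of_nonneg_right hβv hv0
  have m1 := mul_le_mul_of_nonneg_right (min_le_left (d * ν / 8) (β * η / 4)) hv0
  have m2 := mul_le_mul_of_nonneg_right (min_le_right (d * ν / 8) (β * η / 4)) hu0
  have hdζ : 0 ≤ d * ζ * u := by positivity
  have hq1 : 0 ≤ d * ν * v := by positivity
  have hq2 : 0 ≤ β * η * u := by positivity
  have hz1 : 0 ≤ ζ * u := by positivity
  have hz2 : 0 ≤ ζ * v := by positivity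
  rw [← hXx, ← hYy, ← hu, ← hv]
  linarith

/-- A quadratic-like function growing along a perturbed nearly divergence-free system with positive
divergence at the leading order. -/
theorem exists_lyapunov {a b w : ℝ → ℝ → ℝ → ℝ} (ha : Smooth3 a) (hb : Smooth3 b)
    (hw : Smooth3 w) {n h Q : ℕ} (hn : 1 ≤ n) {η ν d c₀ : ℝ} (ha0 : ∀ τ, a 0 0 τ = 0)
    (hb0 : ∀ τ, b 0 0 τ = 0) (hν : deriv (fun y => a 0 y 0) 0 = ν) (hη : ∀ x y, b x y 0 = η * x)
    (hn1 : n = 1 → ∀ x y, a x y 0 = a 0 y 0)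
    (hdiv : ∀ x y τ, τ ^ n * deriv (fun ξ => a ξ y τ) x + τ * deriv (fun ξ => b x ξ τ) y
      = τ ^ h * w x y τ) (hd : w 0 0 0 = d) (hην : ν * η < 0) (hd0 : 0 < d) (hh : 2 ≤ h)
    (hQ : n + h ≤ Q) (hc₀ : 0 ≤ c₀) :
    ∃ V : ℝ → ℝ → ℝ → ℝ, Smooth3 V ∧ ∃ c C ε, 0 < c ∧ 0 < C ∧ 0 < ε ∧ ε ≤ 1 ∧
      ∀ x y τ, |x| ≤ ε → |y| ≤ ε → 0 < τ → τ ≤ ε →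
        c * (τ * x ^ 2 + τ ^ n * y ^ 2) ≤ V x y τ ∧ V x y τ ≤ C * (τ * x ^ 2 + τ ^ n * y ^ 2) ∧
        ∀ e₁ e₂ e, |e₁| ≤ e → |e₂| ≤ e → τ ^ Q * V x y τ - C * e ≤
          deriv (fun ξ => V ξ y τ) x * (τ ^ n * a x y τ + e₁)
            + deriv (fun ξ => V x ξ τ) y * (τ * b x y τ + e₂)
            + deriv (fun z => V x y z) τ * -(c₀ * τ ^ (Q + 1)) := by
  obtain ⟨E, θ, hE, hEy, hEx, C, hC, hest⟩ :=
    exists_normal_form ha hb hw hn ha0 hb0 hν hη hn1 hdiv hd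
  obtain ⟨σ, hσ, hση, hσν⟩ : ∃ σ : ℝ, |σ| = 1 ∧ 0 < σ * η ∧ 0 < -(σ * ν) := by
    rcases lt_trichotomy η 0 with h1 | h1 | h1
    · exact ⟨-1, by simp, by linarith, by nlinarith⟩
    · simp [h1] at hην
    · exact ⟨1, by simp, by linarith, by nlinarith⟩
  set η₁ := σ * η with hη₁
  set ν₁ := -(σ * ν) with hν₁
  obtain ⟨p, hp⟩ : ∃ p, (p = h ∧ n + 1 - h ≤ h) ∨ (p = n + 1 - h ∧ h ≤ n + 1 - h) := by
    rcases le_total (n + 1 - h) h with h1 | h1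
    · exact ⟨h, Or.inl ⟨rfl, h1⟩⟩
    · exact ⟨n + 1 - h, Or.inr ⟨rfl, h1⟩⟩
  set m := max n 2 with hmdef
  have hm : (m = n ∧ 2 ≤ n) ∨ (m = 2 ∧ n ≤ 2) := by omega
  set μ := min η₁ ν₁ with hμdef
  have hμ : 0 < μ := lt_min hση hσν
  obtain ⟨β, hβ, hβ1, hβμ, hβv⟩ : ∃ β : ℝ, 0 < β ∧ β ≤ 1 ∧ β ≤ μ / 8 ∧
      β * (C ^ 2 / η₁ + ν₁) ≤ d * ν₁ / 8 := by
    have hk : 0 < C ^ 2 / η₁ + ν₁ := by positivity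
    refine ⟨min (min 1 (μ / 8)) (d * ν₁ / 8 / (C ^ 2 / η₁ + ν₁)), by positivity,
      (min_le_left _ _).trans (min_le_left _ _), (min_le_left _ _).trans (min_le_right _ _), ?_⟩
    rw [← le_div_iff₀ hk]
    exact min_le_right _ _
  set κ := min (d * ν₁ / 8) (β * η₁ / 4) with hκdef
  have hκ : 0 < κ := by positivity
  set M := 2 * d + 2 * d * C + 2 + 2 * C + 2 * c₀ * C + p * c₀ with hM
  have hMp : 0 < M := by positivity
  obtain ⟨ζ, hζ, hζ1, hζd, hζM, hζμ⟩ : ∃ ζ : ℝ, 0 < ζ ∧ ζ ≤ 1 ∧ ζ ≤ d / 2 ∧ ζ * M ≤ κ ∧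
      ζ * (1 + C) ≤ μ / 8 := by
    refine ⟨min (min 1 (d / 2)) (min (κ / M) (μ / 8 / (1 + C))), by positivity,
      (min_le_left _ _).trans (min_le_left _ _), (min_le_left _ _).trans (min_le_right _ _), ?_, ?_⟩
    · rw [← le_div_iff₀ hMp]
      exact (min_le_right _ _).trans (min_le_left _ _)
    · rw [← le_div_iff₀ (by positivity)]
      exact (min_le_right _ _).trans (min_le_right _ _)
  obtain ⟨ε, hε, hε1, hest⟩ := hest ζ hζ
  set V : ℝ → ℝ → ℝ → ℝ := fun x y τ => σ * (E x y τ + β * (τ ^ p * (x * y))) with hV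
  have hVs : Smooth3 V := by
    have hE' : ContDiff ℝ ∞ (fun q : ℝ × ℝ × ℝ => E q.1 q.2.1 q.2.2) := hE
    change ContDiff ℝ ∞ (fun q : ℝ × ℝ × ℝ => σ * (E q.1 q.2.1 q.2.2
      + β * (q.2.2 ^ p * (q.1 * q.2.1))))
    fun_prop
  obtain ⟨B₁, hB₁, hVx⟩ := hVs.deriv1.exists_bound
  obtain ⟨B₂, hB₂, hVy⟩ := hVs.deriv2.exists_bound
  set D := η₁ + ν₁ + B₁ + B₂ with hD
  have hDp : 0 < D := by positivity
  refine ⟨V, hVs, μ / 4, D, min (min ε (ζ ^ 2)) (κ / D), by positivity, hDp, by positivity,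
    ((min_le_left _ _).trans (min_le_left _ _)).trans hε1, fun x y τ hx hy hτ hτε => ?_⟩
  have hεε : min (min ε (ζ ^ 2)) (κ / D) ≤ ε := (min_le_left _ _).trans (min_le_left _ _)
  have hτ1 : τ ≤ 1 := (hτε.trans hεε).trans hε1
  have hτζ : τ ≤ ζ ^ 2 := hτε.trans ((min_le_left _ _).trans (min_le_right _ _))
  have hτκ : τ * D ≤ κ := by
    rw [← le_div_iff₀ hDp]
    exact hτε.trans (min_le_right _ _)
  obtain ⟨c1, c2, c3, c4, c5⟩ := hest x y τ (hx.trans hεε) (hy.trans hεε) hτ (hτε.trans hεε)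
  have hσa : ∀ z : ℝ, |σ * z| = |z| := fun z => by rw [abs_mul, hσ, one_mul]
  set W := τ * x ^ 2 + τ ^ n * y ^ 2 with hW
  have hW0 : 0 ≤ W := by positivity
  have k1 : τ ^ m * (|x| * |y|) ≤ ζ * W := by
    have := pow_mul_le_of_lt (X := |x|) (Y := |y|) hτ hτ1 hζ hτζ (e := m) (i := 1) (j := n)
      (by omega)
    simpa [hW] using this
  have k2 : |β * (τ ^ p * (x * y))| ≤ μ / 8 * W := by
    rw [abs_mul, abs_mul, abs_mul, abs_of_pos hβ, abs_of_pos (pow_pos hτ p)]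
    have := pow_mul_le_of_le (X := |x|) (Y := |y|) hτ hτ1 (K := 1) (c := 4) (by norm_num)
      (e := p) (i := 1) (j := n) (by omega)
    rw [sq_abs, sq_abs, pow_one] at this
    have h3 : τ ^ p * (|x| * |y|) ≤ W := by
      have : 0 ≤ τ ^ n * y ^ 2 := by positivity
      linarith
    gcongr
  have hVW : |V x y τ - (η₁ * (τ * x ^ 2 / 2) + ν₁ * (τ ^ n * y ^ 2 / 2))| ≤ μ / 4 * W := by
    have e : V x y τ - (η₁ * (τ * x ^ 2 / 2) + ν₁ * (τ ^ n * y ^ 2 / 2)) =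
        σ * (E x y τ - (τ * η * x ^ 2 / 2 - τ ^ n * ν * y ^ 2 / 2) + β * (τ ^ p * (x * y))) := by
      simp only [hV, hη₁, hν₁]; ring
    rw [e, hσa]
    refine (abs_add_le _ _).trans ?_
    have h1 : C * τ ^ m * (|x| * |y|) ≤ C * (ζ * W) := by rw [mul_assoc]; gcongr
    have h2 := mul_le_mul_of_nonneg_right hζμ hW0
    linarith
  have hVW' := abs_le.1 hVW
  have hx0 : 0 ≤ τ * x ^ 2 := by positivity
  have hy0 : 0 ≤ τ ^ n * y ^ 2 := by positivity
  have m1 := mul_le_mul_of_nonneg_right (min_le_left η₁ ν₁) hx0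
  have m2 := mul_le_mul_of_nonneg_right (min_le_right η₁ ν₁) hy0
  have m3 : μ * W ≤ η₁ * (τ * x ^ 2) + ν₁ * (τ ^ n * y ^ 2) := by rw [hW, mul_add]; linarith
  have lower : μ / 4 * W ≤ V x y τ := by linarith
  have upper : V x y τ ≤ D * W := by
    have p1 := mul_nonneg hση.le hy0
    have p2 := mul_nonneg hσν.le hx0
    have p3 : D * W = η₁ * (τ * x ^ 2) + η₁ * (τ ^ n * y ^ 2) + ν₁ * (τ * x ^ 2)
      + ν₁ * (τ ^ n * y ^ 2) + B₁ * W + B₂ * W := by rw [hD, hW]; ring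
    have p4 : 0 ≤ B₁ * W := by positivity
    have p5 : 0 ≤ B₂ * W := by positivity
    linarith
  refine ⟨lower, upper, fun e₁ e₂ e he₁ he₂ => ?_⟩
  have key := dissipation_estimate (n := n) (h := h) (m := m) (p := p) (Q := Q) (η := η₁) (ν := ν₁)
    (d := d) (β := β) (ζ := ζ) (C := C) (c₀ := c₀) (σ := σ) (τ := τ) (x := x) (y := y)
    (A := σ * (τ ^ n * a x y τ)) (B := σ * (τ * b x y τ)) (θ := θ x y τ)
    (Eτ := σ * deriv (fun z => E x y z) τ) hn hm hh hp hQ hσ hση hσν hd0 hβ hβ1 hC hc₀ hζ hζ1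
    hζd hτ hτ1 hτζ hβv hζM
    (by
      rw [show σ * (τ ^ n * a x y τ) + τ ^ n * ν₁ * y = σ * (τ ^ n * a x y τ - τ ^ n * ν * y) by
        rw [hν₁]; ring, hσa]
      exact c2)
    (by
      rw [show σ * (τ * b x y τ) - τ * η₁ * x = σ * (τ * b x y τ - τ * η * x) by
        rw [hη₁]; ring, hσa]
      exact c3)
    (by
      rw [show τ * (σ * deriv (fun z => E x y z) τ) = σ * (τ * deriv (fun z => E x y z) τ) by ring,
        hσa]
      exact c4) c5
  have dx : deriv (fun ξ => V ξ y τ) x =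
      σ * (τ * b x y τ - τ ^ h * (y * θ x y τ) + β * (τ ^ p * y)) := by
    have := ((hE.hasDerivAt1 x y τ).fun_add ((((hasDerivAt_id x).mul_const y).const_mul
      (τ ^ p)).const_mul β)).const_mul σ
    rw [hEx, one_mul] at this
    exact this.deriv
  have dy : deriv (fun ξ => V x ξ τ) y = σ * (-(τ ^ n * a x y τ) + β * (τ ^ p * x)) := by
    have := ((hE.hasDerivAt2 x y τ).fun_add ((((hasDerivAt_id y).const_mul x).const_mul
      (τ ^ p)).const_mul β)).const_mul σ
    rw [hEy, mul_one] at this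
    exact this.deriv
  have dτ : deriv (fun z => V x y z) τ =
      σ * (deriv (fun z => E x y z) τ + β * (p * τ ^ (p - 1) * (x * y))) := by
    exact ((hE.hasDerivAt3 x y τ).fun_add
      (((hasDerivAt_pow p τ).mul_const (x * y)).const_mul β)).const_mul σ |>.deriv
  have g1 : |deriv (fun ξ => V ξ y τ) x * e₁| ≤ B₁ * e := by
    rw [abs_mul]
    have := hVx x y τ (hx.trans (hεε.trans hε1)) (hy.trans (hεε.trans hε1))
      (by rwa [abs_of_pos hτ])
    gcongr
  have g2 : |deriv (fun ξ => V x ξ τ) y * e₂| ≤ B₂ * e := by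
    rw [abs_mul]
    have := hVy x y τ (hx.trans (hεε.trans hε1)) (hy.trans (hεε.trans hε1))
      (by rwa [abs_of_pos hτ])
    gcongr
  have he : 0 ≤ e := (abs_nonneg _).trans he₁
  have g3 : 0 ≤ (η₁ + ν₁) * e := by positivity
  have hlow : τ ^ Q * V x y τ ≤ κ * (τ ^ (p + 1) * x ^ 2 + τ ^ (h + n) * y ^ 2) := by
    calc τ ^ Q * V x y τ ≤ τ ^ (p + 1) * (D * W) := by
          exact mul_le_mul (pow_le_pow_of_le_one hτ.le hτ1 (by omega)) upper
            ((by positivity : (0 : ℝ) ≤ μ / 4 * W).trans lower) (by positivity)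
      _ = τ * D * (τ ^ p * W) := by ring
      _ ≤ κ * (τ ^ (p + 1) * x ^ 2 + τ ^ (h + n) * y ^ 2) := by
          have : τ ^ p * W = τ ^ (p + 1) * x ^ 2 + τ ^ (p + n) * y ^ 2 := by
            rw [hW, pow_succ, pow_add]; ring
          rw [this]
          have h2 : τ ^ (p + n) ≤ τ ^ (h + n) := pow_le_pow_of_le_one hτ.le hτ1 (by omega)
          gcongr
  have ident : deriv (fun ξ => V ξ y τ) x * (τ ^ n * a x y τ + e₁)
            + deriv (fun ξ => V x ξ τ) y * (τ * b x y τ + e₂)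
            + deriv (fun z => V x y z) τ * -(c₀ * τ ^ (Q + 1)) =
      (-(τ ^ h * (y * θ x y τ) * (σ * (τ ^ n * a x y τ)))
        + β * (τ ^ p * (σ * (τ ^ n * a x y τ) * y + x * (σ * (τ * b x y τ))))
        + σ * deriv (fun z => E x y z) τ * -(c₀ * τ ^ (Q + 1))
        + β * (p * τ ^ (p - 1) * -(c₀ * τ ^ (Q + 1)) * (σ * (x * y))))
      + deriv (fun ξ => V ξ y τ) x * e₁ + deriv (fun ξ => V x ξ τ) y * e₂ := by
    rw [mul_add, mul_add, dτ]
    nth_rw 1 [dx]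
    nth_rw 1 [dy]
    ring
  rw [ident]
  have g1' := (abs_le.1 g1).1
  have g2' := (abs_le.1 g2).1
  have hDe : D * e = (η₁ + ν₁) * e + B₁ * e + B₂ * e := by rw [hD]; ring
  linarith

/-! ### The averaged system near the equilibrium -/

theorem mean_const (hP : P.Standing) (c : ℝ) : P.mean (fun _ => c) = c := by
  have h1 : (P.ϰ : ℝ) ≠ 0 := Nat.cast_ne_zero.2 hP.ϰ_pos.ne'
  have := Real.pi_ne_zero
  simp only [mean, intervalIntegral.integral_const, smul_eq_mul, sub_zero]
  field_simp

theorem Lam_one (hP : P.Standing) (ρ ψ : ℝ) : P.Lam 1 ρ ψ = P.Lam 1 0 ψ := by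
  have hq := hP.q_pos
  have h1 : ∀ ρ, P.Lam 1 ρ ψ = P.mean (fun S => P.Fk 1 ρ ψ S - P.Ftilde P.lev 1 ρ ψ S) := fun ρ => by
    change (P.lev 1).Lam ρ ψ = _
    rw [lev_eq le_rfl]; rfl
  have h2 : (1 : ℕ) ≠ 2 * P.q := by omega
  rw [h1, h1]
  simp [Fk, Ftilde, h2]

theorem Om_one (hP : P.Standing) (ρ ψ : ℝ) : P.Om 1 ρ ψ = P.eta * ρ := by
  have h1 : P.Om 1 ρ ψ = P.mean (fun S => P.Gk 1 ρ ψ S - P.Gtilde P.lev 1 ρ ψ S) := by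
    change (P.lev 1).Om ρ ψ = _
    rw [lev_eq le_rfl]; rfl
  rw [h1]
  simp only [Gk, sDot, Gtilde, Finset.Ico_self, Finset.sum_empty, sub_zero]
  simp [mean_const hP, eta, iteratedDeriv_one]

theorem smooth_Lam (hP : P.Standing) {k : ℕ} (hk : 1 ≤ k) :
    ContDiff ℝ ∞ (fun p : ℝ × ℝ => P.Lam k p.1 p.2) := (isSmoothLevel_lev hP k hk).Lam

theorem smooth_Om (hP : P.Standing) {k : ℕ} (hk : 1 ≤ k) :
    ContDiff ℝ ∞ (fun p : ℝ × ℝ => P.Om k p.1 p.2) := (isSmoothLevel_lev hP k hk).Om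

/-- `∑_{k=i}^K τ^{k-i} A_k(x, y)`. -/
noncomputable def tailSum (A : ℕ → ℝ → ℝ → ℝ) (i K : ℕ) (x y τ : ℝ) : ℝ :=
  ∑ k ∈ Finset.Icc i K, τ ^ (k - i) * A k x y

theorem pow_mul_tailSum (A : ℕ → ℝ → ℝ → ℝ) (i K : ℕ) (x y τ : ℝ) :
    τ ^ i * tailSum A i K x y τ = ∑ k ∈ Finset.Icc i K, τ ^ k * A k x y := by
  rw [tailSum, Finset.mul_sum]
  refine Finset.sum_congr rfl fun k hk => ?_
  rw [← mul_assoc, ← pow_add, Nat.add_sub_cancel' (Finset.mem_Icc.1 hk).1]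

theorem pow_mul_tailSum_of_zero {A : ℕ → ℝ → ℝ → ℝ} {i K : ℕ} (hi : 1 ≤ i) {x y : ℝ}
    (h0 : ∀ k, 1 ≤ k → k < i → A k x y = 0) (τ : ℝ) :
    τ ^ i * tailSum A i K x y τ = ∑ k ∈ Finset.Icc 1 K, τ ^ k * A k x y := by
  rw [pow_mul_tailSum]
  refine Finset.sum_subset (Finset.Icc_subset_Icc_left hi) fun k hk hk' => ?_
  rw [Finset.mem_Icc] at hk hk'
  rw [h0 k hk.1 (by omega), mul_zero]

theorem tailSum_zero {A : ℕ → ℝ → ℝ → ℝ} {i K : ℕ} (hi : i ≤ K) (x y : ℝ) :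
    tailSum A i K x y 0 = A i x y := by
  rw [tailSum, Finset.sum_eq_single_of_mem i (Finset.left_mem_Icc.2 hi) fun k hk hki => ?_]
  · simp
  · have := (Finset.mem_Icc.1 hk).1
    rw [zero_pow (by omega), zero_mul]

theorem smooth_tailSum {A : ℕ → ℝ → ℝ → ℝ} {i K : ℕ}
    (hA : ∀ k, i ≤ k → ContDiff ℝ ∞ (fun p : ℝ × ℝ => A k p.1 p.2)) : Smooth3 (tailSum A i K) := by
  refine ContDiff.sum (f := fun k (q : ℝ × ℝ × ℝ) => q.2.2 ^ (k - i) * A k q.1 q.2.1) fun k hk => ?_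
  have h1 : ContDiff ℝ ∞ (fun q : ℝ × ℝ × ℝ => A k q.1 q.2.1) :=
    (hA k (Finset.mem_Icc.1 hk).1).comp (g := fun p : ℝ × ℝ => A k p.1 p.2)
      (f := fun q : ℝ × ℝ × ℝ => (q.1, q.2.1)) (by fun_prop)
  exact (ContDiff.pow (by fun_prop) _).mul h1

/-- A moving frame at the approximate equilibrium of the truncated averaged system, together with a
function that grows along the system perturbed by `O(τ^{K+1})`. -/
theorem exists_frame (hP : P.Standing) {n m h : ℕ} {ψ₀ : ℝ} (hnm : P.LeadingOrders n m)
    (hψ₀ : P.IsEquilibrium n ψ₀) (hdiv : P.DivergenceOrder n m h ψ₀)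
    (hν : P.nu n ψ₀ * P.eta < 0) (hd : 0 < P.divergence h 0 ψ₀) (hh : h + n - 1 < 2 * P.q)
    {K : ℕ} (hK : 2 * P.q ≤ K) {C₁ : ℝ} (hC₁ : 0 ≤ C₁) :
    ∃ (V : ℝ → ℝ → ℝ → ℝ) (X Y : ℝ → ℝ), Smooth3 V ∧ ContDiff ℝ ∞ X ∧ ContDiff ℝ ∞ Y ∧ X 0 = 0 ∧
      Y 0 = ψ₀ ∧ ∃ c C ε, 0 < c ∧ 0 < C ∧ 0 < ε ∧ ε ≤ 1 ∧
      ∀ x y τ, |x| ≤ ε → |y| ≤ ε → 0 < τ → τ ≤ ε →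
        c * (τ * x ^ 2 + τ ^ n * y ^ 2) ≤ V x y τ ∧ V x y τ ≤ C * (τ * x ^ 2 + τ ^ n * y ^ 2) ∧
        ∀ d₁ d₂, |d₁ - P.LamHat K (X τ + x) (Y τ + y) τ| ≤ C₁ * τ ^ (K + 1) →
          |d₂ - P.OmHat K (X τ + x) (Y τ + y) τ| ≤ C₁ * τ ^ (K + 1) →
          τ ^ (2 * P.q) * V x y τ - C * τ ^ (K + 1) ≤
          deriv (fun ξ => V ξ y τ) x * (d₁ - -(1 / (2 * (P.q : ℝ))) * τ ^ (2 * P.q + 1) * deriv X τ)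
            + deriv (fun ξ => V x ξ τ) y
              * (d₂ - -(1 / (2 * (P.q : ℝ))) * τ ^ (2 * P.q + 1) * deriv Y τ)
            + deriv (fun z => V x y z) τ * (-(1 / (2 * (P.q : ℝ))) * τ ^ (2 * P.q + 1)) := by
  obtain ⟨hn1, hn2⟩ := hnm.n_mem
  obtain ⟨hm1, hm2⟩ := hnm.m_mem
  have hmn := hdiv.h_mem.1
  have hh2 : 2 ≤ h := by omega
  have hnh : n + h ≤ 2 * P.q := by omega
  set c₀ : ℝ := 1 / (2 * (P.q : ℝ)) with hc₀
  have hc₀0 : 0 ≤ c₀ := by positivity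
  have hlam : Smooth3 (tailSum P.Lam n K) :=
    smooth_tailSum fun k hk => smooth_Lam hP (hn1.trans hk)
  have hom : Smooth3 (tailSum P.Om 1 K) := smooth_tailSum fun k hk => smooth_Om hP hk
  have hlamE : ∀ x y τ, τ ^ n * tailSum P.Lam n K x y τ = P.LamHat K x y τ := fun x y τ =>
    pow_mul_tailSum_of_zero hn1 (fun k h1 h2 => hnm.Lam_zero k h1 h2 x y) τ
  have homE : ∀ x y τ, τ * tailSum P.Om 1 K x y τ = P.OmHat K x y τ := fun x y τ => by
    have := pow_mul_tailSum P.Om 1 K x y τ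
    rwa [pow_one] at this
  have hlam0 : ∀ x y, tailSum P.Lam n K x y 0 = P.Lam n x y := tailSum_zero (by omega)
  have hom0 : ∀ x y, tailSum P.Om 1 K x y 0 = P.eta * x := fun x y => by
    rw [tailSum_zero (by omega), Om_one hP]
  obtain ⟨X, Y, s₁, s₂, hX, hY, hs₁, hs₂, hX0, hY0, eX, eY⟩ :=
    exists_centre hlam hom (ψ₀ := ψ₀) (η := P.eta) (ν := P.nu n ψ₀) (c₀ := c₀)
      (by rw [hlam0]; exact hψ₀.1) hom0 (by simp only [hlam0]; rfl) hP.eta_ne hψ₀.2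
      (i₁ := 2 * P.q - n) (i₂ := 2 * P.q - 1) (by omega) (by omega) K
  have sX : ContDiff ℝ ∞ (fun q : ℝ × ℝ × ℝ => X q.2.2) := hX.comp (by fun_prop)
  have sY : ContDiff ℝ ∞ (fun q : ℝ × ℝ × ℝ => Y q.2.2) := hY.comp (by fun_prop)
  set a : ℝ → ℝ → ℝ → ℝ := fun x y τ =>
    tailSum P.Lam n K (X τ + x) (Y τ + y) τ - tailSum P.Lam n K (X τ) (Y τ) τ with ha
  set b : ℝ → ℝ → ℝ → ℝ := fun x y τ =>
    tailSum P.Om 1 K (X τ + x) (Y τ + y) τ - tailSum P.Om 1 K (X τ) (Y τ) τ with hb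
  set w : ℝ → ℝ → ℝ → ℝ := fun x y τ => tailSum P.divergence h K (X τ + x) (Y τ + y) τ with hw
  have hshift : ∀ {g : ℝ → ℝ → ℝ → ℝ}, Smooth3 g →
      Smooth3 (fun x y τ => g (X τ + x) (Y τ + y) τ) := fun hg =>
    hg.comp (E := ℝ × ℝ × ℝ) (a := fun q => X q.2.2 + q.1) (b := fun q => Y q.2.2 + q.2.1)
      (c := fun q => q.2.2) (by fun_prop) (by fun_prop) (by fun_prop)
  have hcentre : ∀ {g : ℝ → ℝ → ℝ → ℝ}, Smooth3 g →
      Smooth3 (fun _ _ τ => g (X τ) (Y τ) τ) := fun hg =>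
    hg.comp (E := ℝ × ℝ × ℝ) (a := fun q => X q.2.2) (b := fun q => Y q.2.2)
      (c := fun q => q.2.2) (by fun_prop) (by fun_prop) (by fun_prop)
  have hdx : ∀ {k : ℕ}, 1 ≤ k → ∀ x y, HasDerivAt (fun ξ => P.Lam k ξ y)
      (deriv (fun ξ => P.Lam k ξ y) x) x := fun {k} hk x y => by
    have h1 : ContDiff ℝ ∞ (fun ξ : ℝ => P.Lam k ξ y) :=
      (smooth_Lam hP hk).comp (f := fun ξ : ℝ => (ξ, y)) (by fun_prop)
    exact (h1.differentiable (by simp) x).hasDerivAt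
  have hdy : ∀ {k : ℕ}, 1 ≤ k → ∀ x y, HasDerivAt (fun ξ => P.Om k x ξ)
      (deriv (fun ξ => P.Om k x ξ) y) y := fun {k} hk x y => by
    have h1 : ContDiff ℝ ∞ (fun ξ : ℝ => P.Om k x ξ) :=
      (smooth_Om hP hk).comp (f := fun ξ : ℝ => (x, ξ)) (by fun_prop)
    exact (h1.differentiable (by simp) y).hasDerivAt
  have hDiv : Smooth3 (tailSum P.divergence h K) := by
    refine smooth_tailSum fun k hk => ?_
    have h1 : ContDiff ℝ ∞ (fun p : ℝ × ℝ => deriv (fun x => P.Lam k x p.2) p.1) :=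
      contDiff_deriv_fst (E := ℝ) (g := fun x p => P.Lam k x p) (smooth_Lam hP (by omega))
    have h2 : ContDiff ℝ ∞ (fun p : ℝ × ℝ => deriv (fun y => P.Om k p.2 y) p.1) :=
      contDiff_deriv_fst (E := ℝ) (g := fun y x => P.Om k x y)
        ((smooth_Om hP (by omega)).comp (f := fun p : ℝ × ℝ => (p.2, p.1)) (by fun_prop))
    exact h1.add (h2.comp (f := fun p : ℝ × ℝ => (p.2, p.1)) (by fun_prop))
  have hdivE : ∀ x y τ, τ ^ n * deriv (fun ξ => a ξ y τ) x + τ * deriv (fun ξ => b x ξ τ) y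
      = τ ^ h * w x y τ := fun x y τ => by
    have h1 : HasDerivAt (fun ξ => τ ^ n * a ξ y τ)
        (∑ k ∈ Finset.Icc 1 K, τ ^ k * deriv (fun ξ => P.Lam k ξ (Y τ + y)) (X τ + x)) x := by
      have e : (fun ξ => τ ^ n * a ξ y τ) = fun ξ =>
          P.LamHat K (X τ + ξ) (Y τ + y) τ - P.LamHat K (X τ) (Y τ) τ := by
        funext ξ; rw [ha, mul_sub, hlamE, hlamE]
      rw [e]
      refine HasDerivAt.sub_const _ (HasDerivAt.fun_sum fun k hk => HasDerivAt.const_mul _ ?_)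
      exact (hdx (Finset.mem_Icc.1 hk).1 _ _).comp_const_add (X τ) x
    have h2 : HasDerivAt (fun ξ => τ * b x ξ τ)
        (∑ k ∈ Finset.Icc 1 K, τ ^ k * deriv (fun ξ => P.Om k (X τ + x) ξ) (Y τ + y)) y := by
      have e : (fun ξ => τ * b x ξ τ) = fun ξ =>
          P.OmHat K (X τ + x) (Y τ + ξ) τ - P.OmHat K (X τ) (Y τ) τ := by
        funext ξ; rw [hb, mul_sub, homE, homE]
      rw [e]
      refine HasDerivAt.sub_const _ (HasDerivAt.fun_sum fun k hk => HasDerivAt.const_mul _ ?_)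
      exact (hdy (Finset.mem_Icc.1 hk).1 _ _).comp_const_add (Y τ) y
    have h3 := h1.deriv
    have h4 := h2.deriv
    rw [deriv_const_mul_field] at h3 h4
    rw [h3, h4, hw, pow_mul_tailSum_of_zero (by omega) (fun k hk1 hk2 =>
      hdiv.div_zero k hk1 (by omega) _ _), ← Finset.sum_add_distrib]
    simp only [← mul_add]
    rfl
  obtain ⟨V, hV, c, C, ε, hc, hC, hε, hε1, hest⟩ := exists_lyapunov (a := a) (b := b) (w := w)
    (n := n) (h := h) (Q := 2 * P.q) (η := P.eta) (ν := P.nu n ψ₀) (d := P.divergence h 0 ψ₀)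
    (c₀ := c₀) ((hshift hlam).sub (hcentre hlam)) ((hshift hom).sub (hcentre hom)) (hshift hDiv)
    hn1 (fun τ => by simp [ha]) (fun τ => by simp [hb])
    (by
      simp only [ha, hlam0, hX0, hY0, add_zero]
      rw [deriv_sub_const, deriv_comp_const_add (f := fun y => P.Lam n 0 y), add_zero]
      rfl)
    (fun x y => by simp [hb, hom0, hX0])
    (fun hn x y => by simp only [ha, hlam0, hX0, zero_add]; rw [hn, Lam_one hP x])
    hdivE (by simp only [hw, hX0, hY0, add_zero]; rw [tailSum_zero (by omega)]) hν hd hh2 hnh hc₀0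
  obtain ⟨B₁, hB₁⟩ := (isCompact_Icc (a := (0 : ℝ)) (b := 1)).exists_bound_of_continuousOn
    hs₁.continuous.continuousOn
  obtain ⟨B₂, hB₂⟩ := (isCompact_Icc (a := (0 : ℝ)) (b := 1)).exists_bound_of_continuousOn
    hs₂.continuous.continuousOn
  have hB₁0 : 0 ≤ B₁ := (norm_nonneg _).trans (hB₁ 0 (by simp))
  have hB₂0 : 0 ≤ B₂ := (norm_nonneg _).trans (hB₂ 0 (by simp))
  refine ⟨V, X, Y, hV, hX, hY, hX0, hY0, c, C * (C₁ + B₁ + B₂) + C, ε, hc, by positivity, hε, hε1,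
    fun x y τ hx hy hτ hτε => ?_⟩
  obtain ⟨low, up, hgrow⟩ := hest x y τ hx hy hτ hτε
  refine ⟨low, up.trans ?_, fun d₁ d₂ hd₁ hd₂ => ?_⟩
  · gcongr
    have : 0 ≤ C * (C₁ + B₁ + B₂) := by positivity
    linarith
  have hτ1 : τ ≤ 1 := hτε.trans hε1
  have res : ∀ {i : ℕ} {s : ℝ → ℝ} {B : ℝ}, |s τ| ≤ B →
      |τ ^ i * (τ ^ (K + 1) * s τ)| ≤ B * τ ^ (K + 1) := fun {i s B} hB => by
    rw [abs_mul, abs_mul, abs_of_pos (pow_pos hτ i), abs_of_pos (pow_pos hτ (K + 1))]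
    have h1 : τ ^ i ≤ 1 := pow_le_one₀ hτ.le hτ1
    calc τ ^ i * (τ ^ (K + 1) * |s τ|) ≤ 1 * (τ ^ (K + 1) * B) := by gcongr
      _ = _ := by ring
  have r1 := res (i := n) (hB₁ τ ⟨hτ.le, hτ1⟩)
  have r2 := res (i := 1) (hB₂ τ ⟨hτ.le, hτ1⟩)
  have e1 : d₁ - -c₀ * τ ^ (2 * P.q + 1) * deriv X τ = τ ^ n * a x y τ +
      ((d₁ - P.LamHat K (X τ + x) (Y τ + y) τ) + τ ^ n * (τ ^ (K + 1) * s₁ τ)) := by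
    rw [← eX, ha, ← hlamE]
    have : τ ^ n * τ ^ (2 * P.q - n + 1) = τ ^ (2 * P.q + 1) := by rw [← pow_add]; congr 1; omega
    linear_combination -(c₀ * deriv X τ) * this
  have e2 : d₂ - -c₀ * τ ^ (2 * P.q + 1) * deriv Y τ = τ * b x y τ +
      ((d₂ - P.OmHat K (X τ + x) (Y τ + y) τ) + τ ^ 1 * (τ ^ (K + 1) * s₂ τ)) := by
    rw [← eY, hb, ← homE]
    have : τ * τ ^ (2 * P.q - 1 + 1) = τ ^ (2 * P.q + 1) := by rw [← pow_succ']; congr 1; omega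
    linear_combination -(c₀ * deriv Y τ) * this
  have hτK : 0 ≤ τ ^ (K + 1) := by positivity
  have b1 := mul_nonneg hB₁0 hτK
  have b2 := mul_nonneg hB₂0 hτK
  have := hgrow _ _ ((C₁ + B₁ + B₂) * τ ^ (K + 1))
    ((abs_add_le _ _).trans ((add_le_add hd₁ r1).trans (by linarith)))
    ((abs_add_le _ _).trans ((add_le_add hd₂ r2).trans (by linarith)))
  rw [← e1, ← e2] at this
  have b3 := mul_nonneg hC.le hτK
  rw [neg_mul]
  rw [neg_mul] at this
  linarith

/-- The phase shift `φ - (κ/ϰ) S(t)`. -/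
noncomputable def shift (P : OscSystem) (φ : ℝ → ℝ) (t : ℝ) : ℝ :=
  φ t - (P.κ : ℝ) / (P.ϰ : ℝ) * P.phase t

theorem exists_near_bound (hP : P.Standing) (ψ₀ : ℝ) (K : ℕ) {w : ℕ → ℝ → ℝ → ℝ → ℝ}
    (hw : ∀ k, 1 ≤ k → Smooth3 (w k)) (hper : ∀ k, 1 ≤ k → P.Per (w k)) :
    ∃ C, 0 ≤ C ∧ ∀ τ R Ψ S, 0 ≤ τ → τ ≤ 1 → |R| ≤ 1 → |Ψ - ψ₀| ≤ 1 →
      |∑ i ∈ Finset.Icc 1 K, τ ^ i * w i R Ψ S| ≤ C * τ := by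
  have h : ∀ i, ∃ C, 1 ≤ i → ∀ R Ψ S, |R| ≤ 1 → |Ψ - ψ₀| ≤ 1 → |w i R Ψ S| ≤ C := fun i => by
    by_cases hi : 1 ≤ i
    · obtain ⟨C, hC⟩ := exists_bound_of_smooth_per hP ψ₀ (hw i hi) (hper i hi)
      exact ⟨C, fun _ R Ψ S hR hΨ => hC (R, Ψ, S) ⟨hR, hΨ⟩⟩
    · exact ⟨0, fun h => absurd h hi⟩
  choose C hC using h
  refine ⟨∑ i ∈ Finset.Icc 1 K, |C i|, Finset.sum_nonneg fun _ _ => abs_nonneg _,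
    fun τ R Ψ S h0 h1 hR hΨ => ?_⟩
  rw [Finset.sum_mul]
  refine (Finset.abs_sum_le_sum_abs _ _).trans (Finset.sum_le_sum fun i hi => ?_)
  have hi := (Finset.mem_Icc.1 hi).1
  rw [abs_mul, abs_of_nonneg (pow_nonneg h0 i), mul_comm]
  have h2 := ((hC i hi R Ψ S hR hΨ).trans (le_abs_self _))
  have h3 : τ ^ i ≤ τ := by simpa using pow_le_pow_of_le_one h0 h1 hi
  gcongr

/-- A solution that starts away from the equilibrium cannot stay in a small neighbourhood of it for
longer than a time depending only on the initial moment. -/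
theorem exists_confinement_time (hP : P.Standing) {n m h : ℕ} {ψ₀ : ℝ}
    (hnm : P.LeadingOrders n m) (hψ₀ : P.IsEquilibrium n ψ₀) (hdiv : P.DivergenceOrder n m h ψ₀)
    (hν : P.nu n ψ₀ * P.eta < 0) (hd : 0 < P.divergence h 0 ψ₀) (hh : h + n - 1 < 2 * P.q) :
    ∃ ε, 0 < ε ∧ ε ≤ 1 ∧ ∀ δ, 0 < δ → ∃ T, 1 ≤ T ∧ ∀ ts, T ≤ ts → ∃ te, ts < te ∧
      ∀ r φ, P.IsSolution r φ ts te → δ ≤ |P.shift φ ts - ψ₀| →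
      ∃ t ∈ Set.Icc ts te, ε * P.tau t < |r t - P.a| ∨ ε < |P.shift φ t - ψ₀| := by
  have hq := hP.q_pos
  obtain ⟨C₁, T₁, hC₁, hT₁, havg⟩ := exists_averaged hP ψ₀ (K := 4 * P.q) (by omega)
  obtain ⟨V, X, Y, hV, hX, hY, hX0, hY0, c, C, ε, hc, hC, hε, hε1, hest⟩ :=
    exists_frame hP hnm hψ₀ hdiv hν hd hh (K := 4 * P.q) (by omega) hC₁
  obtain ⟨C₂, hC₂, hu⟩ := exists_near_bound hP ψ₀ (4 * P.q) (w := fun k => (P.lev k).u)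
    (fun k hk => (isSmoothLevel_lev hP k hk).u) (fun k hk => (isSmoothLevel_lev hP k hk).u_per)
  obtain ⟨C₃, hC₃, hv⟩ := exists_near_bound hP ψ₀ (4 * P.q) (w := fun k => (P.lev k).v)
    (fun k hk => (isSmoothLevel_lev hP k hk).v) (fun k hk => (isSmoothLevel_lev hP k hk).v_per)
  refine ⟨ε / 2, by positivity, by linarith, fun δ hδ => ?_⟩
  set u₀ : ℝ := c * (δ / 2) ^ 2 / 2 with hu₀
  have hu₀p : 0 < u₀ := by positivity
  have hlim : Tendsto P.tau atTop (nhds 0) := tendsto_tau hP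
  have e1 : ∀ᶠ t in atTop, C₂ * P.tau t + |X (P.tau t)| ≤ ε / 2 := by
    have : Tendsto (fun t => C₂ * P.tau t + |X (P.tau t)|) atTop (nhds (C₂ * 0 + |X 0|)) :=
      (hlim.const_mul _).add ((hX.continuous.tendsto 0).comp hlim).abs
    rw [hX0, mul_zero, abs_zero, add_zero] at this
    exact this.eventually_le_const (by positivity)
  have e2 : ∀ᶠ t in atTop, C₃ * P.tau t + |Y (P.tau t) - ψ₀| ≤ min (ε / 2) (δ / 2) := by
    have : Tendsto (fun t => C₃ * P.tau t + |Y (P.tau t) - ψ₀|) atTop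
        (nhds (C₃ * 0 + |Y 0 - ψ₀|)) :=
      (hlim.const_mul _).add (((hY.continuous.tendsto 0).comp hlim).sub_const ψ₀).abs
    rw [hY0, mul_zero, sub_self, abs_zero, add_zero] at this
    exact this.eventually_le_const (by positivity)
  have e3 : ∀ᶠ t in atTop, P.tau t ≤ ε := hlim.eventually_le_const hε
  have e4 : ∀ᶠ t in atTop, C * P.tau t ≤ 2 * u₀ := by
    have := hlim.const_mul C
    rw [mul_zero] at this
    exact this.eventually_le_const (by positivity)
  obtain ⟨T₂, hT₂⟩ := eventually_atTop.1 (e1.and (e2.and (e3.and e4)))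
  refine ⟨max T₁ T₂, hT₁.trans (le_max_left _ _), fun ts hts => ?_⟩
  have hts1 : 1 ≤ ts := hT₁.trans ((le_max_left _ _).trans hts)
  have hts0 : 0 < ts := by linarith
  set te : ℝ := ts ^ 2 * (2 * C / u₀) + ts ^ 2 + 1 with hte
  have htse : ts < te := by
    have h1 : 0 < ts ^ 2 * (2 * C / u₀) := by positivity
    have h2 : ts ≤ ts ^ 2 := le_self_pow₀ hts1 (by norm_num)
    linarith
  refine ⟨te, htse, fun r φ hsol hδφ => ?_⟩
  by_contra! hcon
  have hpt : ∀ t ∈ Set.Icc ts te, 0 < t ∧ 0 < P.tau t ∧ P.tau t ≤ 1 ∧ P.tau t ≤ ε ∧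
      C * P.tau t ≤ 2 * u₀ ∧ |P.avgR (4 * P.q) r φ t - X (P.tau t)| ≤ ε ∧
      |P.avgΨ (4 * P.q) r φ t - Y (P.tau t)| ≤ ε ∧
      |P.avgΨ (4 * P.q) r φ t - Y (P.tau t) - (P.shift φ t - ψ₀)| ≤ δ / 2 := fun t ht => by
    obtain ⟨h1, h2, h3, h4⟩ := hT₂ t ((le_max_right _ _).trans (hts.trans ht.1))
    have ht0 : 0 < t := hts0.trans_le ht.1
    have hτ := tau_pos (P := P) t ht0
    have hτ1 : P.tau t ≤ 1 := tau_le_one (hts1.trans ht.1)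
    obtain ⟨hr, hφ⟩ := hcon t ht
    have hR : |(r t - P.a) / P.tau t| ≤ ε / 2 := by
      rw [abs_div, abs_of_pos hτ, div_le_iff₀ hτ]; exact hr
    have hu' := hu (P.tau t) ((r t - P.a) / P.tau t) (P.shift φ t) (P.phase t) hτ.le hτ1
      (hR.trans (by linarith)) (hφ.trans (by linarith))
    have hv' := hv (P.tau t) ((r t - P.a) / P.tau t) (P.shift φ t) (P.phase t) hτ.le hτ1
      (hR.trans (by linarith)) (hφ.trans (by linarith))
    have eR : P.avgR (4 * P.q) r φ t = (r t - P.a) / P.tau t + ∑ i ∈ Finset.Icc 1 (4 * P.q),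
        P.tau t ^ i * (P.lev i).u ((r t - P.a) / P.tau t) (P.shift φ t) (P.phase t) := rfl
    have eΨ : P.avgΨ (4 * P.q) r φ t = P.shift φ t + ∑ i ∈ Finset.Icc 1 (4 * P.q),
        P.tau t ^ i * (P.lev i).v ((r t - P.a) / P.tau t) (P.shift φ t) (P.phase t) := rfl
    have h5 : |P.avgΨ (4 * P.q) r φ t - Y (P.tau t) - (P.shift φ t - ψ₀)| ≤
        min (ε / 2) (δ / 2) := by
      refine le_trans ?_ h2
      rw [eΨ]
      refine le_trans (le_of_eq ?_) ((abs_sub _ _).trans (add_le_add_left hv' _))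
      congr 1; ring
    refine ⟨ht0, hτ, hτ1, h3, h4, ?_, ?_, h5.trans (min_le_right _ _)⟩
    · rw [eR, add_sub_assoc]
      refine (abs_add_le _ _).trans ((add_le_add hR ((abs_sub _ _).trans
        ((add_le_add_left hu' _).trans h1))).trans (by linarith))
    · have := abs_add_le (P.avgΨ (4 * P.q) r φ t - Y (P.tau t) - (P.shift φ t - ψ₀))
        (P.shift φ t - ψ₀)
      rw [sub_add_cancel] at this
      have h6 := h5.trans (min_le_left _ _)
      linarith
  set v : ℝ → ℝ := fun t => V (P.avgR (4 * P.q) r φ t - X (P.tau t))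
    (P.avgΨ (4 * P.q) r φ t - Y (P.tau t)) (P.tau t) with hvdef
  have hvd : ∀ t ∈ Set.Icc ts te, ∃ v', HasDerivWithinAt v v' (Set.Icc ts te) t ∧
      t⁻¹ * v t - C * ((t⁻¹) ^ 2 * P.tau t) ≤ v' := fun t ht => by
    obtain ⟨ht0, hτ, hτ1, hτε, hCτ, hx, hy, -⟩ := hpt t ht
    obtain ⟨hr, hφ⟩ := hcon t ht
    obtain ⟨d₁, d₂, hd₁, hd₂, g₁, g₂⟩ := havg r φ ts te hsol ((le_max_left _ _).trans hts) t ht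
      (hr.trans (mul_le_of_le_one_left hτ.le (by linarith))) (hφ.trans (by linarith))
    have hτd := (hasDerivAt_tau hP ht0).hasDerivWithinAt (s := Set.Icc ts te)
    have hXd := ((hX.differentiable (by simp) (P.tau t)).hasDerivAt).comp_hasDerivWithinAt t hτd
    have hYd := ((hY.differentiable (by simp) (P.tau t)).hasDerivAt).comp_hasDerivWithinAt t hτd
    refine ⟨_, hV.hasDerivWithinAt (hd₁.fun_sub hXd) (hd₂.fun_sub hYd) hτd, ?_⟩
    have := (hest _ _ (P.tau t) hx hy hτ hτε).2.2 d₁ d₂ (by rwa [add_sub_cancel, add_sub_cancel])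
      (by rwa [add_sub_cancel, add_sub_cancel])
    have e : P.tau t ^ (4 * P.q + 1) = (t⁻¹) ^ 2 * P.tau t := by
      rw [← tau_pow_two_q hP ht0, ← pow_mul, ← pow_succ]; congr 1; omega
    rw [e, tau_pow_two_q hP ht0] at this
    rw [mul_comm (deriv X _), mul_comm (deriv Y _)]
    exact this
  choose! v' hv' hv'' using hvd
  have hmono : MonotoneOn (fun t => v t * t⁻¹ - u₀ * (t⁻¹) ^ 2) (Set.Icc ts te) := by
    have hder : ∀ t ∈ Set.Icc ts te, HasDerivWithinAt (fun t => v t * t⁻¹ - u₀ * (t⁻¹) ^ 2)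
        (v' t * t⁻¹ + v t * (-(t ^ 2)⁻¹) - u₀ * (2 * (t⁻¹) ^ 1 * (-(t ^ 2)⁻¹)))
        (Set.Icc ts te) t := fun t ht => by
      have hi := (hasDerivAt_inv (hpt t ht).1.ne').hasDerivWithinAt (s := Set.Icc ts te)
      exact ((hv' t ht).mul hi).fun_sub ((hi.pow 2).const_mul u₀)
    refine monotoneOn_of_deriv_nonneg (convex_Icc _ _)
      (fun t ht => (hder t ht).continuousWithinAt) ?_ ?_
    · intro t ht
      exact ((hder t (interior_subset ht)).mono interior_subset).differentiableWithinAt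
    · intro t ht
      have htI := interior_subset ht
      rw [((hder t htI).hasDerivAt (mem_interior_iff_mem_nhds.1 ht)).deriv]
      obtain ⟨ht0, hτ, hτ1, hτε, hCτ, -⟩ := hpt t htI
      have hi : 0 < t⁻¹ := inv_pos.2 ht0
      have h1 := mul_le_mul_of_nonneg_right (hv'' t htI) hi.le
      have h2 := mul_le_mul_of_nonneg_right hCτ (pow_pos hi 3).le
      rw [← inv_pow, pow_one]
      linarith
  have hs := Set.left_mem_Icc.2 htse.le
  have he := Set.right_mem_Icc.2 htse.le
  have hfin := hmono hs he htse.le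
  simp only at hfin
  obtain ⟨-, hτs, hτs1, hτsε, -, hxs, hys, hysδ⟩ := hpt ts hs
  obtain ⟨hte0, hτe, hτe1, hτeε, -, hxe, hye, -⟩ := hpt te he
  have low := (hest _ _ _ hxs hys hτs hτsε).1
  have up := (hest _ _ _ hxe hye hτe hτeε).2.1
  change _ ≤ v ts at low
  change v te ≤ _ at up
  have hup : v te ≤ 2 * C := by
    refine up.trans ?_
    have h1 : ∀ z : ℝ, |z| ≤ ε → z ^ 2 ≤ 1 := fun z hz => by
      rw [← sq_abs]; exact pow_le_one₀ (abs_nonneg _) (hz.trans hε1)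
    have h2 := mul_le_one₀ hτe1 (sq_nonneg _) (h1 _ hxe)
    have h3 := mul_le_one₀ (pow_le_one₀ hτe.le hτe1 (n := n)) (sq_nonneg _) (h1 _ hye)
    exact (mul_le_mul_of_nonneg_left (add_le_add h2 h3) hC.le).trans_eq (by ring)
  have hlow : 2 * u₀ * ts⁻¹ ≤ v ts := by
    refine le_trans ?_ low
    have h1 : δ / 2 ≤ |P.avgΨ (4 * P.q) r φ ts - Y (P.tau ts)| := by
      have := abs_sub_abs_le_abs_sub (P.shift φ ts - ψ₀)
        (P.avgΨ (4 * P.q) r φ ts - Y (P.tau ts))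
      rw [abs_sub_comm (P.shift φ ts - ψ₀)] at this
      linarith
    have h2 : (δ / 2) ^ 2 ≤ (P.avgΨ (4 * P.q) r φ ts - Y (P.tau ts)) ^ 2 := by
      rw [← sq_abs (P.avgΨ (4 * P.q) r φ ts - Y (P.tau ts))]
      gcongr
    have h3 : ts⁻¹ ≤ P.tau ts ^ n := by
      rw [← tau_pow_two_q hP hts0]
      exact pow_le_pow_of_le_one hτs.le hτs1 hnm.n_mem.2
    have hsi : 0 < ts⁻¹ := inv_pos.2 hts0
    calc 2 * u₀ * ts⁻¹ = c * (0 + ts⁻¹ * (δ / 2) ^ 2) := by rw [hu₀]; ring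
      _ ≤ _ := by gcongr; positivity
  have hts2 := mul_le_mul_of_nonneg_right hlow (inv_pos.2 hts0).le
  have hte2 := mul_le_mul_of_nonneg_right hup (inv_pos.2 hte0).le
  have h1 : u₀ * (ts⁻¹) ^ 2 ≤ 2 * C * te⁻¹ := by
    have : 0 ≤ u₀ * (te⁻¹) ^ 2 := by positivity
    linarith
  have h2 : u₀ * te ≤ 2 * C * ts ^ 2 := by
    have := mul_le_mul_of_nonneg_right h1 (show 0 ≤ te * ts ^ 2 by positivity)
    calc u₀ * te = u₀ * (ts⁻¹) ^ 2 * (te * ts ^ 2) := by field_simp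
      _ ≤ 2 * C * te⁻¹ * (te * ts ^ 2) := this
      _ = _ := by field_simp
  have h3 : u₀ * te = 2 * C * ts ^ 2 + u₀ * (ts ^ 2 + 1) := by rw [hte]; field_simp; ring
  have h4 : 0 < u₀ * (ts ^ 2 + 1) := by positivity
  linarith

theorem IsPerturbation.exists_bound (hP : P.Standing) {F : ℝ → ℝ → ℝ → ℝ → ℝ}
    {Fc : ℕ → ℝ → ℝ → ℝ → ℝ} (hF : P.IsPerturbation F Fc) :
    ∃ C T : ℝ, 0 < C ∧ 0 < T ∧ ∀ t, T ≤ t → ∀ r φ S, |r| ≤ P.Rmax →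
      |F r φ S t| ≤ C * P.tau t ^ 2 := by
  obtain ⟨C, T, hT, h⟩ := hF.expansion 1 le_rfl
  refine ⟨max C 1, T, by positivity, hT, fun t ht r φ S hr => ?_⟩
  have h1 := h t ht r φ S hr
  rw [Finset.Ico_self, Finset.sum_empty, sub_zero, ← tau_pow_two_mul hP (hT.trans_le ht)] at h1
  exact h1.trans (mul_le_mul_of_nonneg_right (le_max_left _ _) (sq_nonneg _))

theorem exists_phase_deriv (hP : P.Standing) : ∃ C : ℝ, 0 < C ∧ ∀ t, 1 ≤ t →
    ∃ s', HasDerivAt P.phase s' t ∧ |s' - P.s 0| ≤ C * P.tau t ^ 2 := by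
  have hq := hP.q_pos
  refine ⟨∑ k ∈ Finset.range (2 * P.q - 1), |P.sDot (k + 2)| + 1,
    add_pos_of_nonneg_of_pos (Finset.sum_nonneg fun _ _ => abs_nonneg _) one_pos, fun t ht => ?_⟩
  refine ⟨_, hasDerivAt_phase hP (by linarith) le_rfl, ?_⟩
  rw [show 2 * P.q + 1 = (2 * P.q - 1) + 1 + 1 by omega, Finset.sum_range_succ',
    Finset.sum_range_succ', sDot_zero hP]
  have h1 : P.sDot (0 + 1) = 0 := by simp [sDot]
  have hτ := (tau_pos (P := P) t (by linarith)).le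
  have hτ1 := tau_le_one (P := P) ht
  rw [h1, mul_zero, add_zero, pow_zero, one_mul, add_sub_cancel_right, add_mul, Finset.sum_mul,
    one_mul]
  refine ((Finset.abs_sum_le_sum_abs _ _).trans (Finset.sum_le_sum fun k _ => ?_)).trans
    (le_add_of_nonneg_right (sq_nonneg _))
  rw [abs_mul, abs_of_nonneg (pow_nonneg hτ _), mul_comm]
  exact mul_le_mul_of_nonneg_left (pow_le_pow_of_le_one hτ hτ1 (by omega)) (abs_nonneg _)

theorem exists_omega_linear (hP : P.Standing) : ∃ ε : ℝ, 0 < ε ∧ ∀ r, |r - P.a| ≤ ε →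
    |P.ω r - P.ω P.a - P.eta * (r - P.a)| ≤ |P.eta| / 4 * |r - P.a| := by
  have h1 : {r | |r| ≤ P.Rmax} ∈ nhds P.a := hP.eventually_strip
  have h2 : HasDerivAt P.ω P.eta P.a :=
    ((hP.ω_smooth.contDiffAt h1).differentiableAt (by simp)).hasDerivAt
  have h3 := (hasDerivAt_iff_isLittleO.1 h2).def (c := |P.eta| / 4)
    (by have := abs_pos.2 hP.eta_ne; positivity)
  obtain ⟨ε, hε, h4⟩ := Metric.eventually_nhds_iff.1 h3
  refine ⟨ε / 2, by positivity, fun r hr => ?_⟩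
  have := h4 (y := r) (by rw [Real.dist_eq]; linarith)
  simp only [smul_eq_mul, Real.norm_eq_abs] at this
  rwa [mul_comm P.eta]

/-- A solution whose amplitude is off the resonant one by `K₀ τ` leaves a neighbourhood of the
resonant phase before the time doubles. -/
theorem exists_fast_escape (hP : P.Standing) (ψ₀ : ℝ) {K₀ : ℝ} (hK₀ : 0 < K₀) :
    ∃ ε T, 0 < ε ∧ 1 ≤ T ∧ ∀ t₀ te, T ≤ t₀ → 2 * t₀ ≤ te → ∀ r φ, P.IsSolution r φ t₀ te →
      K₀ * P.tau t₀ < |r t₀ - P.a| →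
      ∃ t ∈ Set.Icc t₀ te, ε < |r t - P.a| ∨ ε < |P.shift φ t - ψ₀| := by
  have hq := hP.q_pos
  have hη : 0 < |P.eta| := abs_pos.2 hP.eta_ne
  obtain ⟨C₁, T₁, hC₁, hT₁, hf⟩ := hP.pert_f.exists_bound hP
  obtain ⟨C₂, T₂, hC₂, hT₂, hg⟩ := hP.pert_g.exists_bound hP
  obtain ⟨C₃, hC₃, hS⟩ := exists_phase_deriv hP
  obtain ⟨ε₁, hε₁, hω⟩ := exists_omega_linear hP
  set k : ℝ := (P.κ : ℝ) / (P.ϰ : ℝ) with hk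
  have hk0 : 0 ≤ k := by positivity
  set c : ℝ := K₀ / (4 * C₁) with hc
  have hc0 : 0 < c := by positivity
  have hcC : C₁ * c = K₀ / 4 := by rw [hc]; field_simp
  have hlim : Tendsto P.tau atTop (nhds 0) := tendsto_tau hP
  have e1 : ∀ᶠ t in atTop, (C₂ + k * C₃) * P.tau t ≤ |P.eta| * K₀ / 8 := by
    have := hlim.const_mul (C₂ + k * C₃)
    rw [mul_zero] at this
    exact this.eventually_le_const (by positivity)
  have e2 : ∀ᶠ t in atTop, c * P.tau t ≤ 1 := by
    have := hlim.const_mul c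
    rw [mul_zero] at this
    exact this.eventually_le_const (by positivity)
  obtain ⟨T₃, hT₃⟩ := eventually_atTop.1 (e1.and e2)
  refine ⟨min ε₁ (|P.eta| * K₀ * c / 16), max 1 (max T₁ (max T₂ T₃)), by positivity,
    le_max_left _ _, fun t₀ te ht₀ hte r φ hsol hr₀ => ?_⟩
  obtain ⟨h1, h2, h3, h4⟩ : 1 ≤ t₀ ∧ T₁ ≤ t₀ ∧ T₂ ≤ t₀ ∧ T₃ ≤ t₀ := by
    simpa only [max_le_iff] using ht₀
  by_contra! hcon
  have ht0 : 0 < t₀ := by linarith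
  have hτ := tau_pos (P := P) t₀ ht0
  have hτ1 := tau_le_one (P := P) h1
  obtain ⟨hs1, hs2⟩ := hT₃ t₀ h4
  set τ := P.tau t₀ with hτdef
  set Δ : ℝ := c / τ with hΔ
  have hΔ0 : 0 < Δ := by positivity
  have hΔt : Δ ≤ t₀ := by
    have h5 : c * t₀⁻¹ ≤ τ := by
      rw [← tau_pow_two_q hP ht0]
      calc c * τ ^ (2 * P.q) ≤ c * τ ^ 2 := by
            gcongr ?_ * ?_
            exact pow_le_pow_of_le_one hτ.le hτ1 (by omega)
        _ = c * τ * τ := by ring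
        _ ≤ 1 * τ := by gcongr
        _ = τ := one_mul _
    rw [hΔ, div_le_iff₀ hτ]
    calc c = t₀ * (c * t₀⁻¹) := by field_simp
      _ ≤ _ := by gcongr
  have hsub : Set.Icc t₀ (t₀ + Δ) ⊆ Set.Icc t₀ te := Set.Icc_subset_Icc_right (by linarith)
  have hl : t₀ ∈ Set.Icc t₀ (t₀ + Δ) := Set.left_mem_Icc.2 (by linarith)
  have hr : t₀ + Δ ∈ Set.Icc t₀ (t₀ + Δ) := Set.right_mem_Icc.2 (by linarith)
  have hτt : ∀ t ∈ Set.Icc t₀ (t₀ + Δ), P.tau t ^ 2 ≤ τ ^ 2 := fun t ht =>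
    pow_le_pow_left₀ (tau_pos t (ht0.trans_le ht.1)).le (tau_anti ht0 ht.1) 2
  have hz : ∀ t ∈ Set.Icc t₀ (t₀ + Δ), |r t - r t₀| ≤ |r t₀ - P.a| / 4 := fun t ht => by
    have := (convex_Icc t₀ (t₀ + Δ)).norm_image_sub_le_of_norm_hasDerivWithin_le (C := C₁ * τ ^ 2)
      (fun s hs => ((hsol s (hsub hs)).2.1).mono hsub)
      (fun s hs => (hf s (h2.trans hs.1) _ _ _ (hsol s (hsub hs)).1).trans
        (mul_le_mul_of_nonneg_left (hτt s hs) hC₁.le)) hl ht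
    refine this.trans ?_
    rw [Real.norm_eq_abs, abs_of_nonneg (by linarith [ht.1])]
    calc C₁ * τ ^ 2 * (t - t₀) ≤ C₁ * τ ^ 2 * Δ := by gcongr; linarith [ht.2]
      _ = C₁ * c * τ := by rw [hΔ]; field_simp
      _ ≤ _ := by rw [hcC]; linarith
  have hψ := (convex_Icc t₀ (t₀ + Δ)).norm_image_sub_le_of_norm_hasDerivWithin_le
    (C := 3 / 4 * (|P.eta| * |r t₀ - P.a|))
    (f := fun t => P.shift φ t - P.eta * (r t₀ - P.a) * t)
    (f' := fun t => P.ω (r t) + P.g (r t) (φ t) (P.phase t) t - k * deriv P.phase t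
      - P.eta * (r t₀ - P.a))
    (fun s hs => by
      obtain ⟨s', hs', -⟩ := hS s (h1.trans hs.1)
      have d1 := ((hsol s (hsub hs)).2.2.mono hsub).fun_sub
        ((hs'.hasDerivWithinAt (s := Set.Icc t₀ (t₀ + Δ))).const_mul k)
      have d2 := d1.fun_sub (((hasDerivAt_id s).const_mul
        (P.eta * (r t₀ - P.a))).hasDerivWithinAt (s := Set.Icc t₀ (t₀ + Δ)))
      rw [hs'.deriv]
      exact d2.congr_deriv (by rw [mul_one]))
    (fun s hs => by
      obtain ⟨s', hs', hs''⟩ := hS s (h1.trans hs.1)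
      have g1 := hg s (h3.trans hs.1) (r s) (φ s) (P.phase s) (hsol s (hsub hs)).1
      have g2 := hω (r s) ((hcon s (hsub hs)).1.trans (min_le_left _ _))
      have g3 := hz s hs
      have g4 : |r s - P.a| ≤ 5 / 4 * |r t₀ - P.a| := by
        have := abs_add_le (r s - r t₀) (r t₀ - P.a)
        rw [sub_add_sub_cancel] at this
        linarith
      have hres : k * P.s 0 = P.ω P.a := by
        have := hP.resonance
        have h0 : (P.ϰ : ℝ) ≠ 0 := Nat.cast_ne_zero.2 hP.ϰ_pos.ne'
        rw [hk]; field_simp; linarith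
      rw [hs'.deriv, Real.norm_eq_abs]
      have e : P.ω (r s) + P.g (r s) (φ s) (P.phase s) s - k * s' - P.eta * (r t₀ - P.a)
          = (P.ω (r s) - P.ω P.a - P.eta * (r s - P.a)) + P.g (r s) (φ s) (P.phase s) s
            + -(k * (s' - P.s 0)) + P.eta * (r s - r t₀) := by
        rw [← hres]; ring
      rw [e]
      refine (abs_add_le _ _).trans ((add_le_add_left (abs_add_three _ _ _) _).trans ?_)
      rw [abs_neg, abs_mul, abs_mul P.eta, abs_of_nonneg hk0]
      have g5 : |P.eta| / 4 * |r s - P.a| ≤ |P.eta| / 4 * (5 / 4 * |r t₀ - P.a|) := by gcongr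
      have g6 : |P.eta| * |r s - r t₀| ≤ |P.eta| * (|r t₀ - P.a| / 4) := by gcongr
      have g7 : k * |s' - P.s 0| ≤ k * (C₃ * P.tau s ^ 2) := by gcongr
      have g8 : (C₂ + k * C₃) * P.tau s ^ 2 ≤ (C₂ + k * C₃) * τ * τ := by
        rw [mul_assoc, ← sq]
        exact mul_le_mul_of_nonneg_left (hτt s hs) (by positivity)
      have g9 : (C₂ + k * C₃) * τ * τ ≤ |P.eta| * K₀ / 8 * τ := by gcongr
      have g10 : |P.eta| / 8 * (K₀ * τ) ≤ |P.eta| / 8 * |r t₀ - P.a| := by gcongr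
      have g11 : 0 ≤ |P.eta| * |r t₀ - P.a| := by positivity
      linarith) hl hr
  have hb1 := (hcon _ (hsub hl)).2.trans (min_le_right _ _)
  have hb2 := (hcon _ (hsub hr)).2.trans (min_le_right _ _)
  rw [Real.norm_eq_abs, Real.norm_eq_abs, add_sub_cancel_left, abs_of_pos hΔ0] at hψ
  have e : P.eta * (r t₀ - P.a) * Δ = (P.shift φ (t₀ + Δ) - ψ₀) - (P.shift φ t₀ - ψ₀)
      - (P.shift φ (t₀ + Δ) - P.eta * (r t₀ - P.a) * (t₀ + Δ)
        - (P.shift φ t₀ - P.eta * (r t₀ - P.a) * t₀)) := by ring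
  have h5 : |P.eta| * |r t₀ - P.a| * Δ ≤ |P.eta| * K₀ * c / 16 + |P.eta| * K₀ * c / 16
      + 3 / 4 * (|P.eta| * |r t₀ - P.a|) * Δ := by
    rw [← abs_mul, ← abs_of_pos hΔ0, ← abs_mul, abs_of_pos hΔ0, e]
    refine (abs_sub _ _).trans (add_le_add ((abs_sub _ _).trans (add_le_add hb2 hb1)) ?_)
    rw [abs_mul]
    exact hψ
  have h6 : |P.eta| * K₀ * c ≤ |P.eta| * |r t₀ - P.a| * Δ := by
    calc |P.eta| * K₀ * c = |P.eta| * (K₀ * τ) * Δ := by rw [hΔ]; field_simp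
      _ ≤ _ := by gcongr
  have h7 : 0 < |P.eta| * K₀ * c := by positivity
  linarith

theorem IsSolution.mono {r φ : ℝ → ℝ} {t₁ t₂ s₁ s₂ : ℝ} (h : P.IsSolution r φ t₁ t₂)
    (hs : Set.Icc s₁ s₂ ⊆ Set.Icc t₁ t₂) : P.IsSolution r φ s₁ s₂ := fun t ht =>
  ⟨(h t (hs ht)).1, (h t (hs ht)).2.1.mono hs, (h t (hs ht)).2.2.mono hs⟩

/-- The distance to the limit of the phase-locking regimes. -/
noncomputable def limitDist (P : OscSystem) (ψ₀ : ℝ) (r φ : ℝ → ℝ) (t : ℝ) : ℝ :=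
  |r t - P.a| + |P.shift φ t - ψ₀|

theorem exists_exit (hP : P.Standing) {n m h : ℕ} {ψ₀ : ℝ}
    (hnm : P.LeadingOrders n m) (hψ₀ : P.IsEquilibrium n ψ₀) (hdiv : P.DivergenceOrder n m h ψ₀)
    (hν : P.nu n ψ₀ * P.eta < 0) (hd : 0 < P.divergence h 0 ψ₀) (hh : h + n - 1 < 2 * P.q) :
    ∃ ε, 0 < ε ∧ ∀ δ, 0 < δ → ∃ T, 1 ≤ T ∧ ∀ ts, T ≤ ts → ∃ te, ts < te ∧
      ∀ r φ, P.IsSolution r φ ts te → δ ≤ P.limitDist ψ₀ r φ ts →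
      ∃ t ∈ Set.Icc ts te, ε ≤ P.limitDist ψ₀ r φ t := by
  obtain ⟨ε₁, hε₁, -, hconf⟩ := exists_confinement_time hP hnm hψ₀ hdiv hν hd hh
  obtain ⟨ε₂, T₂, hε₂, hT₂, hesc⟩ := exists_fast_escape hP ψ₀ hε₁
  refine ⟨min ε₁ ε₂, by positivity, fun δ hδ => ?_⟩
  obtain ⟨T₁, hT₁, hconf⟩ := hconf (δ / 2) (by positivity)
  obtain ⟨T₃, hT₃⟩ := eventually_atTop.1 ((tendsto_tau hP).eventually_le_const
    (show 0 < δ / 4 / ε₁ by positivity))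
  refine ⟨max T₁ (max T₂ T₃), hT₁.trans (le_max_left _ _), fun ts hts => ?_⟩
  obtain ⟨h1, h2, h3⟩ : T₁ ≤ ts ∧ T₂ ≤ ts ∧ T₃ ≤ ts := by simpa only [max_le_iff] using hts
  obtain ⟨te, hte, hconf⟩ := hconf ts h1
  refine ⟨2 * te, by linarith, fun r φ hsol hD => ?_⟩
  have hex : ∀ t, ε₂ < |r t - P.a| ∨ ε₂ < |P.shift φ t - ψ₀| →
      min ε₁ ε₂ ≤ P.limitDist ψ₀ r φ t := fun t ht => by
    refine (min_le_right _ _).trans ?_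
    have := abs_nonneg (r t - P.a)
    have := abs_nonneg (P.shift φ t - ψ₀)
    rw [limitDist]
    rcases ht with ht | ht <;> linarith
  have hfast : ∀ t ∈ Set.Icc ts te, ε₁ * P.tau t < |r t - P.a| →
      ∃ t ∈ Set.Icc ts (2 * te), min ε₁ ε₂ ≤ P.limitDist ψ₀ r φ t := fun t ht hlt => by
    have hsub : Set.Icc t (2 * te) ⊆ Set.Icc ts (2 * te) := Set.Icc_subset_Icc_left ht.1
    obtain ⟨t', ht', hlt'⟩ := hesc t (2 * te) (h2.trans ht.1) (by linarith [ht.2]) r φ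
      (hsol.mono hsub) hlt
    exact ⟨t', hsub ht', hex t' hlt'⟩
  have hs : ts ∈ Set.Icc ts te := Set.left_mem_Icc.2 hte.le
  rcases le_or_gt (δ / 2) |P.shift φ ts - ψ₀| with hc | hc
  · have hsub : Set.Icc ts te ⊆ Set.Icc ts (2 * te) := Set.Icc_subset_Icc_right (by linarith)
    obtain ⟨t, ht, hlt | hlt⟩ := hconf r φ (hsol.mono hsub) hc
    · exact hfast t ht hlt
    · refine ⟨t, hsub ht, (min_le_left _ _).trans (hlt.le.trans ?_)⟩
      exact le_add_of_nonneg_left (abs_nonneg _)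
  · refine hfast ts hs ?_
    have h4 := hT₃ ts h3
    rw [le_div_iff₀ hε₁] at h4
    rw [limitDist] at hD
    linarith

/-! ### Existence and uniqueness of solutions -/

/-- The right-hand side of the system. -/
noncomputable def field (P : OscSystem) (t : ℝ) (p : ℝ × ℝ) : ℝ × ℝ :=
  (P.f p.1 p.2 (P.phase t) t, P.ω p.1 + P.g p.1 p.2 (P.phase t) t)

/-- The set `|r| ≤ Rmax`, `|φ| ≤ B`. -/
def box (P : OscSystem) (B : ℝ) : Set (ℝ × ℝ) := Set.Icc (-P.Rmax) P.Rmax ×ˢ Set.Icc (-B) B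

theorem isSolution_iff {r φ : ℝ → ℝ} {t₁ t₂ : ℝ} : P.IsSolution r φ t₁ t₂ ↔
    ∀ t ∈ Set.Icc t₁ t₂, |r t| ≤ P.Rmax ∧
      HasDerivWithinAt (fun t => (r t, φ t)) (P.field t (r t, φ t)) (Set.Icc t₁ t₂) t := by
  refine forall₂_congr fun t _ => and_congr_right fun _ => ⟨fun h => h.1.prodMk h.2, fun h => ?_⟩
  exact ⟨(hasFDerivAt_fst (𝕜 := ℝ) (E := ℝ) (F := ℝ)).comp_hasDerivWithinAt t h,
    (hasFDerivAt_snd (𝕜 := ℝ) (E := ℝ) (F := ℝ)).comp_hasDerivWithinAt t h⟩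

theorem _root_.ContDiffOn.exists_lipschitzOnWith_of_isCompact {E : Type*} [NormedAddCommGroup E]
    [NormedSpace ℝ E] {G : E → ℝ} {s : Set E} (hG : ContDiffOn ℝ ∞ G s) (hs : IsCompact s)
    (hc : Convex ℝ s) (hu : UniqueDiffOn ℝ s) : ∃ K, LipschitzOnWith K G s := by
  obtain ⟨C, hC⟩ := hs.exists_bound_of_continuousOn (hG.continuousOn_fderivWithin hu (by simp))
  refine ⟨C.toNNReal, hc.lipschitzOnWith_of_nnnorm_fderivWithin_le
    (hG.differentiableOn (by simp)) fun x hx => ?_⟩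
  rw [← NNReal.coe_le_coe]
  exact (hC x hx).trans (Real.le_coe_toNNReal C)

theorem Standing.Rmax_pos (hP : P.Standing) : 0 < P.Rmax := (abs_nonneg _).trans_lt hP.a_lt

theorem continuousOn_phase (hP : P.Standing) {t₁ t₂ : ℝ} (h₁ : 0 < t₁) :
    ContinuousOn P.phase (Set.Icc t₁ t₂) := fun _ ht =>
  (hasDerivAt_phase hP (h₁.trans_le ht.1) le_rfl).continuousAt.continuousWithinAt

theorem IsPerturbation.exists_lipschitz (hP : P.Standing) {F : ℝ → ℝ → ℝ → ℝ → ℝ}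
    {Fc : ℕ → ℝ → ℝ → ℝ → ℝ} (hF : P.IsPerturbation F Fc) {t₁ t₂ : ℝ} (h₁ : 0 < t₁) (h₂ : t₁ < t₂)
    {B : ℝ} (hB : 0 < B) :
    ∃ K, ∀ t ∈ Set.Icc t₁ t₂,
      LipschitzOnWith K (fun p : ℝ × ℝ => F p.1 p.2 (P.phase t) t) (P.box B) := by
  obtain ⟨M, hM⟩ := isCompact_Icc.exists_bound_of_continuousOn (continuousOn_phase (t₂ := t₂) hP h₁)
  have hM' : -(|M| + 1) < |M| + 1 := by have := abs_nonneg M; linarith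
  have hR := hP.Rmax_pos
  obtain ⟨K, hK⟩ := ContDiffOn.exists_lipschitzOnWith_of_isCompact (E := ℝ × ℝ × ℝ × ℝ)
    (s := Set.Icc (-P.Rmax) P.Rmax ×ˢ Set.Icc (-B) B ×ˢ Set.Icc (-(|M| + 1)) (|M| + 1) ×ˢ
      Set.Icc t₁ t₂)
    (hF.smooth.mono fun p hp => ⟨abs_le.2 hp.1, h₁.trans_le hp.2.2.2.1⟩)
    (isCompact_Icc.prod (isCompact_Icc.prod (isCompact_Icc.prod isCompact_Icc)))
    ((convex_Icc _ _).prod ((convex_Icc _ _).prod ((convex_Icc _ _).prod (convex_Icc _ _))))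
    ((uniqueDiffOn_Icc (by linarith)).prod ((uniqueDiffOn_Icc (by linarith)).prod
      ((uniqueDiffOn_Icc hM').prod (uniqueDiffOn_Icc h₂))))
  refine ⟨K, fun t ht => LipschitzOnWith.of_dist_le_mul fun p hp p' hp' => ?_⟩
  have hS : P.phase t ∈ Set.Icc (-(|M| + 1)) (|M| + 1) := by
    have := hM t ht
    rw [Real.norm_eq_abs] at this
    exact abs_le.1 (this.trans ((le_abs_self M).trans (by linarith)))
  have := hK.dist_le_mul (p.1, p.2, P.phase t, t) ⟨hp.1, hp.2, hS, ht⟩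
    (p'.1, p'.2, P.phase t, t) ⟨hp'.1, hp'.2, hS, ht⟩
  refine this.trans_eq ?_
  simp [Prod.dist_eq]

theorem exists_lipschitz_field (hP : P.Standing) {t₁ t₂ : ℝ} (h₁ : 0 < t₁) (h₂ : t₁ < t₂) {B : ℝ}
    (hB : 0 < B) : ∃ K, ∀ t ∈ Set.Icc t₁ t₂, LipschitzOnWith K (P.field t) (P.box B) := by
  have hR := hP.Rmax_pos
  obtain ⟨K₁, hK₁⟩ := hP.pert_f.exists_lipschitz hP h₁ h₂ hB
  obtain ⟨K₂, hK₂⟩ := hP.pert_g.exists_lipschitz hP h₁ h₂ hB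
  obtain ⟨K₃, hK₃⟩ := ContDiffOn.exists_lipschitzOnWith_of_isCompact (s := Set.Icc (-P.Rmax) P.Rmax)
    (hP.ω_smooth.mono fun r hr => abs_le.2 hr) isCompact_Icc (convex_Icc _ _)
    (uniqueDiffOn_Icc (by linarith))
  have hω : LipschitzOnWith (K₃ * 1) (fun p : ℝ × ℝ => P.ω p.1) (P.box B) :=
    hK₃.comp (LipschitzWith.prod_fst.lipschitzOnWith) fun p hp => hp.1
  exact ⟨_, fun t ht => (hK₁ t ht).prodMk (hω.add (hK₂ t ht))⟩

theorem IsPerturbation.continuousOn_time (hP : P.Standing) {F : ℝ → ℝ → ℝ → ℝ → ℝ}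
    {Fc : ℕ → ℝ → ℝ → ℝ → ℝ} (hF : P.IsPerturbation F Fc) {t₁ t₂ : ℝ} (h₁ : 0 < t₁) {r φ : ℝ}
    (hr : |r| ≤ P.Rmax) : ContinuousOn (fun t => F r φ (P.phase t) t) (Set.Icc t₁ t₂) :=
  hF.smooth.continuousOn.comp (f := fun t => (r, φ, P.phase t, t))
    (continuousOn_const.prodMk (continuousOn_const.prodMk
      ((continuousOn_phase hP h₁).prodMk continuousOn_id))) fun _ ht => ⟨hr, h₁.trans_le ht.1⟩

theorem continuousOn_field (hP : P.Standing) {t₁ t₂ : ℝ} (h₁ : 0 < t₁) {p : ℝ × ℝ}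
    (hp : |p.1| ≤ P.Rmax) : ContinuousOn (fun t => P.field t p) (Set.Icc t₁ t₂) :=
  (hP.pert_f.continuousOn_time hP h₁ hp).prodMk
    (continuousOn_const.add (hP.pert_g.continuousOn_time hP h₁ hp))

theorem IsSolution.unique (hP : P.Standing) {r φ r' φ' : ℝ → ℝ} {t₁ t₂ : ℝ} (h₁ : 0 < t₁)
    (h₂ : t₁ < t₂) (h : P.IsSolution r φ t₁ t₂) (h' : P.IsSolution r' φ' t₁ t₂)
    (hr : r t₁ = r' t₁) (hφ : φ t₁ = φ' t₁) : ∀ t ∈ Set.Icc t₁ t₂, r t = r' t ∧ φ t = φ' t := by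
  rw [isSolution_iff] at h h'
  have hc : ContinuousOn (fun t => (r t, φ t)) (Set.Icc t₁ t₂) := fun t ht =>
    (h t ht).2.continuousWithinAt
  have hc' : ContinuousOn (fun t => (r' t, φ' t)) (Set.Icc t₁ t₂) := fun t ht =>
    (h' t ht).2.continuousWithinAt
  obtain ⟨M, hM⟩ := isCompact_Icc.exists_bound_of_continuousOn hc
  obtain ⟨M', hM'⟩ := isCompact_Icc.exists_bound_of_continuousOn hc'
  obtain ⟨K, hK⟩ := exists_lipschitz_field hP h₁ h₂ (B := |M| + |M'| + 1) (by positivity)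
  have hIci : ∀ {x : ℝ → ℝ × ℝ} {d : ℝ × ℝ} {t : ℝ}, t ∈ Set.Ico t₁ t₂ →
      HasDerivWithinAt x d (Set.Icc t₁ t₂) t → HasDerivWithinAt x d (Set.Ici t) t :=
    fun ht hx => hx.mono_of_mem_nhdsWithin (Icc_mem_nhdsGE_of_mem ht)
  have key := ODE_solution_unique_of_mem_Icc_right (v := P.field)
    (s := fun _ => P.box (|M| + |M'| + 1)) (K := K)
    (fun t ht => hK t (Set.Ico_subset_Icc_self ht)) hc
    (fun t ht => hIci ht (h t (Set.Ico_subset_Icc_self ht)).2)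
    (fun t ht => ⟨abs_le.1 (h t (Set.Ico_subset_Icc_self ht)).1, by
      have h3 : |φ t| ≤ M := (le_max_right _ _).trans (hM t (Set.Ico_subset_Icc_self ht))
      exact abs_le.1 (h3.trans (by linarith [le_abs_self M, abs_nonneg M']))⟩) hc'
    (fun t ht => hIci ht (h' t (Set.Ico_subset_Icc_self ht)).2)
    (fun t ht => ⟨abs_le.1 (h' t (Set.Ico_subset_Icc_self ht)).1, by
      have h3 : |φ' t| ≤ M' := (le_max_right _ _).trans (hM' t (Set.Ico_subset_Icc_self ht))
      exact abs_le.1 (h3.trans (by linarith [le_abs_self M', abs_nonneg M]))⟩)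
    (by rw [hr, hφ])
  exact fun t ht => Prod.mk_inj.1 (key ht)

/-- The nearest point of the box. -/
noncomputable def clamp (P : OscSystem) (B : ℝ) (p : ℝ × ℝ) : ℝ × ℝ :=
  (max (-P.Rmax) (min P.Rmax p.1), max (-B) (min B p.2))

theorem clamp_mem (hP : P.Standing) {B : ℝ} (hB : 0 < B) (p : ℝ × ℝ) : P.clamp B p ∈ P.box B :=
  have hR := hP.Rmax_pos
  ⟨⟨le_max_left _ _, max_le (by linarith) (min_le_left _ _)⟩,
    ⟨le_max_left _ _, max_le (by linarith) (min_le_left _ _)⟩⟩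

theorem clamp_of_mem {B : ℝ} {p : ℝ × ℝ} (hp : p ∈ P.box B) : P.clamp B p = p := by
  rw [clamp, min_eq_right hp.1.2, min_eq_right hp.2.2, max_eq_right hp.1.1, max_eq_right hp.2.1]

theorem lipschitzWith_clamp (B : ℝ) : LipschitzWith 1 (P.clamp B) := by
  have h1 : LipschitzWith 1 (fun p : ℝ × ℝ => max (-P.Rmax) (min P.Rmax p.1)) :=
    (LipschitzWith.prod_fst.const_min _).const_max _
  have h2 : LipschitzWith 1 (fun p : ℝ × ℝ => max (-B) (min B p.2)) :=
    (LipschitzWith.prod_snd.const_min _).const_max _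
  have h3 := h1.prodMk h2
  rw [max_self] at h3
  exact h3

theorem exists_clamped_solution (hP : P.Standing) {t₁ t₂ : ℝ} (h₁ : 0 < t₁) (h₂ : t₁ < t₂) {B : ℝ}
    (hB : 0 < B) (p₀ : ℝ × ℝ) : ∃ p : ℝ → ℝ × ℝ, p t₁ = p₀ ∧ ∀ t ∈ Set.Icc t₁ t₂,
      HasDerivWithinAt p (P.field t (P.clamp B (p t))) (Set.Icc t₁ t₂) t := by
  have hR := hP.Rmax_pos
  obtain ⟨K, hK⟩ := exists_lipschitz_field hP h₁ h₂ hB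
  obtain ⟨M, hM⟩ := isCompact_Icc.exists_bound_of_continuousOn
    (continuousOn_field (t₂ := t₂) hP h₁ (p := P.clamp B 0) (abs_le.2 (clamp_mem hP hB 0).1))
  obtain ⟨D, hD⟩ := ((isCompact_Icc (a := -P.Rmax) (b := P.Rmax)).prod
    (isCompact_Icc (a := -B) (b := B))).isBounded.exists_norm_le
  set L : NNReal := (M + K * (D + D)).toNNReal with hL
  have hpl : IsPicardLindelof (fun t p => P.field t (P.clamp B p))
      (⟨t₁, Set.left_mem_Icc.2 h₂.le⟩ : Set.Icc t₁ t₂) p₀ (L * (t₂ - t₁).toNNReal) 0 L (K * 1) := by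
    refine ⟨fun t ht => ?_, fun x _ => ?_, fun t ht x _ => ?_, ?_⟩
    · exact (hK t ht).comp (lipschitzWith_clamp B).lipschitzOnWith fun p _ => clamp_mem hP hB p
    · exact continuousOn_field hP h₁ (abs_le.2 (clamp_mem hP hB x).1)
    · have e1 := hM t ht
      have e2 := (hK t ht).norm_sub_le (clamp_mem hP hB x) (clamp_mem hP hB 0)
      have e3 : ‖P.clamp B x - P.clamp B 0‖ ≤ D + D := (norm_sub_le _ _).trans
        (add_le_add (hD _ (clamp_mem hP hB x)) (hD _ (clamp_mem hP hB 0)))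
      have e4 := norm_le_norm_add_norm_sub' (P.field t (P.clamp B x)) (P.field t (P.clamp B 0))
      have e5 : (K : ℝ) * ‖P.clamp B x - P.clamp B 0‖ ≤ K * (D + D) := by gcongr
      refine le_trans ?_ (Real.le_coe_toNNReal _)
      linarith
    · simp only [sub_self, NNReal.coe_mul, NNReal.coe_zero, sub_zero]
      rw [max_eq_left (by linarith), Real.coe_toNNReal (t₂ - t₁) (by linarith)]
  obtain ⟨α, h0, hα⟩ := hpl.exists_eq_forall_mem_Icc_hasDerivWithinAt₀
  exact ⟨α, h0, hα⟩

theorem rhoSum_tendsto (hP : P.Standing) {m : ℕ} (hm : 2 ≤ m) (c : ℕ → ℝ) (K : ℕ) :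
    Tendsto (fun t => rhoSum m c K (P.tau t)) atTop (nhds 0) := by
  have h1 : Continuous (rhoSum m c K) := by unfold rhoSum; fun_prop
  have h2 : rhoSum m c K 0 = 0 := Finset.sum_eq_zero fun k hk => by
    have := (Finset.mem_Icc.1 hk).1
    rw [zero_pow (by omega), zero_mul]
  have := (h1.tendsto 0).comp (tendsto_tau hP)
  rwa [h2] at this

theorem phiSum_tendsto (hP : P.Standing) (ψ₀ : ℝ) (d : ℕ → ℝ) (K : ℕ) :
    Tendsto (fun t => phiSum ψ₀ d K (P.tau t)) atTop (nhds ψ₀) := by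
  have h1 : Continuous (phiSum ψ₀ d K) := by unfold phiSum; fun_prop
  have h2 : phiSum ψ₀ d K 0 = ψ₀ := by
    rw [phiSum, Finset.sum_eq_zero fun k hk => ?_, add_zero]
    have := (Finset.mem_Icc.1 hk).1
    rw [zero_pow (by omega), zero_mul]
  have := (h1.tendsto 0).comp (tendsto_tau hP)
  rwa [h2] at this

theorem IsRegime.tendsto (hP : P.Standing) {N n m : ℕ} (hm : 2 ≤ m) {ψ₀ : ℝ} {ϱ ϕ : ℝ → ℝ}
    (h : P.IsRegime N n m ψ₀ ϱ ϕ) :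
    Tendsto ϱ atTop (nhds 0) ∧ Tendsto ϕ atTop (nhds ψ₀) := by
  rcases h with ⟨M, rfl, rfl⟩ | ⟨-, h⟩
  · exact ⟨rhoSum_tendsto hP hm _ M, phiSum_tendsto hP ψ₀ _ M⟩
  · have hpow : ∀ {k : ℕ}, k ≠ 0 → Tendsto (fun t => P.tau t ^ k) atTop (nhds 0) := fun {k} hk => by
      simpa [hk] using (tendsto_tau hP).pow k
    obtain ⟨h1, h2⟩ := h 0
    have h3 := (h1.trans_tendsto (hpow (by omega))).add
      (rhoSum_tendsto hP hm (P.rhoCoeff N n m ψ₀) 0)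
    have h4 := (h2.trans_tendsto (hpow (by omega))).add
      (phiSum_tendsto hP ψ₀ (P.phiCoeff N n m ψ₀) 0)
    rw [zero_add] at h3 h4
    exact ⟨h3.congr fun t => sub_add_cancel _ _, h4.congr fun t => sub_add_cancel _ _⟩

theorem IsRegime.eventually_dist (hP : P.Standing) {N n m : ℕ} (hm : 2 ≤ m) {ψ₀ : ℝ} {ϱ ϕ : ℝ → ℝ}
    (h : P.IsRegime N n m ψ₀ ϱ ϕ) {ζ : ℝ} (hζ : 0 < ζ) :
    ∀ᶠ t in atTop, ∀ r φ : ℝ → ℝ,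
      |P.regimeDist ϱ ϕ t (r t) (φ t) - P.limitDist ψ₀ r φ t| ≤ ζ := by
  obtain ⟨h1, h2⟩ := h.tendsto hP hm
  have h3 : Tendsto (fun t => |P.tau t * ϱ t| + |ϕ t - ψ₀|) atTop (nhds (|0 * 0| + |ψ₀ - ψ₀|)) :=
    ((tendsto_tau hP).mul h1).abs.add (h2.sub_const ψ₀).abs
  rw [mul_zero, sub_self, abs_zero, add_zero] at h3
  filter_upwards [h3.eventually_le_const hζ] with t ht r φ
  refine le_trans ?_ ht
  have e1 := abs_abs_sub_abs_le_abs_sub (r t - P.a - P.tau t * ϱ t) (r t - P.a)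
  have e2 := abs_abs_sub_abs_le_abs_sub (P.shift φ t - ϕ t) (P.shift φ t - ψ₀)
  rw [sub_sub_cancel_left, abs_neg] at e1
  rw [sub_sub_sub_cancel_left, abs_sub_comm ψ₀] at e2
  have e : P.regimeDist ϱ ϕ t (r t) (φ t) - P.limitDist ψ₀ r φ t =
      (|r t - P.a - P.tau t * ϱ t| - |r t - P.a|) + (|P.shift φ t - ϕ t| - |P.shift φ t - ψ₀|) := by
    rw [regimeDist, limitDist, shift]; ring
  rw [e]
  exact (abs_add_le _ _).trans (add_le_add e1 e2)

theorem _root_.ContinuousOn.exists_first_time {f : ℝ → ℝ} {a b c : ℝ}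
    (hf : ContinuousOn f (Set.Icc a b)) (ha : f a < c) (hb : ∃ t ∈ Set.Icc a b, c ≤ f t) :
    ∃ t, a < t ∧ t ≤ b ∧ f t = c ∧ ∀ s ∈ Set.Icc a t, f s ≤ c := by
  have ivt : ∀ t ∈ Set.Icc a b, c ≤ f t → ∃ s ∈ Set.Icc a t, f s = c := fun t ht hc =>
    intermediate_value_Icc ht.1 (hf.mono (Set.Icc_subset_Icc_right ht.2)) ⟨ha.le, hc⟩
  have hcl : IsCompact (Set.Icc a b ∩ f ⁻¹' {c}) :=
    isCompact_Icc.of_isClosed_subset (hf.preimage_isClosed_of_isClosed isClosed_Icc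
      isClosed_singleton) Set.inter_subset_left
  obtain ⟨t₁, ht₁, hc₁⟩ := hb
  obtain ⟨s₁, hs₁, hs₁'⟩ := ivt t₁ ht₁ hc₁
  obtain ⟨t, ⟨htI, htc⟩, hmin⟩ := hcl.exists_isLeast ⟨s₁, ⟨hs₁.1, hs₁.2.trans ht₁.2⟩, hs₁'⟩
  refine ⟨t, htI.1.lt_of_ne ?_, htI.2, htc, fun s hs => ?_⟩
  · rintro rfl
    exact ha.ne htc
  · by_contra! hlt
    obtain ⟨s', hs', hs'c⟩ := ivt s ⟨hs.1, hs.2.trans htI.2⟩ hlt.le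
    have h1 : t ≤ s' := hmin ⟨⟨hs'.1, hs'.2.trans (hs.2.trans htI.2)⟩, hs'c⟩
    have h2 : s = t := le_antisymm hs.2 (h1.trans hs'.2)
    rw [h2, show f t = c from htc] at hlt
    exact lt_irrefl _ hlt

/-- Until the distance from the limit regime reaches a small value, the solution exists. -/
theorem exists_solution_until (hP : P.Standing) {ψ₀ ε ts te rs φs : ℝ} (hts : 0 < ts) (hte : ts < te)
    (hε1 : ε ≤ 1) (hεR : ε ≤ P.Rmax - |P.a|)
    (hs : P.limitDist ψ₀ (fun _ => rs) (fun _ => φs) ts < ε)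
    (hexit : ∀ r φ, P.IsSolution r φ ts te → r ts = rs → φ ts = φs →
      ∃ t ∈ Set.Icc ts te, ε ≤ P.limitDist ψ₀ r φ t) :
    ∃ t r φ, ts < t ∧ P.IsSolution r φ ts t ∧ r ts = rs ∧ φ ts = φs ∧
      P.limitDist ψ₀ r φ t = ε := by
  obtain ⟨M, hM⟩ := isCompact_Icc.exists_bound_of_continuousOn
    ((continuousOn_phase (t₂ := te) hP hts).const_smul ((P.κ : ℝ) / (P.ϰ : ℝ)))
  set B := |M| + |ψ₀| + 1 with hBdef
  obtain ⟨p, hp0, hp⟩ := exists_clamped_solution hP hts hte (B := B) (by positivity) (rs, φs)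
  set r : ℝ → ℝ := fun t => (p t).1 with hr
  set φ : ℝ → ℝ := fun t => (p t).2 with hφ
  have hr0 : r ts = rs := by simp [hr, hp0]
  have hφ0 : φ ts = φs := by simp [hφ, hp0]
  have hpc : ContinuousOn p (Set.Icc ts te) := fun t ht => (hp t ht).continuousWithinAt
  have hrc : ContinuousOn r (Set.Icc ts te) := continuous_fst.comp_continuousOn hpc
  have hφc : ContinuousOn φ (Set.Icc ts te) := continuous_snd.comp_continuousOn hpc
  have hcont : ContinuousOn (P.limitDist ψ₀ r φ) (Set.Icc ts te) :=
    (hrc.sub continuousOn_const).abs.add (((hφc.sub (continuousOn_const.mul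
      (continuousOn_phase hP hts))).sub continuousOn_const).abs)
  have hs' : P.limitDist ψ₀ r φ ts < ε := by
    simp only [limitDist, shift, hr0, hφ0]
    exact hs
  have hsol : ∀ t, t ≤ te → (∀ s ∈ Set.Icc ts t, P.limitDist ψ₀ r φ s ≤ ε) →
      P.IsSolution r φ ts t := fun t ht hD => by
    rw [isSolution_iff]
    intro s hs
    have hsI : s ∈ Set.Icc ts te := ⟨hs.1, hs.2.trans ht⟩
    have h1 := hD s hs
    rw [limitDist] at h1
    have h2 := abs_nonneg (r s - P.a)
    have h3 := abs_nonneg (P.shift φ s - ψ₀)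
    have h4 : |r s| ≤ P.Rmax := by
      have := abs_add_le (r s - P.a) P.a
      rw [sub_add_cancel] at this
      linarith
    have h5 : |φ s| ≤ B := by
      have h6 := abs_add_three (P.shift φ s - ψ₀) ψ₀ ((P.κ : ℝ) / (P.ϰ : ℝ) * P.phase s)
      rw [show P.shift φ s - ψ₀ + ψ₀ + (P.κ : ℝ) / (P.ϰ : ℝ) * P.phase s = φ s by
        rw [shift]; ring] at h6
      have h7 : |(P.κ : ℝ) / (P.ϰ : ℝ) * P.phase s| ≤ M := hM s hsI
      have := le_abs_self M
      linarith
    have h6 := hp s hsI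
    rw [clamp_of_mem (show p s ∈ P.box B from ⟨abs_le.1 h4, abs_le.1 h5⟩)] at h6
    exact ⟨h4, h6.mono (Set.Icc_subset_Icc_right ht)⟩
  have hex : ∃ t ∈ Set.Icc ts te, ε ≤ P.limitDist ψ₀ r φ t := by
    by_contra! hcon
    obtain ⟨t, ht, hge⟩ := hexit r φ (hsol te le_rfl fun s hs => (hcon s hs).le) hr0 hφ0
    exact absurd hge (not_le.2 (hcon t ht))
  obtain ⟨t, h1, h2, h3, h4⟩ := hcont.exists_first_time hs' hex
  exact ⟨t, r, φ, h1, hsol t h2 h4, hr0, hφ0, h3⟩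

end OscSystem

theorem mainTheorem5 (P : OscSystem) (hP : P.Standing) (n m h : ℕ) (ψ₀ : ℝ)
    (hnm : P.LeadingOrders n m) (hψ₀ : P.IsEquilibrium n ψ₀)
    (hdiv : P.DivergenceOrder n m h ψ₀)
    (hν : P.nu n ψ₀ * P.eta < 0) (hd : 0 < P.divergence h 0 ψ₀)
    (hh : h + n - 1 < 2 * P.q) :
    ∃ N₀ : ℕ, 0 < N₀ ∧ ∃ ε : ℝ, 0 < ε ∧
      ∀ δ : ℝ, 0 < δ → δ < ε → ∀ N : ℕ, N₀ ≤ N →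
      ∀ ϱ ϕ : ℝ → ℝ, P.IsRegime N n m ψ₀ ϱ ϕ →
      ∀ δ₀ : ℝ, 0 < δ₀ → δ₀ ≤ δ →
      ∃ T : ℝ, 0 < T ∧ ∀ ts : ℝ, T ≤ ts → ∀ rs φs : ℝ,
        δ₀ ≤ P.regimeDist ϱ ϕ ts rs φs → P.regimeDist ϱ ϕ ts rs φs ≤ δ →
        ∃ te : ℝ, ts < te ∧
          (∃ r φ : ℝ → ℝ, P.IsSolution r φ ts te ∧ r ts = rs ∧ φ ts = φs) ∧
          ∀ r φ : ℝ → ℝ, P.IsSolution r φ ts te → r ts = rs → φ ts = φs →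
            ε ≤ P.regimeDist ϱ ϕ te (r te) (φ te) := by
  obtain ⟨ε₀, hε₀, hexit⟩ := OscSystem.exists_exit hP hnm hψ₀ hdiv hν hd hh
  have hR : 0 < P.Rmax - |P.a| := sub_pos.2 hP.a_lt
  set ε₁ := min ε₀ (min 1 (P.Rmax - |P.a|)) with hε₁
  have hε₁0 : 0 < ε₁ := by positivity
  refine ⟨1, one_pos, ε₁ / 2, by positivity, fun δ hδ hδε N _ ϱ ϕ hreg δ₀ hδ₀ hδδ => ?_⟩
  obtain ⟨T₁, hT₁, hexit⟩ := hexit (δ₀ / 2) (by positivity)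
  obtain ⟨T₂, hT₂⟩ := eventually_atTop.1 (hreg.eventually_dist hP hnm.m_mem.1
    (show 0 < δ₀ / 2 by positivity))
  refine ⟨max T₁ T₂, by positivity, fun ts hts rs φs hlow hup => ?_⟩
  obtain ⟨te, hte, hexit⟩ := hexit ts ((le_max_left _ _).trans hts)
  have hts0 : 0 < ts := by linarith [(le_max_left _ _).trans hts]
  have hclose := fun t (ht : ts ≤ t) => hT₂ t (((le_max_right _ _).trans hts).trans ht)
  have hs := abs_le.1 (hclose ts le_rfl (fun _ => rs) (fun _ => φs))
  obtain ⟨t, r, φ, htt, hsol, hr0, hφ0, hD⟩ := OscSystem.exists_solution_until hP (ψ₀ := ψ₀)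
    (ε := ε₁) (rs := rs) (φs := φs) hts0 hte ((min_le_right _ _).trans (min_le_left _ _))
    ((min_le_right _ _).trans (min_le_right _ _)) (by linarith) (fun r φ hsol hr0 hφ0 => by
      obtain ⟨t, ht, hge⟩ := hexit r φ hsol (by
        have : P.limitDist ψ₀ r φ ts = P.limitDist ψ₀ (fun _ => rs) (fun _ => φs) ts := by
          simp only [OscSystem.limitDist, OscSystem.shift, hr0, hφ0]
        rw [this]
        linarith)
      exact ⟨t, ht, (min_le_left _ _).trans hge⟩)
  refine ⟨t, htt, ⟨r, φ, hsol, hr0, hφ0⟩, fun r' φ' hsol' hr' hφ' => ?_⟩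
  obtain ⟨h1, h2⟩ := hsol'.unique hP hts0 htt hsol (hr'.trans hr0.symm) (hφ'.trans hφ0.symm) t
    (Set.right_mem_Icc.2 htt.le)
  rw [h1, h2]
  have := abs_le.1 (hclose t htt.le r φ)
  linarith
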